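/- All graphs are finite, simple, undirected and connected; $d(u,v)$ is the distance. A set $S\subseteq V(G)$ is a \emph{strong geodetic set} of $G$ if one can fix one shortest $u,v$-path for every unordered pair $\{u,v\}\subseteq S$ so that every vertex of $V(G)\setminus S$ lies on one of the fixed paths; it is \emph{minimum} if its cardinality is smallest possible. A \emph{cactus} is a connected graph in which every edge belongs to at most one simple cycle. A \emph{cut-vertex} is a vertex whose removal increases the number of connected components, a \emph{block} is a maximal connected subgraph without cut-vertices of its own, and the \emph{cut-tree} $T$ of $G$ has as nodes the blocks and the cut-vertices of $G$, a cut-vertex $a$ being joined to a block $B$ exactly when $a\in B$. Each block of a cactus with at least two vertices is an edge or a cycle. Consider the following algorithm for a cactus $G$ whose cut-tree $T$ has at least two nodes. Start with $S=\emptyset$. (1) For each block $\ell$ that is a leaf of $T$, in any order: if $\ell$ is an edge, add to $S$ its simplicial end (the end whose neighbourhood is a clique). If $\ell$ is a cycle of length $l$ with cut-vertex $a$: if $l$ is even, add the vertex $v\in\ell$ with $d(a,v)=l/2$; if $l$ is odd, add the two vertices $u,v\in\ell$ with $d(a,u)=d(a,v)=\lfloor l/2\rfloor$. (2) For each block that is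 an internal node of $T$, in any order: if it is an edge, do nothing. If it is a cycle $C$ of length $l$, let $A$ be the set of cut-vertices of $G$ in $C$. If $l$ is even and some $a_1,a_2\in A$ satisfy $d(a_1,a_2)=l/2$, do nothing. Otherwise, if the (unique) shortest paths in $C$ between vertices of $A$ together contain all vertices of $C$, do nothing; if they do not, choose any distinct $x_1,x_k\in A$, let $(x_1,x_2,\dots,x_k)$ be the longest path between them in $C$, and add $x_j$ with $j=\lfloor (1+k)/2\rfloor$ to $S$. (3) If now $|S|\le 2$ and some block of $G$ is an even cycle, add to $S$ an arbitrary vertex of $V(G)\setminus S$. Return $S$. \textbf{Theorem.} (a) For every cactus $G$ whose cut-tree has at least two nodes, the algorithm can be carried out, and, whatever choices are made, the returned set is a minimum strong geodetic set of $G$. (b) There is a polynomial-time algorithm (a random-access program with unit-cost addition, subtraction and comparison, running in time polynomial in $n=|V(G)|$) that, given the adjacency matrix of a cactus $G$, outputs a minimum strong geodetic set of $G$, which is a set returned by the algorithm above whenever the cut-tree of $G$ has at least two nodes. (c) Consequently the problem \textsc{Strong Geodetic} on cacti (given a cactus $G$ and an integer $k$, does $G$ have a strong geodetic set of cardinality at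 most $k$?) is solvable in polynomial time. -/

import Mathlib

universe u

namespace StrongGeodetic

section Graphs

variable {V : Type u}

/-- `S` is a strong geodetic set: one can fix a single shortest path for every (unordered) pair of
vertices of `S` so that every vertex outside `S` lies on one of the fixed paths. -/
def IsStrongGeodeticSet (G : SimpleGraph V) (S : Finset V) : Prop :=
  ∃ P : ∀ x y : {x // x ∈ S}, G.Walk x.1 y.1,
    (∀ x y, (P x y).length = G.dist x.1 y.1) ∧
    (∀ x y, P y x = (P x y).reverse) ∧
    ∀ w, w ∉ S → ∃ x y, w ∈ (P x y).support

/-- A strong geodetic set of minimum cardinality. -/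
def IsMinimumStrongGeodeticSet (G : SimpleGraph V) (S : Finset V) : Prop :=
  IsStrongGeodeticSet G S ∧ ∀ S' : Finset V, IsStrongGeodeticSet G S' → S.card ≤ S'.card

/-- A cactus: a connected graph in which every edge belongs to at most one simple cycle
(cycles being regarded as subgraphs). -/
def IsCactus (G : SimpleGraph V) : Prop :=
  G.Connected ∧
    ∀ (x y : V) (c : G.Walk x x) (d : G.Walk y y), c.IsCycle → d.IsCycle →
      ∀ e, e ∈ c.edges → e ∈ d.edges → c.toSubgraph = d.toSubgraph

/-- `v` is a cut-vertex (of a finite graph): `G - v` has more connected components than `G`. -/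
def IsCutVertex (G : SimpleGraph V) (v : V) : Prop :=
  Nat.card G.ConnectedComponent < Nat.card (G.induce {v}ᶜ).ConnectedComponent

/-- A simplicial vertex: its neighbourhood is a clique. -/
def IsSimplicial (G : SimpleGraph V) (v : V) : Prop :=
  G.IsClique (G.neighborSet v)

/-- A connected graph without cut-vertices. -/
def IsBiconnected (G : SimpleGraph V) : Prop :=
  G.Connected ∧ ∀ v, ¬ IsCutVertex G v

/-- The vertex sets of the biconnected components (blocks) of `G`, i.e. of the maximal biconnected
subgraphs; these are induced subgraphs, so they are given by their vertex sets. -/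
def IsBlock (G : SimpleGraph V) (B : Finset V) : Prop :=
  Maximal (fun B : Finset V => IsBiconnected (G.induce (B : Set V))) B

/-- The nodes of the cut-tree: the blocks and the cut-vertices of `G`. -/
abbrev CutTreeNode (G : SimpleGraph V) : Type u :=
  {B : Finset V // IsBlock G B} ⊕ {a : V // IsCutVertex G a}

/-- The cut-tree: a cut-vertex `a` is joined to a block `B` exactly when `a ∈ B`. -/
def cutTree (G : SimpleGraph V) : SimpleGraph (CutTreeNode G) where
  Adj
    | .inl B, .inr a => a.1 ∈ B.1
    | .inr a, .inl B => a.1 ∈ B.1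
    | _, _ => False
  symm := ⟨by rintro (B | a) (B' | a') h <;> exact h⟩
  loopless := ⟨by rintro (B | a) h <;> exact h⟩

/-- `B` is a block that is a leaf of the cut-tree. -/
def IsLeafBlock (G : SimpleGraph V) (B : Finset V) : Prop :=
  ∃ h : IsBlock G B, ((cutTree G).neighborSet (.inl ⟨B, h⟩)).ncard = 1

/-- `B` is a block that is an internal node of the cut-tree. -/
def IsInternalBlock (G : SimpleGraph V) (B : Finset V) : Prop :=
  ∃ h : IsBlock G B, ((cutTree G).neighborSet (.inl ⟨B, h⟩)).ncard ≠ 1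

/-- `C` is the vertex set of a cycle of `G` (whose length is then `C.card`). -/
def IsCycleOn (G : SimpleGraph V) (C : Finset V) : Prop :=
  ∃ (x : V) (c : G.Walk x x), c.IsCycle ∧ ∀ w, w ∈ c.support ↔ w ∈ C

/-- `P` is a path all of whose vertices lie in `C`. -/
def IsPathIn {G : SimpleGraph V} (C : Finset V) {x y : V} (P : G.Walk x y) : Prop :=
  P.IsPath ∧ ∀ w ∈ P.support, w ∈ C

/-- `P` is a shortest path between its ends inside `C`. -/
def IsShortestPathIn {G : SimpleGraph V} (C : Finset V) {x y : V} (P : G.Walk x y) : Prop :=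
  IsPathIn C P ∧ ∀ Q : G.Walk x y, IsPathIn C Q → P.length ≤ Q.length

/-- `P` is a longest path between its ends inside `C`. -/
def IsLongestPathIn {G : SimpleGraph V} (C : Finset V) {x y : V} (P : G.Walk x y) : Prop :=
  IsPathIn C P ∧ ∀ Q : G.Walk x y, IsPathIn C Q → Q.length ≤ P.length

/-- Every vertex of `C` lies on a shortest path in `C` between two cut-vertices of `G` in `C`. -/
def CoveredByCutVertices (G : SimpleGraph V) (C : Finset V) : Prop :=
  ∀ w ∈ C, ∃ p ∈ C, ∃ q ∈ C, IsCutVertex G p ∧ IsCutVertex G q ∧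
    ∃ P : G.Walk p q, IsShortestPathIn C P ∧ w ∈ P.support

/-- `C` contains two cut-vertices of `G` at distance half the length of the (even) cycle `C`. -/
def HasAntipodalCutVertices (G : SimpleGraph V) (C : Finset V) : Prop :=
  ∃ p ∈ C, ∃ q ∈ C, IsCutVertex G p ∧ IsCutVertex G q ∧ G.dist p q = C.card / 2

/-- `v` is the vertex `x_j`, `j = ⌊(1 + k) / 2⌋`, of a longest path `x_1, …, x_k` in `C` between
two distinct cut-vertices `x_1`, `x_k` of `G` (`getVert` counts the vertices from `0`). -/
def IsMiddleVertex (G : SimpleGraph V) (C : Finset V) (v : V) : Prop :=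
  ∃ x ∈ C, ∃ y ∈ C, IsCutVertex G x ∧ IsCutVertex G y ∧ x ≠ y ∧
    ∃ P : G.Walk x y, IsLongestPathIn C P ∧ v = P.getVert ((1 + P.support.length) / 2 - 1)

end Graphs

section Procedure

variable {V : Type u} [DecidableEq V]

/-- `LeafStep G B X`: processing the leaf block `B`, the algorithm may add the vertices `X`. -/
inductive LeafStep (G : SimpleGraph V) : Finset V → Finset V → Prop
  | edge (x y : V) : G.Adj x y → IsSimplicial G x → LeafStep G {x, y} {x}
  | evenCycle (C : Finset V) (a v : V) : IsCycleOn G C → Even C.card →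
      a ∈ C → IsCutVertex G a → v ∈ C → G.dist a v = C.card / 2 → LeafStep G C {v}
  | oddCycle (C : Finset V) (a x y : V) : IsCycleOn G C → Odd C.card →
      a ∈ C → IsCutVertex G a → x ∈ C → y ∈ C → x ≠ y →
      G.dist a x = C.card / 2 → G.dist a y = C.card / 2 → LeafStep G C {x, y}

/-- `InternalStep G B X`: processing the internal block `B`, the algorithm may add the
vertices `X`. -/
inductive InternalStep (G : SimpleGraph V) : Finset V → Finset V → Prop
  | edge (x y : V) : G.Adj x y → InternalStep G {x, y} ∅
  | oddCovered (C : Finset V) : IsCycleOn G C → Odd C.card →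
      CoveredByCutVertices G C → InternalStep G C ∅
  | oddUncovered (C : Finset V) (v : V) : IsCycleOn G C → Odd C.card →
      ¬ CoveredByCutVertices G C → IsMiddleVertex G C v → InternalStep G C {v}
  | evenAntipodal (C : Finset V) : IsCycleOn G C → Even C.card →
      HasAntipodalCutVertices G C → InternalStep G C ∅
  | evenCovered (C : Finset V) : IsCycleOn G C → Even C.card →
      ¬ HasAntipodalCutVertices G C → CoveredByCutVertices G C → InternalStep G C ∅
  | evenUncovered (C : Finset V) (v : V) : IsCycleOn G C → Even C.card →
      ¬ HasAntipodalCutVertices G C → ¬ CoveredByCutVertices G C →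
      IsMiddleVertex G C v → InternalStep G C {v}

/-- `Pass step Bs S S'`: processing the blocks in the list `Bs` one after the other by `step`
turns the current set `S` into `S'`. -/
inductive Pass (step : Finset V → Finset V → Prop) :
    List (Finset V) → Finset V → Finset V → Prop
  | nil (S : Finset V) : Pass step [] S S
  | cons (B : Finset V) (Bs : List (Finset V)) (X S S' : Finset V) :
      step B X → Pass step Bs (S ∪ X) S' → Pass step (B :: Bs) S S'

/-- The last step: if fewer than three vertices were chosen and some block is an even cycle, then
an arbitrary further vertex is added. -/
inductive FinalStep (G : SimpleGraph V) : Finset V → Finset V → Prop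
  | large (S : Finset V) : 3 ≤ S.card → FinalStep G S S
  | evenBlock (S : Finset V) (w : V) : S.card < 3 →
      (∃ C, IsBlock G C ∧ IsCycleOn G C ∧ Even C.card) → w ∉ S → FinalStep G S (insert w S)
  | noEvenBlock (S : Finset V) : S.card < 3 →
      ¬ (∃ C, IsBlock G C ∧ IsCycleOn G C ∧ Even C.card) → FinalStep G S S

/-- `S` is a possible result of the (nondeterministic) algorithm on `G`: starting from `∅`,
process all leaf blocks of the cut-tree in some order, then all internal blocks in some order,
then perform the last step. -/
def IsAlgorithmOutput (G : SimpleGraph V) (S : Finset V) : Prop :=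
  ∃ (leaves internals : List (Finset V)) (S₀ S₁ : Finset V),
    leaves.Nodup ∧ (∀ B, B ∈ leaves ↔ IsLeafBlock G B) ∧
    internals.Nodup ∧ (∀ B, B ∈ internals ↔ IsInternalBlock G B) ∧
    Pass (LeafStep G) leaves ∅ S₀ ∧ Pass (InternalStep G) internals S₀ S₁ ∧ FinalStep G S₁ S

end Procedure

/-! ### Random-access programs with unit cost

A program has scalar variables and arrays, named by natural numbers; each variable and each array
cell holds a natural number. The arithmetic operations are addition and truncated subtraction
(no multiplication), so that unit-cost time is polynomially related to Turing machine time. -/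

/-- The memory: values of the variables and contents of the arrays. -/
structure Store where
  var : ℕ → ℕ
  arr : ℕ → ℕ → ℕ

/-- Expressions; `get a i` reads the cell of the array `a` at the value of `i`. -/
inductive Expr
  | const (m : ℕ)
  | var (x : ℕ)
  | get (a : ℕ) (i : Expr)
  | add (e f : Expr)
  | sub (e f : Expr)

/-- The value of an expression. -/
def Expr.eval (s : Store) : Expr → ℕ
  | .const m => m
  | .var x => s.var x
  | .get a i => s.arr a (i.eval s)
  | .add e f => e.eval s + f.eval s
  | .sub e f => e.eval s - f.eval s

/-- The number of operations made to evaluate an expression. -/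
def Expr.cost : Expr → ℕ
  | .const _ => 1
  | .var _ => 1
  | .get _ i => i.cost + 1
  | .add e f => e.cost + f.cost + 1
  | .sub e f => e.cost + f.cost + 1

/-- Programs; a test succeeds when the expression is nonzero. -/
inductive Program
  | skip
  | assign (x : ℕ) (e : Expr)
  | store (a : ℕ) (i e : Expr)
  | seq (p q : Program)
  | ite (e : Expr) (p q : Program)
  | loop (e : Expr) (p : Program)

/-- `Exec p s s' t`: started in `s`, the program `p` halts in `s'` after exactly `t` steps.
(`loop e p` runs `p` as long as `e` is nonzero.) -/
inductive Exec : Program → Store → Store → ℕ → Prop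
  | skip (s : Store) : Exec .skip s s 1
  | assign (x : ℕ) (e : Expr) (s : Store) :
      Exec (.assign x e) s ⟨Function.update s.var x (e.eval s), s.arr⟩ (e.cost + 1)
  | store (a : ℕ) (i e : Expr) (s : Store) :
      Exec (.store a i e) s
        ⟨s.var, Function.update s.arr a (Function.update (s.arr a) (i.eval s) (e.eval s))⟩
        (i.cost + e.cost + 1)
  | seq {p q : Program} {s s' s'' : Store} {t t' : ℕ} :
      Exec p s s' t → Exec q s' s'' t' → Exec (.seq p q) s s'' (t + t')
  | iteTrue {e : Expr} {p q : Program} {s s' : Store} {t : ℕ} :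
      e.eval s ≠ 0 → Exec p s s' t → Exec (.ite e p q) s s' (e.cost + 1 + t)
  | iteFalse {e : Expr} {p q : Program} {s s' : Store} {t : ℕ} :
      e.eval s = 0 → Exec q s s' t → Exec (.ite e p q) s s' (e.cost + 1 + t)
  | loopDone {e : Expr} {p : Program} {s : Store} :
      e.eval s = 0 → Exec (.loop e p) s s (e.cost + 1)
  | loopStep {e : Expr} {p : Program} {s s' s'' : Store} {t t' : ℕ} :
      e.eval s ≠ 0 → Exec p s s' t → Exec (.loop e p) s' s'' t' →
      Exec (.loop e p) s s'' (e.cost + 1 + t + t')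

open Classical in
/-- The initial memory for a graph `G` on `{0, …, n - 1}` and a number `k`: variable `0` holds `n`,
variable `1` holds `k`, array `0` holds the adjacency matrix row by row, and all the rest is `0`. -/
noncomputable def inputStore {n : ℕ} (G : SimpleGraph (Fin n)) (k : ℕ) : Store where
  var x := if x = 0 then n else if x = 1 then k else 0
  arr a m := if a = 0 ∧ ∃ i j : Fin n, m = i.val * n + j.val ∧ G.Adj i j then 1 else 0

/-- The vertex set written by a program: the support of array `1` on `{0, …, n - 1}`. -/
def outputSet (n : ℕ) (s : Store) : Finset (Fin n) :=
  Finset.univ.filter fun i => s.arr 1 i.val ≠ 0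

end StrongGeodetic

/-! Everything rests on gates. Deleting the edges of a cycle of a cactus, or a bridge, leaves its
vertices in different components; so every vertex `x` has a gate `g x` in such a block `B`, through
which all walks from `x` to `B` pass. A geodesic between vertices with different gates enters `B` at
one gate, runs inside `B` and leaves it at the other, and a vertex of `B` between `x` and `y` is
between `g x` and `g y` (`IsGate.dist_gate_add`). A vertex of a block is a cut-vertex exactly when
it is the gate of some other vertex (`IsBlock.isCutVertex_iff_exists`), and a vertex that is no
cut-vertex lies in one block only (`IsBlock.eq_of_not_isCutVertex`).

Lower bound: the gates in `B` of the members of a strong geodetic set `S'` are cut-vertices or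
members of `S'` in `B` that are no cut-vertices. At least as many of the second kind are needed as
the algorithm adds for `B` (`LeafStep.card_le`, `InternalStep.card_le`), and for different blocks
these parts of `S'` are disjoint. Moreover a cycle forces three vertices, because one geodesic
cannot contain both cycle neighbours of the gate of its start (`IsStrongGeodeticSet.three_le_card`);
this pays for the last step.

Upper bound: each leaf block supplies a member of `S` off its cut-vertex, so `S` meets every
component of the graph minus a cut-vertex (`exists_mem_avoiding`). Hence cut-vertices are covered,
and each cut-vertex of a block is the gate of a member of `S`. In a cycle of length `l`, gates less
than `l / 2` apart have a unique geodesic, so nothing has to be chosen; an antipodal pair covers one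
half of the cycle, and a third member of `S` takes care of the other. Choices in different cycles
are independent, since the part of a geodesic inside a block can be exchanged without touching the
rest (`IsGate.exists_exchange`); so the local coverings glue
(`isStrongGeodeticSet_of_locallyCovered`).

For polynomial time, ties are broken by a numbering of the vertices. Membership in the resulting set
is then expressed by bounded quantifiers, distances and reachability avoiding a vertex, a block
being named by one or two of its vertices (`blockAt`). A small language of terms with bounded sums
and iterated updates expresses all this and compiles to programs with a polynomial time bound
(`Term.exec_compile`). A cactus without cut-vertices is a vertex, an edge or a cycle, and is treated
directly. -/

namespace StrongGeodetic

/-! ### Cut-vertices and gated sets -/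

section Gates

variable {V : Type u} {G : SimpleGraph V}

theorem reachable_induce_compl_iff {v : V} (u w : ↥({v}ᶜ : Set V)) :
    (G.induce {v}ᶜ).Reachable u w ↔ ∃ p : G.Walk u.1 w.1, v ∉ p.support := by
  constructor
  · rintro ⟨p⟩
    refine ⟨p.map (SimpleGraph.Embedding.induce _).toHom, fun h => ?_⟩
    obtain ⟨z, _, hz⟩ := List.mem_map.1
      ((SimpleGraph.Walk.support_map (SimpleGraph.Embedding.induce _).toHom p) ▸ h)
    exact z.2 hz
  · rintro ⟨p, hp⟩
    exact ⟨p.induce {v}ᶜ (fun x hx h => hp (by rw [Set.mem_singleton_iff] at h; rwa [h] at hx))⟩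

theorem isCutVertex_iff [Finite V] (hG : G.Connected) {v : V} :
    IsCutVertex G v ↔ ∃ u w, u ≠ v ∧ w ≠ v ∧ ∀ p : G.Walk u w, v ∈ p.support := by
  have h1 : Nat.card G.ConnectedComponent = 1 := by
    rw [Nat.card_eq_one_iff_unique]
    have := hG.preconnected.subsingleton_connectedComponent
    have := hG.nonempty
    exact ⟨inferInstance, inferInstance⟩
  rw [IsCutVertex, h1, Finite.one_lt_card_iff_nontrivial]
  constructor
  · rintro ⟨a, b, hab⟩
    induction a using SimpleGraph.ConnectedComponent.ind with | _ a
    induction b using SimpleGraph.ConnectedComponent.ind with | _ b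
    rw [Ne, SimpleGraph.ConnectedComponent.eq, reachable_induce_compl_iff] at hab
    push Not at hab
    exact ⟨a.1, b.1, a.2, b.2, hab⟩
  · rintro ⟨u, w, hu, hw, h⟩
    refine ⟨(G.induce {v}ᶜ).connectedComponentMk ⟨u, hu⟩,
      (G.induce {v}ᶜ).connectedComponentMk ⟨w, hw⟩, ?_⟩
    rw [Ne, SimpleGraph.ConnectedComponent.eq, reachable_induce_compl_iff]
    push Not
    exact h

/-- `g` retracts the graph onto `B` so that an edge is contracted unless it lies inside `B`. -/
structure IsGate (G : SimpleGraph V) (B : Finset V) (g : V → V) : Prop where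
  mem : ∀ x, g x ∈ B
  fix : ∀ x ∈ B, g x = x
  adj : ∀ x y, G.Adj x y → g x = g y ∨ (x ∈ B ∧ y ∈ B)

variable {B : Finset V} {g : V → V}

/-- The gate changes only along edges inside `B`, so it is constant until the walk first meets `B`,
and there the vertex is its own gate. -/
theorem IsGate.mem_support (h : IsGate G B g) {x w : V} (p : G.Walk x w) (hw : w ∈ B) :
    g x ∈ p.support := by
  induction p with
  | nil => simp [h.fix _ hw]
  | cons ha p ih =>
    rcases h.adj _ _ ha with h1 | ⟨h1, _⟩
    · rw [h1]; exact List.mem_cons_of_mem _ (ih hw)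
    · rw [h.fix _ h1]; exact List.mem_cons_self

theorem IsGate.mem_support_of_ne (h : IsGate G B g) {x y : V} (p : G.Walk x y)
    (hne : g x ≠ g y) : g x ∈ p.support := by
  induction p with
  | nil => exact absurd rfl hne
  | cons ha p ih =>
    rcases h.adj _ _ ha with h1 | ⟨h1, _⟩
    · rw [h1]; exact List.mem_cons_of_mem _ (ih (h1 ▸ hne))
    · rw [h.fix _ h1]; exact List.mem_cons_self

theorem dist_add_dist_of_mem_support {x y w : V} (p : G.Walk x y)
    (hp : p.length = G.dist x y) (hw : w ∈ p.support) (hG : G.Connected) :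
    G.dist x w + G.dist w y = G.dist x y := by
  classical
  have h1 := SimpleGraph.dist_le (p.takeUntil w hw)
  have h2 := SimpleGraph.dist_le (p.dropUntil w hw)
  have h3 : (p.takeUntil w hw).length + (p.dropUntil w hw).length = p.length := by
    rw [← SimpleGraph.Walk.length_append, SimpleGraph.Walk.take_spec]
  have := hG.dist_triangle (u := x) (v := w) (w := y)
  omega

theorem IsGate.dist_eq (h : IsGate G B g) (hG : G.Connected) (x : V) {w : V} (hw : w ∈ B) :
    G.dist x w = G.dist x (g x) + G.dist (g x) w := by
  obtain ⟨p, hp⟩ := hG.exists_walk_length_eq_dist x w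
  exact (dist_add_dist_of_mem_support p hp (h.mem_support p hw) hG).symm

theorem IsGate.dist_eq_of_ne (h : IsGate G B g) (hG : G.Connected) {x y : V} (hne : g x ≠ g y) :
    G.dist x y = G.dist x (g x) + G.dist (g x) (g y) + G.dist (g y) y := by
  obtain ⟨p, hp⟩ := hG.exists_walk_length_eq_dist x y
  have h1 := dist_add_dist_of_mem_support p hp (h.mem_support_of_ne p hne) hG
  have h2 := h.dist_eq hG y (h.mem x)
  rw [G.dist_comm (u := y), G.dist_comm (u := y), G.dist_comm (u := g y) (v := g x)] at h2
  rw [G.dist_comm (u := g y) (v := y), G.dist_comm (u := y)]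
  omega

/-- The detours from `x` and `y` to their gates contribute the same amount to both sides and cancel.
This reduces covering a vertex of `B` to a question inside `B`. -/
theorem IsGate.dist_gate_add (h : IsGate G B g) (hG : G.Connected) {x y w : V} (hw : w ∈ B)
    (hd : G.dist x w + G.dist w y = G.dist x y) :
    G.dist (g x) w + G.dist w (g y) = G.dist (g x) (g y) := by
  have h1 := h.dist_eq hG x hw
  have h2 := h.dist_eq hG y hw
  have h3 := hG.dist_triangle (u := x) (v := g x) (w := y)
  have h4 := hG.dist_triangle (u := g x) (v := g y) (w := y)
  have h5 := hG.dist_triangle (u := g x) (v := w) (w := g y)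
  rw [G.dist_comm (u := y), G.dist_comm (u := y), G.dist_comm (u := g y) (v := w)] at h2
  rw [G.dist_comm (u := g y) (v := y), G.dist_comm (u := y)] at h4
  omega

/-- Geodesics between vertices of a gated set stay in the set. -/
theorem IsGate.mem_of_dist_add (h : IsGate G B g) (hG : G.Connected) {p q w : V} (hp : p ∈ B)
    (hq : q ∈ B) (hd : G.dist p w + G.dist w q = G.dist p q) : w ∈ B := by
  have h1 := h.dist_eq hG w hp
  have h2 := h.dist_eq hG w hq
  have h3 := hG.dist_triangle (u := p) (v := g w) (w := q)
  rw [G.dist_comm (u := w), G.dist_comm (u := g w) (v := p)] at h1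
  have h4 : G.dist w (g w) = 0 := by omega
  rw [hG.dist_eq_zero_iff] at h4
  rw [h4]; exact h.mem w

theorem IsGate.isCutVertex [Finite V] (h : IsGate G B g) (hG : G.Connected) {z q : V}
    (hz : z ≠ g z) (hq : q ∈ B) (hqz : q ≠ g z) : IsCutVertex G (g z) :=
  (isCutVertex_iff hG).2 ⟨z, q, hz, hqz, fun p => h.mem_support p hq⟩

/-- After the deletion every component contains a vertex of `B`, found by walking towards `B` up to
the first edge of `E`, and by `hsep` only one. Sending each component to that vertex is the gate. -/
theorem exists_isGate (hG : G.Connected) (E : Set (Sym2 V)) (hne : B.Nonempty)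
    (hE : ∀ x y, s(x, y) ∈ E → x ∈ B ∧ y ∈ B)
    (hsep : ∀ a ∈ B, ∀ b ∈ B, (G.deleteEdges E).Reachable a b → a = b) :
    ∃ g, IsGate G B g ∧ ∀ x, (G.deleteEdges E).Reachable x (g x) := by
  have key : ∀ x, ∃ a ∈ B, (G.deleteEdges E).Reachable x a := by
    intro x
    obtain ⟨b, hb⟩ := hne
    obtain ⟨p⟩ := hG.preconnected x b
    induction p with
    | nil => exact ⟨_, hb, SimpleGraph.Reachable.refl _⟩
    | @cons x y _ ha p ih =>
      by_cases he : s(x, y) ∈ E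
      · exact ⟨x, (hE _ _ he).1, SimpleGraph.Reachable.refl _⟩
      · obtain ⟨a, haB, har⟩ := ih hb
        refine ⟨a, haB, SimpleGraph.Reachable.trans ?_ har⟩
        exact SimpleGraph.Adj.reachable (by rw [SimpleGraph.deleteEdges_adj]; exact ⟨ha, he⟩)
  choose g hg hgr using key
  refine ⟨g, ⟨hg, fun x hx => ?_, fun x y ha => ?_⟩, hgr⟩
  · exact (hsep _ hx _ (hg x) (hgr x)).symm
  · by_cases he : s(x, y) ∈ E
    · exact Or.inr (hE _ _ he)
    · left
      refine hsep _ (hg x) _ (hg y) (((hgr x).symm.trans ?_).trans (hgr y))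
      exact SimpleGraph.Adj.reachable (by rw [SimpleGraph.deleteEdges_adj]; exact ⟨ha, he⟩)

/-- A biconnected vertex set sharing two vertices with a gated set is contained in it. -/
theorem IsGate.subset_of_isBiconnected [Finite V] (h : IsGate G B g) {B' : Finset V}
    (hB' : IsBiconnected (G.induce (B' : Set V))) {p q : V} (hp : p ∈ B) (hq : q ∈ B)
    (hpq : p ≠ q) (hp' : p ∈ B') (hq' : q ∈ B') : B' ⊆ B := by
  intro z hz
  by_contra hzB
  obtain ⟨q, hq, hq', hqz⟩ : ∃ q ∈ B, q ∈ B' ∧ q ≠ g z := by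
    by_cases hpz : p = g z
    · exact ⟨q, hq, hq', fun h' => hpq (hpz.trans h'.symm)⟩
    · exact ⟨p, hp, hp', hpz⟩
  have hw : ∀ p : (G.induce (B' : Set V)).Walk ⟨z, hz⟩ ⟨q, hq'⟩, ∃ hm : g z ∈ B',
      (⟨g z, hm⟩ : (B' : Set V)) ∈ p.support := by
    intro p
    have := h.mem_support (p.map (SimpleGraph.Embedding.induce _).toHom) hq
    rw [SimpleGraph.Walk.support_map] at this
    obtain ⟨y, hy, hyz⟩ := List.mem_map.1 this
    have hyz' : y.1 = g z := hyz
    exact ⟨hyz' ▸ y.2, by convert hy; exact hyz'.symm⟩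
  obtain ⟨p⟩ := hB'.1.preconnected ⟨z, hz⟩ ⟨q, hq'⟩
  obtain ⟨hm, _⟩ := hw p
  refine hB'.2 ⟨g z, hm⟩ ((isCutVertex_iff hB'.1).2 ⟨⟨z, hz⟩, ⟨q, hq'⟩, ?_, ?_, fun p => (hw p).2⟩)
  · intro h'
    have : z = g z := congrArg Subtype.val h'
    exact hzB (this ▸ h.mem z)
  · intro h'
    exact hqz (congrArg Subtype.val h')

end Gates

/-! ### Cycles of a cactus are gated and chordless -/

section Cycles

variable {V : Type u} {G : SimpleGraph V}

/-- `C` is the vertex set of a chordless cycle of length `l`, parametrized periodically by `f`,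
and `g` is a gate onto `C`. -/
structure IsGatedCycle (G : SimpleGraph V) (C : Finset V) (l : ℕ) (f : ℤ → V) (g : V → V) :
    Prop where
  three_le : 3 ≤ l
  per : ∀ i, f (i + l) = f i
  inj : ∀ i j, f i = f j → (l : ℤ) ∣ i - j
  mem_iff : ∀ w, w ∈ C ↔ ∃ i, f i = w
  adj : ∀ i, G.Adj (f i) (f (i + 1))
  chordless : ∀ i j, G.Adj (f i) (f j) → (l : ℤ) ∣ i - j - 1 ∨ (l : ℤ) ∣ i - j + 1
  gate : IsGate G C g

theorem int_eq_zero_of_dvd {l : ℕ} {x : ℤ} (h : (l : ℤ) ∣ x) (h1 : -(l : ℤ) < x) (h2 : x < l) :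
    x = 0 :=
  Int.eq_zero_of_abs_lt_dvd h (abs_lt.2 ⟨h1, h2⟩)

theorem dvd_of_dvd_of_eq {l x y : ℤ} (h : l ∣ x) (e : x = y) : l ∣ y := e ▸ h

theorem periodic_mul {α : Type*} {l : ℕ} {f : ℤ → α} (per : ∀ i, f (i + l) = f i) (i c : ℤ) :
    f (i + l * c) = f i := by
  have : Function.Periodic f (l : ℤ) := per
  have h := this.int_mul c i
  rwa [mul_comm] at h

/-- If the two edges agreed with opposite orientations, `l` would divide `2`. -/
theorem edge_inj {α : Type*} {l : ℕ} {f : ℤ → α} (hl : 3 ≤ l)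
    (inj : ∀ i j, f i = f j → (l : ℤ) ∣ i - j) {a b : ℤ}
    (h : s(f a, f (a + 1)) = s(f b, f (b + 1))) : (l : ℤ) ∣ a - b := by
  rw [Sym2.eq_iff] at h
  rcases h with ⟨h, _⟩ | ⟨h, h'⟩
  · exact inj _ _ h
  · exfalso
    have := dvd_sub (inj _ _ h') (inj _ _ h)
    have h2 : (l : ℤ) ∣ 2 := dvd_of_dvd_of_eq this (by ring)
    have := Int.le_of_dvd (by norm_num) h2
    omega

/-- Deleting the edges of the cycle must separate its vertices, which yields the gate by
`exists_isGate`. A chord would survive the deletion and join two of them. -/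
theorem exists_isGatedCycle (hG : IsCactus G) {x : V} (c : G.Walk x x) (hc : c.IsCycle)
    {C : Finset V} (hC : ∀ w, w ∈ c.support ↔ w ∈ C) :
    ∃ f g, IsGatedCycle G C c.length f g ∧ ∀ i, s(f i, f (i + 1)) ∈ c.edges := by
  classical
  obtain ⟨l, hl⟩ : ∃ l, l = c.length := ⟨_, rfl⟩
  have h3 : 3 ≤ l := hl ▸ hc.three_le_length
  obtain ⟨f, hf⟩ : ∃ f : ℤ → V, ∀ i, f i = c.getVert (i % l).toNat := ⟨_, fun _ => rfl⟩
  have hl0 : (0 : ℤ) < l := by omega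
  have hmod : ∀ i : ℤ, 0 ≤ i % l ∧ i % l < l := fun i =>
    ⟨Int.emod_nonneg _ hl0.ne', Int.emod_lt_of_pos _ hl0⟩
  have per : ∀ i, f (i + l) = f i := fun i => by rw [hf, hf, Int.add_emod_right]
  have inj : ∀ i j, f i = f j → (l : ℤ) ∣ i - j := by
    intro i j hij
    rw [hf, hf] at hij
    have h1 := hmod i
    have h2 := hmod j
    have := hc.getVert_injOn' (by simp only [Set.mem_ofPred_eq]; omega)
      (by simp only [Set.mem_ofPred_eq]; omega) hij
    exact Int.ModEq.dvd (show j % l = i % l by omega)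
  have hnat : ∀ r : ℕ, r ≤ l → f r = c.getVert r := by
    intro r hr
    rw [hf]
    rcases hr.eq_or_lt with rfl | hr
    · rw [Int.emod_self, hl, SimpleGraph.Walk.getVert_length]; simp
    · rw [Int.emod_eq_of_lt (by omega) (by omega)]; simp
  have hnat' : ∀ i : ℤ, ∃ r : ℕ, r < l ∧ f i = f r ∧ f (i + 1) = f (r + 1) := by
    intro i
    have h1 := hmod i
    refine ⟨(i % l).toNat, by omega, ?_, ?_⟩
    · rw [hf i, hnat _ (by omega)]
    · rw [Int.toNat_of_nonneg h1.1]
      conv_lhs => rw [← Int.emod_add_mul_ediv i l, add_right_comm, periodic_mul per]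
  have hmem : ∀ w, w ∈ C ↔ ∃ i, f i = w := by
    intro w
    rw [← hC, SimpleGraph.Walk.mem_support_iff_exists_getVert]
    constructor
    · rintro ⟨n, hn, hn'⟩
      exact ⟨n, by rw [hnat n (by omega), hn]⟩
    · rintro ⟨i, rfl⟩
      obtain ⟨r, hr, h1, -⟩ := hnat' i
      exact ⟨r, by rw [h1, hnat r hr.le], by omega⟩
  have hedge : ∀ i, s(f i, f (i + 1)) ∈ c.edges := by
    intro i
    obtain ⟨r, hr, h1, h2⟩ := hnat' i
    rw [SimpleGraph.Walk.mk_mem_edges_iff_exists]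
    refine ⟨r, by omega, ?_⟩
    rw [h1, h2, hnat r hr.le, ← hnat (r + 1) (by omega)]
    push_cast
    rfl
  have hedge' : ∀ x y, s(x, y) ∈ c.edges → ∃ i, s(f i, f (i + 1)) = s(x, y) := by
    intro x y h
    rw [SimpleGraph.Walk.mk_mem_edges_iff_exists] at h
    obtain ⟨i, hi, h⟩ := h
    refine ⟨i, ?_⟩
    rw [← h, hnat i (by omega), ← hnat (i + 1) (by omega)]
    push_cast
    rfl
  have hadj : ∀ i, G.Adj (f i) (f (i + 1)) := fun i => c.adj_of_mem_edges (hedge i)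
  have hE : ∀ x y, s(x, y) ∈ {e | e ∈ c.edges} → x ∈ C ∧ y ∈ C := by
    intro x y h
    rw [← hC, ← hC]
    exact ⟨c.fst_mem_support_of_mem_edges h, c.snd_mem_support_of_mem_edges h⟩
  have hsep : ∀ a ∈ C, ∀ b ∈ C, (G.deleteEdges {e | e ∈ c.edges}).Reachable a b → a = b := by
    intro a ha b hb hab
    by_contra hne
    obtain ⟨i, rfl⟩ := (hmem a).1 ha
    obtain ⟨j, rfl⟩ := (hmem b).1 hb
    obtain ⟨k, hk0, hkl, hk⟩ : ∃ k : ℕ, 0 < k ∧ k < l ∧ f j = f (i + k) := by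
      have h1 := hmod (j - i)
      have h2 := Int.emod_add_mul_ediv (j - i) l
      have h3 : f j = f (i + (j - i) % l) := by
        rw [← periodic_mul per (i + (j - i) % l) ((j - i) / l), add_assoc, h2]
        congr 1; ring
      refine ⟨((j - i) % l).toNat, ?_, by omega, by rw [Int.toNat_of_nonneg h1.1]; exact h3⟩
      rcases Nat.eq_zero_or_pos ((j - i) % l).toNat with h0 | h0
      · have : (j - i) % l = 0 := by omega
        rw [this, add_zero] at h3
        exact absurd h3.symm hne
      · exact h0
    rw [hk] at hab
    have hne1 : ∀ m : ℕ, m + 1 < k →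
        s(f (i + 1 + m), f (i + 1 + m + 1)) ≠ s(f i, f (i + 1)) ∧
        s(f (i + 1 + m), f (i + 1 + m + 1)) ≠ s(f (i + k), f (i + k + 1)) := by
      intro m hm
      constructor <;> intro h
      · have := int_eq_zero_of_dvd (edge_inj h3 inj h) (by omega) (by omega)
        omega
      · have := int_eq_zero_of_dvd (edge_inj h3 inj h) (by omega) (by omega)
        omega
    have hne2 : s(f i, f (i + 1)) ≠ s(f (i + k), f (i + k + 1)) := by
      intro h
      have := int_eq_zero_of_dvd (edge_inj h3 inj h) (by omega) (by omega)
      omega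
    -- If `f i` and `f (i + k)` were joined outside the cycle, that connection together with the arc
    -- from `f (i + 1)` to `f (i + k)` would put the edge at `i` on a cycle even after the removal
    -- of the edge at `i + k`.
    set G' := G.deleteEdges {s(f (i + k), f (i + k + 1))} with hG'
    have hreach : ∀ m : ℕ, m < k →
        (G'.deleteEdges {s(f i, f (i + 1))}).Reachable (f (i + 1)) (f (i + 1 + m)) := by
      intro m
      induction m with
      | zero => intro _; simp
      | succ m ih =>
        intro hm
        refine (ih (by omega)).trans (SimpleGraph.Adj.reachable ?_)
        obtain ⟨h1, h2⟩ := hne1 m hm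
        rw [SimpleGraph.deleteEdges_adj, hG', SimpleGraph.deleteEdges_adj]
        push_cast
        rw [← add_assoc]
        exact ⟨⟨hadj _, h2⟩, h1⟩
    have h1 : (G'.deleteEdges {s(f i, f (i + 1))}).Reachable (f i) (f (i + k)) := by
      refine hab.mono ?_
      intro x y h
      rw [SimpleGraph.deleteEdges_adj] at h
      rw [SimpleGraph.deleteEdges_adj, hG', SimpleGraph.deleteEdges_adj]
      refine ⟨⟨h.1, fun h' => h.2 ?_⟩, fun h' => h.2 ?_⟩
      · rw [Set.mem_singleton_iff] at h'; rw [h']; exact hedge _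
      · rw [Set.mem_singleton_iff] at h'; rw [h']; exact hedge _
    have h2 := hreach (k - 1) (by omega)
    rw [show i + 1 + ((k - 1 : ℕ) : ℤ) = i + k by omega] at h2
    have hadj' : G'.Adj (f i) (f (i + 1)) := by
      rw [hG', SimpleGraph.deleteEdges_adj]; exact ⟨hadj i, hne2⟩
    obtain ⟨u, d, hd, hde⟩ :=
      SimpleGraph.adj_and_reachable_delete_edges_iff_exists_cycle.1 ⟨hadj', h1.trans h2.symm⟩
    have hle : G' ≤ G := SimpleGraph.deleteEdges_le _
    -- Both cycles contain the edge at `i`, so in a cactus they coincide; but `d` lives in `G'`,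
    -- which lacks the edge at `i + k` of `c`.
    have heq := hG.2 _ _ c (d.mapLe hle) hc (hd.mapLe hle) s(f i, f (i + 1)) (hedge i)
      (by rw [SimpleGraph.Walk.edges_mapLe_eq_edges]; exact hde)
    have h5 : s(f (i + k), f (i + k + 1)) ∈ (d.mapLe hle).toSubgraph.edgeSet := by
      rw [← heq, SimpleGraph.Walk.mem_edges_toSubgraph]; exact hedge _
    rw [SimpleGraph.Walk.mem_edges_toSubgraph, SimpleGraph.Walk.edges_mapLe_eq_edges] at h5
    have h6 := d.adj_of_mem_edges h5
    rw [hG', SimpleGraph.deleteEdges_adj] at h6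
    exact h6.2 rfl
  obtain ⟨g, hg, -⟩ := exists_isGate hG.1 {e | e ∈ c.edges}
    ⟨x, (hC x).1 c.start_mem_support⟩ hE hsep
  refine ⟨f, g, ⟨hl ▸ h3, hl ▸ per, hl ▸ inj, hmem, hadj, ?_, hg⟩, hedge⟩
  intro i j hij
  rw [← hl]
  by_cases he : s(f i, f j) ∈ c.edges
  · obtain ⟨m, hm⟩ := hedge' _ _ he
    rw [Sym2.eq_iff] at hm
    rcases hm with ⟨h1, h2⟩ | ⟨h1, h2⟩
    · right
      exact dvd_of_dvd_of_eq (dvd_sub (inj _ _ h2) (inj _ _ h1)) (by ring)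
    · left
      exact dvd_of_dvd_of_eq (dvd_sub (inj _ _ h1) (inj _ _ h2)) (by ring)
  · exfalso
    refine hij.ne (hsep _ ((hmem _).2 ⟨i, rfl⟩) _ ((hmem _).2 ⟨j, rfl⟩)
      (SimpleGraph.Adj.reachable ?_))
    rw [SimpleGraph.deleteEdges_adj]; exact ⟨hij, he⟩

theorem exists_isGate_edge (hG : G.Connected) [DecidableEq V] {u v : V} (huv : G.Adj u v)
    (hc : ∀ (x : V) (c : G.Walk x x), c.IsCycle → s(u, v) ∉ c.edges) :
    ∃ g, IsGate G {u, v} g := by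
  have hr : ¬ (G.deleteEdges {s(u, v)}).Reachable u v := by
    intro h
    obtain ⟨x, c, hc1, hc2⟩ :=
      SimpleGraph.adj_and_reachable_delete_edges_iff_exists_cycle.1 ⟨huv, h⟩
    exact hc x c hc1 hc2
  obtain ⟨g, hg, -⟩ := exists_isGate (B := {u, v}) hG {s(u, v)} ⟨u, by simp⟩
    (by
      intro x y h
      rw [Set.mem_singleton_iff, Sym2.eq_iff] at h
      rcases h with ⟨rfl, rfl⟩ | ⟨rfl, rfl⟩ <;> simp)
    (by
      intro a ha b hb hab
      simp only [Finset.mem_insert, Finset.mem_singleton] at ha hb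
      rcases ha with rfl | rfl <;> rcases hb with rfl | rfl
      · rfl
      · exact absurd hab hr
      · exact absurd hab.symm hr
      · rfl)
  exact ⟨g, hg⟩

namespace IsGatedCycle

variable {C : Finset V} {l : ℕ} {f : ℤ → V} {g : V → V}

theorem mem (h : IsGatedCycle G C l f g) (i : ℤ) : f i ∈ C := (h.mem_iff _).2 ⟨i, rfl⟩

/-- Shifts and reflections of the parametrization allow any vertex of the cycle to be `f 0` and any
two of them to be `f 0` and `f k` with `2 * k ≤ l`. -/
theorem shift (h : IsGatedCycle G C l f g) (a : ℤ) : IsGatedCycle G C l (fun i => f (a + i)) g where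
  three_le := h.three_le
  per i := by rw [← add_assoc]; exact h.per _
  inj i j hij := dvd_of_dvd_of_eq (h.inj _ _ hij) (by ring)
  mem_iff w := by
    rw [h.mem_iff]
    constructor
    · rintro ⟨i, rfl⟩; exact ⟨i - a, by congr 1; ring⟩
    · rintro ⟨i, rfl⟩; exact ⟨_, rfl⟩
  adj i := by rw [← add_assoc]; exact h.adj _
  chordless i j hij := by
    exact (h.chordless _ _ hij).imp (dvd_of_dvd_of_eq · (by ring)) (dvd_of_dvd_of_eq · (by ring))
  gate := h.gate

theorem reflect (h : IsGatedCycle G C l f g) : IsGatedCycle G C l (fun i => f (-i)) g where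
  three_le := h.three_le
  per i := by rw [← h.per (-(i + l))]; congr 1; ring
  inj i j hij := by
    have := h.inj _ _ hij
    rw [← dvd_neg]; exact dvd_of_dvd_of_eq this (by ring)
  mem_iff w := by
    rw [h.mem_iff]
    constructor
    · rintro ⟨i, rfl⟩; exact ⟨-i, by rw [neg_neg]⟩
    · rintro ⟨i, rfl⟩; exact ⟨_, rfl⟩
  adj i := by
    have := (h.adj (-(i + 1))).symm
    rwa [show -(i + 1) + 1 = -i by ring] at this
  chordless i j hij := by
    rcases h.chordless _ _ hij with h' | h'
    · right; rw [← dvd_neg]; exact dvd_of_dvd_of_eq h' (by ring)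
    · left; rw [← dvd_neg]; exact dvd_of_dvd_of_eq h' (by ring)
  gate := h.gate

theorem exists_index (h : IsGatedCycle G C l f g) {w : V} (hw : w ∈ C) :
    ∃ k : ℕ, k < l ∧ f k = w := by
  obtain ⟨i, rfl⟩ := (h.mem_iff w).1 hw
  have hl0 : (0 : ℤ) < l := by have := h.three_le; omega
  have h1 := Int.emod_nonneg i hl0.ne'
  have h2 := Int.emod_lt_of_pos i hl0
  refine ⟨(i % l).toNat, by omega, ?_⟩
  rw [Int.toNat_of_nonneg h1, ← periodic_mul h.per (i % l) (i / l), Int.emod_add_mul_ediv]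

theorem exists_base (h : IsGatedCycle G C l f g) {a : V} (ha : a ∈ C) :
    ∃ f', IsGatedCycle G C l f' g ∧ f' 0 = a := by
  obtain ⟨i, rfl⟩ := (h.mem_iff a).1 ha
  exact ⟨_, h.shift i, by simp⟩

theorem eq_of_lt (h : IsGatedCycle G C l f g) {i j : ℤ} (hij : f i = f j) (h1 : i - j < l)
    (h2 : j - i < l) : i = j := by
  have := int_eq_zero_of_dvd (h.inj _ _ hij) (by omega) h1
  omega

theorem card_eq (h : IsGatedCycle G C l f g) : C.card = l := by
  rw [← Finset.card_range l]
  symm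
  refine Finset.card_bij (fun i _ => f i) (fun i _ => h.mem i) ?_ ?_
  · intro i hi j hj hij
    rw [Finset.mem_range] at hi hj
    have := h.eq_of_lt hij (by omega) (by omega)
    omega
  · intro w hw
    obtain ⟨k, hk, rfl⟩ := h.exists_index hw
    exact ⟨k, Finset.mem_range.2 hk, rfl⟩

/-- The walk along the cycle. -/
def arc (h : IsGatedCycle G C l f g) (i : ℤ) : (k : ℕ) → G.Walk (f i) (f (i + k))
  | 0 => SimpleGraph.Walk.nil.copy rfl (by simp)
  | k + 1 => ((h.arc i k).concat (h.adj _)).copy rfl (by push_cast; rw [add_assoc])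

theorem length_arc (h : IsGatedCycle G C l f g) (i : ℤ) (k : ℕ) : (h.arc i k).length = k := by
  induction k with
  | zero => simp [arc]
  | succ k ih => simp [arc, ih]

theorem mem_support_arc (h : IsGatedCycle G C l f g) (i : ℤ) (k : ℕ) (w : V) :
    w ∈ (h.arc i k).support ↔ ∃ j : ℕ, j ≤ k ∧ w = f (i + j) := by
  induction k with
  | zero => simp [arc]
  | succ k ih =>
    simp only [arc, SimpleGraph.Walk.support_copy, SimpleGraph.Walk.support_concat,
      List.mem_append, ih, List.mem_singleton]
    constructor
    · rintro (⟨j, hj, rfl⟩ | rfl)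
      · exact ⟨j, by omega, rfl⟩
      · exact ⟨k + 1, le_rfl, by push_cast; rw [add_assoc]⟩
    · rintro ⟨j, hj, rfl⟩
      rcases hj.eq_or_lt with rfl | hj
      · right; push_cast; rw [add_assoc]
      · left; exact ⟨j, by omega, rfl⟩

/-- The two arcs bound the distance from above. From below, the index `j` of the gate gives a
potential `min j (l - j)` that grows by at most one along any edge of `G`: the edge keeps the gate
or joins neighbours on the cycle. -/
theorem dist_zero (h : IsGatedCycle G C l f g) (hG : G.Connected) {k : ℕ} (hk : k ≤ l) :
    G.dist (f 0) (f k) = min k (l - k) := by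
  classical
  apply le_antisymm
  · refine le_min ?_ ?_
    · have := SimpleGraph.dist_le (h.arc 0 k)
      rwa [h.length_arc, zero_add] at this
    · have := SimpleGraph.dist_le (h.arc k (l - k))
      rw [h.length_arc, show (k : ℤ) + ((l - k : ℕ) : ℤ) = 0 + l by omega, h.per] at this
      rwa [G.dist_comm]
  · have hidx : ∀ w, ∃ j : ℕ, w ∈ C → j < l ∧ f j = w := fun w => by
      by_cases hw : w ∈ C
      · obtain ⟨j, hj⟩ := h.exists_index hw; exact ⟨j, fun _ => hj⟩
      · exact ⟨0, fun h => absurd h hw⟩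
    choose idx hidx using hidx
    have hlip : ∀ x y, G.Adj x y → min (idx (g y)) (l - idx (g y)) ≤
        min (idx (g x)) (l - idx (g x)) + 1 := by
      intro x y hxy
      rcases h.gate.adj _ _ hxy with h1 | ⟨h1, h2⟩
      · rw [h1]; omega
      · rw [h.gate.fix _ h1, h.gate.fix _ h2]
        obtain ⟨a1, a2⟩ := hidx _ h1
        obtain ⟨b1, b2⟩ := hidx _ h2
        rw [← a2, ← b2] at hxy
        generalize idx x = a at *
        generalize idx y = b at *
        have : (a : ℤ) - b - 1 = 0 ∨ (a : ℤ) - b + 1 = 0 ∨ (a : ℤ) - b - 1 + l = 0 ∨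
            (a : ℤ) - b + 1 - l = 0 := by
          rcases h.chordless _ _ hxy with h' | h'
          · by_cases hab : (a : ℤ) - b - 1 + l = 0
            · exact Or.inr (Or.inr (Or.inl hab))
            · left; exact int_eq_zero_of_dvd h' (by omega) (by omega)
          · by_cases hab : (a : ℤ) - b + 1 - l = 0
            · exact Or.inr (Or.inr (Or.inr hab))
            · right; left; exact int_eq_zero_of_dvd h' (by omega) (by omega)
        omega
    have hwalk : ∀ x y (p : G.Walk x y), min (idx (g y)) (l - idx (g y)) ≤
        min (idx (g x)) (l - idx (g x)) + p.length := by
      intro x y p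
      induction p with
      | nil => simp
      | cons ha p ih =>
        have := hlip _ _ ha
        rw [SimpleGraph.Walk.length_cons]
        omega
    obtain ⟨p, hp⟩ := hG.exists_walk_length_eq_dist (f 0) (f k)
    have h1 := hwalk _ _ p
    rw [h.gate.fix _ (h.mem _), h.gate.fix _ (h.mem _), hp] at h1
    obtain ⟨a1, a2⟩ := hidx _ (h.mem 0)
    obtain ⟨b1, b2⟩ := hidx _ (h.mem k)
    have ha := h.eq_of_lt a2 (by omega) (by omega)
    rcases hk.eq_or_lt with rfl | hk
    · omega
    · have hb := h.eq_of_lt b2 (by omega) (by omega)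
      omega

theorem dist_add (h : IsGatedCycle G C l f g) (hG : G.Connected) (i : ℤ) {k : ℕ} (hk : k ≤ l) :
    G.dist (f i) (f (i + k)) = min k (l - k) := by
  have := (h.shift i).dist_zero hG hk
  simpa using this

theorem dist_eq (h : IsGatedCycle G C l f g) (hG : G.Connected) {i j : ℕ} (hij : i ≤ j)
    (hj : j ≤ l) : G.dist (f i) (f j) = min (j - i) (l - (j - i)) := by
  have := h.dist_add hG i (k := j - i) (by omega)
  rwa [show (i : ℤ) + ((j - i : ℕ) : ℤ) = j by omega] at this

theorem two_mul_dist_le (h : IsGatedCycle G C l f g) (hG : G.Connected) {p q : V} (hp : p ∈ C)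
    (hq : q ∈ C) : 2 * G.dist p q ≤ l := by
  obtain ⟨f, h, rfl⟩ := h.exists_base hp
  obtain ⟨k, hk, rfl⟩ := h.exists_index hq
  rw [h.dist_zero hG hk.le]
  omega

end IsGatedCycle

end Cycles

/-! ### Blocks of a cactus, cut-vertices and leaf blocks -/

section Blocks

variable {V : Type u} {G : SimpleGraph V}

theorem isBiconnected_of_avoiding [Finite V] {B : Finset V} (hne : B.Nonempty)
    (hconn : ∀ u ∈ B, ∀ w ∈ B, ∃ p : G.Walk u w, ∀ x ∈ p.support, x ∈ B)
    (h : ∀ v ∈ B, ∀ u ∈ B, ∀ w ∈ B, u ≠ v → w ≠ v →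
      ∃ p : G.Walk u w, v ∉ p.support ∧ ∀ x ∈ p.support, x ∈ B) :
    IsBiconnected (G.induce (B : Set V)) := by
  obtain ⟨b, hb⟩ := hne
  have hc : (G.induce (B : Set V)).Connected := by
    rw [SimpleGraph.connected_iff]
    refine ⟨fun u w => ?_, ⟨⟨b, hb⟩⟩⟩
    obtain ⟨p, hp⟩ := hconn u.1 u.2 w.1 w.2
    exact ⟨p.induce _ hp⟩
  refine ⟨hc, fun v hv => ?_⟩
  obtain ⟨u, w, hu, hw, hp⟩ := (isCutVertex_iff hc).1 hv
  obtain ⟨p, hp1, hp2⟩ := h v.1 v.2 u.1 u.2 w.1 w.2 (fun h => hu (Subtype.ext h))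
    (fun h => hw (Subtype.ext h))
  have := hp (p.induce _ hp2)
  rw [SimpleGraph.Walk.support_induce] at this
  exact hp1 ((List.mem_attachWith _ _).1 this)

theorem IsGatedCycle.exists_avoiding {C : Finset V} {l : ℕ} {f : ℤ → V} {g : V → V}
    (h : IsGatedCycle G C l f g) {v u w : V} (hv : v ∈ C) (hu : u ∈ C) (hw : w ∈ C)
    (huv : u ≠ v) (hwv : w ≠ v) :
    ∃ p : G.Walk u w, v ∉ p.support ∧ ∀ x ∈ p.support, x ∈ C := by
  obtain ⟨f, h, rfl⟩ := h.exists_base hv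
  obtain ⟨a, ha, rfl⟩ := h.exists_index hu
  obtain ⟨b, hb, rfl⟩ := h.exists_index hw
  have key : ∀ a b : ℕ, a ≤ b → b < l → f a ≠ f 0 →
      ∃ p : G.Walk (f a) (f b), f 0 ∉ p.support ∧ ∀ x ∈ p.support, x ∈ C := by
    intro a b hab hb ha0
    have hab' : (a : ℤ) + ((b - a : ℕ) : ℤ) = b := by omega
    refine ⟨(h.arc a (b - a)).copy rfl (by rw [hab']), ?_, ?_⟩
    · rw [SimpleGraph.Walk.support_copy, h.mem_support_arc]
      rintro ⟨j, hj, h0⟩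
      have := h.eq_of_lt h0 (by omega) (by omega)
      have : a = 0 := by omega
      subst this
      exact ha0 rfl
    · intro x hx
      rw [SimpleGraph.Walk.support_copy, h.mem_support_arc] at hx
      obtain ⟨j, hj, rfl⟩ := hx
      exact h.mem _
  rcases le_total a b with hab | hab
  · exact key a b hab hb huv
  · obtain ⟨p, hp1, hp2⟩ := key b a hab ha hwv
    refine ⟨p.reverse, ?_, ?_⟩
    · simpa using hp1
    · simpa using hp2

theorem IsGatedCycle.isBiconnected [Finite V] {C : Finset V} {l : ℕ} {f : ℤ → V} {g : V → V}
    (h : IsGatedCycle G C l f g) : IsBiconnected (G.induce (C : Set V)) := by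
  refine isBiconnected_of_avoiding ⟨_, h.mem 0⟩ ?_ fun v hv u hu w hw h1 h2 =>
    h.exists_avoiding hv hu hw h1 h2
  intro u hu w hw
  obtain ⟨f, h, rfl⟩ := h.exists_base hu
  obtain ⟨b, hb, rfl⟩ := h.exists_index hw
  refine ⟨(h.arc 0 b).copy rfl (by rw [zero_add]), ?_⟩
  intro x hx
  rw [SimpleGraph.Walk.support_copy, h.mem_support_arc] at hx
  obtain ⟨j, hj, rfl⟩ := hx
  exact h.mem _

theorem isBiconnected_edge [Finite V] [DecidableEq V] {u v : V} (h : G.Adj u v) :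
    IsBiconnected (G.induce (({u, v} : Finset V) : Set V)) := by
  refine isBiconnected_of_avoiding ⟨u, by simp⟩ ?_ ?_
  · intro x hx y hy
    simp only [Finset.mem_insert, Finset.mem_singleton] at hx hy
    rcases hx with rfl | rfl <;> rcases hy with rfl | rfl
    · exact ⟨.nil, by simp⟩
    · exact ⟨h.toWalk, by simp⟩
    · exact ⟨h.symm.toWalk, by simp⟩
    · exact ⟨.nil, by simp⟩
  · intro z hz x hx y hy hxz hyz
    simp only [Finset.mem_insert, Finset.mem_singleton] at hx hy hz
    have : x = y := by
      rcases hx with rfl | rfl <;> rcases hy with rfl | rfl <;> rcases hz with rfl | rfl <;>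
        first | rfl | exact absurd rfl hxz | exact absurd rfl hyz
    subst this
    exact ⟨.nil, by simpa using hxz.symm, by simpa using hx⟩

/-- A biconnected superset shares two vertices with the gated set, hence is contained in it. -/
theorem IsGate.isBlock [Finite V] {B : Finset V} {g : V → V} (h : IsGate G B g)
    (hB : IsBiconnected (G.induce (B : Set V))) {p q : V} (hp : p ∈ B) (hq : q ∈ B)
    (hpq : p ≠ q) : IsBlock G B :=
  ⟨hB, fun _ hB' hle => h.subset_of_isBiconnected hB' hp hq hpq (hle hp) (hle hq)⟩

theorem IsCycleOn.exists_isGatedCycle (hG : IsCactus G) {C : Finset V} (hC : IsCycleOn G C) :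
    ∃ f g, IsGatedCycle G C C.card f g := by
  obtain ⟨x, c, hc, hC⟩ := hC
  obtain ⟨f, g, h, -⟩ := StrongGeodetic.exists_isGatedCycle hG c hc hC
  exact ⟨f, g, by rw [h.card_eq]; exact h⟩

theorem IsCycleOn.isBlock [Finite V] (hG : IsCactus G) {C : Finset V} (hC : IsCycleOn G C) :
    IsBlock G C := by
  obtain ⟨f, g, h⟩ := hC.exists_isGatedCycle hG
  exact h.gate.isBlock h.isBiconnected (h.mem 0) (h.mem 1) (h.adj 0).ne

theorem exists_isCycleOn_or_isGate_edge [DecidableEq V] (hG : IsCactus G) {u v : V}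
    (huv : G.Adj u v) :
    (∃ C, IsCycleOn G C ∧ u ∈ C ∧ v ∈ C) ∨ ∃ g, IsGate G {u, v} g := by
  by_cases h : ∃ (x : V) (c : G.Walk x x), c.IsCycle ∧ s(u, v) ∈ c.edges
  · obtain ⟨x, c, hc, he⟩ := h
    refine Or.inl ⟨c.support.toFinset, ⟨x, c, hc, by simp⟩, ?_, ?_⟩
    · simpa using c.fst_mem_support_of_mem_edges he
    · simpa using c.snd_mem_support_of_mem_edges he
  · push Not at h
    exact Or.inr (exists_isGate_edge hG.1 huv h)

theorem exists_adj [Nontrivial V] (hG : G.Connected) (x : V) : ∃ y, G.Adj x y :=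
  hG.preconnected.exists_adj_of_nontrivial x

theorem isLeafBlock_iff {B : Finset V} : IsLeafBlock G B ↔
    IsBlock G B ∧ ∃ a ∈ B, IsCutVertex G a ∧ ∀ b ∈ B, IsCutVertex G b → b = a := by
  rw [IsLeafBlock, ← exists_prop]
  refine exists_congr fun h => ?_
  rw [Set.ncard_eq_one]
  constructor
  · rintro ⟨x, hx⟩
    have hmem : ∀ y, y ∈ (cutTree G).neighborSet (.inl ⟨B, h⟩) ↔ y = x := fun y => by rw [hx]; rfl
    rcases x with x | a
    · exact ((hmem (.inl x)).2 rfl).elim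
    · refine ⟨a.1, (hmem (.inr a)).2 rfl, a.2, fun b hb hbc => ?_⟩
      have := (hmem (.inr ⟨b, hbc⟩)).1 hb
      exact congrArg Subtype.val (Sum.inr.inj this)
  · rintro ⟨a, ha, hac, hall⟩
    refine ⟨.inr ⟨a, hac⟩, Set.ext fun y => ?_⟩
    rcases y with y | b
    · exact ⟨fun h => h.elim, fun h => by cases h⟩
    · constructor
      · intro hb
        exact congrArg Sum.inr (Subtype.ext (hall b.1 hb b.2))
      · intro hb
        obtain rfl := Sum.inr.inj hb
        exact ha

theorem isInternalBlock_iff {B : Finset V} : IsInternalBlock G B ↔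
    IsBlock G B ∧ ¬ IsLeafBlock G B := by
  constructor
  · rintro ⟨h, hn⟩
    exact ⟨h, fun ⟨_, h'⟩ => hn h'⟩
  · rintro ⟨h, hn⟩
    exact ⟨h, fun h' => hn ⟨h, h'⟩⟩

variable [Finite V]

theorem IsBlock.eq_of_isGate {B B' : Finset V} {g : V → V} (hB : IsBlock G B) (hB' : IsBlock G B')
    (hg : IsGate G B' g) {p q : V} (hpq : p ≠ q) (hp : p ∈ B) (hq : q ∈ B) (hp' : p ∈ B')
    (hq' : q ∈ B') : B = B' :=
  (hB.eq_of_le hB'.1 (hg.subset_of_isBiconnected hB.1 hp' hq' hpq hp hq))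

theorem IsBlock.exists_avoiding {B : Finset V} (hB : IsBlock G B) {v u w : V}
    (hv : v ∈ B) (hu : u ∈ B) (hw : w ∈ B) (huv : u ≠ v) (hwv : w ≠ v) :
    ∃ p : G.Walk u w, v ∉ p.support := by
  by_contra h
  push Not at h
  refine hB.1.2 ⟨v, hv⟩ ((isCutVertex_iff hB.1.1).2 ⟨⟨u, hu⟩, ⟨w, hw⟩,
    fun h => huv (congrArg Subtype.val h), fun h => hwv (congrArg Subtype.val h), fun p => ?_⟩)
  have h1 := h (p.map (SimpleGraph.Embedding.induce _).toHom)
  obtain ⟨z, hz, hz'⟩ := List.mem_map.1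
      ((SimpleGraph.Walk.support_map (SimpleGraph.Embedding.induce _).toHom p) ▸ h1)
  convert hz
  exact hz'.symm

theorem nontrivial_of_isCutVertex (hG : G.Connected) {a : V} (ha : IsCutVertex G a) :
    Nontrivial V := by
  obtain ⟨u, w, hu, -, -⟩ := (isCutVertex_iff hG).1 ha
  exact ⟨u, a, hu⟩

variable [DecidableEq V]

theorem exists_isBlock_of_adj (hG : IsCactus G) {u v : V} (huv : G.Adj u v) :
    ∃ B g, IsBlock G B ∧ IsGate G B g ∧ u ∈ B ∧ v ∈ B ∧ (IsCycleOn G B ∨ B = {u, v}) := by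
  rcases exists_isCycleOn_or_isGate_edge hG huv with ⟨C, hC, hu, hv⟩ | ⟨g, hg⟩
  · obtain ⟨f, g, h⟩ := hC.exists_isGatedCycle hG
    exact ⟨C, g, hC.isBlock hG, h.gate, hu, hv, Or.inl hC⟩
  · exact ⟨{u, v}, g, hg.isBlock (isBiconnected_edge huv) (by simp) (by simp) huv.ne, hg,
      by simp, by simp, Or.inr rfl⟩

theorem IsBlock.exists_adj [Nontrivial V] (hG : G.Connected) {B : Finset V}
    (hB : IsBlock G B) : ∃ u ∈ B, ∃ v ∈ B, G.Adj u v := by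
  obtain ⟨⟨x, hx⟩⟩ := hB.1.1.nonempty
  by_cases h : ∃ y ∈ B, y ≠ x
  · obtain ⟨y, hy, hyx⟩ := h
    have : Nontrivial (B : Set V) := ⟨⟨x, hx⟩, ⟨y, hy⟩, fun h => hyx (congrArg Subtype.val h).symm⟩
    obtain ⟨z, hz⟩ := StrongGeodetic.exists_adj hB.1.1 ⟨x, hx⟩
    exact ⟨x, hx, z.1, z.2, hz⟩
  · push Not at h
    obtain ⟨y, hy⟩ := StrongGeodetic.exists_adj hG x
    -- A single vertex is not maximal: the pair of ends of an incident edge is biconnected and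
    -- larger.
    have hle : B ≤ {x, y} := by
      intro z hz
      simp [h z hz]
    have := hB.2 (isBiconnected_edge hy) hle (show y ∈ ({x, y} : Finset V) by simp)
    exact ⟨x, hx, y, this, hy⟩

theorem IsBlock.cases [Nontrivial V] (hG : IsCactus G) {B : Finset V} (hB : IsBlock G B) :
    IsCycleOn G B ∨ ∃ u v g, G.Adj u v ∧ B = {u, v} ∧ IsGate G {u, v} g := by
  obtain ⟨u, hu, v, hv, huv⟩ := hB.exists_adj hG.1
  obtain ⟨B', g, hB', hg, hu', hv', h⟩ := exists_isBlock_of_adj hG huv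
  obtain rfl := hB.eq_of_isGate hB' hg huv.ne hu hv hu' hv'
  rcases h with h | h
  · exact Or.inl h
  · exact Or.inr ⟨u, v, g, huv, h, h ▸ hg⟩

theorem IsBlock.exists_isGate [Nontrivial V] (hG : IsCactus G) {B : Finset V} (hB : IsBlock G B) :
    ∃ g, IsGate G B g := by
  rcases hB.cases hG with h | ⟨u, v, g, -, rfl, h⟩
  · obtain ⟨f, g, h⟩ := h.exists_isGatedCycle hG
    exact ⟨g, h.gate⟩
  · exact ⟨g, h⟩

/-- Take `y` in `B'` but not in `B`; its gate in `B` belongs to `B'`. If the gate is `w`, then `w`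
separates `y` from the rest of `B` and is a cut-vertex. Otherwise the blocks share two vertices, and
gatedness gives `B' ⊆ B`. This makes the lower bounds of different blocks additive. -/
theorem IsBlock.eq_of_not_isCutVertex [Nontrivial V] (hG : IsCactus G) {B B' : Finset V}
    (hB : IsBlock G B) (hB' : IsBlock G B') {w : V} (hw : ¬ IsCutVertex G w) (h1 : w ∈ B)
    (h2 : w ∈ B') : B = B' := by
  obtain ⟨g, hg⟩ := hB.exists_isGate hG
  refine (hB'.eq_of_le hB.1 fun y hy => ?_).symm
  by_contra hyB
  obtain ⟨p⟩ := hB'.1.1.preconnected ⟨y, hy⟩ ⟨w, h2⟩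
  have hm := hg.mem_support (p.map (SimpleGraph.Embedding.induce _).toHom) h1
  obtain ⟨z, hz, hz'⟩ := List.mem_map.1
      ((SimpleGraph.Walk.support_map (SimpleGraph.Embedding.induce _).toHom p) ▸ hm)
  have hz'' : z.1 = g y := hz'
  have hyg : g y ∈ B' := hz'' ▸ z.2
  by_cases hgw : g y = w
  · obtain ⟨u, hu, v, hv, huv⟩ := hB.exists_adj hG.1
    obtain ⟨q, hq, hqw⟩ : ∃ q ∈ B, q ≠ w := by
      by_cases h : u = w
      · exact ⟨v, hv, h ▸ huv.ne'⟩
      · exact ⟨u, hu, h⟩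
    rw [← hgw] at hqw hw
    refine hw (hg.isCutVertex hG.1 (fun h => hyB (h ▸ hg.mem y)) hq hqw)
  · exact hyB (hg.subset_of_isBiconnected hB'.1 (hg.mem y) h1 hgw hyg h2 hy)

/-- If nothing hangs at `p`, geodesics from other vertices to their gates avoid `p`, and the gates
are joined inside the biconnected block without `p`; so `p` separates nothing. Conversely, a vertex
hanging at `p` is cut off by `p` from the rest of the block. -/
theorem IsBlock.isCutVertex_iff_exists [Nontrivial V] (hG : IsCactus G) {B : Finset V} {g : V → V}
    (hB : IsBlock G B) (hg : IsGate G B g) {p : V} (hp : p ∈ B) :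
    IsCutVertex G p ↔ ∃ z, z ≠ p ∧ g z = p := by
  constructor
  · intro hcut
    by_contra! hno
    obtain ⟨u, w, hu, hw, h⟩ := (isCutVertex_iff hG.1).1 hcut
    have key : ∀ u, u ≠ p → ∃ q : G.Walk u (g u), p ∉ q.support := by
      intro u hu
      obtain ⟨q, hq⟩ := hG.1.exists_walk_length_eq_dist u (g u)
      refine ⟨q, fun hpq => hno u hu ?_⟩
      have h1 := dist_add_dist_of_mem_support q hq hpq hG.1
      have h2 := hg.dist_eq hG.1 u hp
      have h3 : G.dist (g u) p = 0 := by omega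
      exact hG.1.dist_eq_zero_iff.1 h3
    obtain ⟨q1, hq1⟩ := key u hu
    obtain ⟨q2, hq2⟩ := key w hw
    obtain ⟨q3, hq3⟩ := hB.exists_avoiding hp (hg.mem u) (hg.mem w) (hno u hu) (hno w hw)
    have := h ((q1.append q3).append q2.reverse)
    simp [hq1, hq2, hq3] at this
  · rintro ⟨z, hz, rfl⟩
    obtain ⟨u, hu, v, hv, huv⟩ := hB.exists_adj hG.1
    by_cases h : u = g z
    · exact hg.isCutVertex hG.1 hz hv (h ▸ huv.ne')
    · exact hg.isCutVertex hG.1 hz hu h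

theorem eq_univ_of_no_isCutVertex [Nontrivial V] [Fintype V] (hG : IsCactus G)
    (hno : ∀ v, ¬ IsCutVertex G v) {B : Finset V} (hB : IsBlock G B) : B = Finset.univ := by
  obtain ⟨g, hg⟩ := hB.exists_isGate hG
  rw [Finset.eq_univ_iff_forall]
  intro z
  by_contra hz
  exact hno _ ((hB.isCutVertex_iff_exists hG hg (hg.mem z)).2
    ⟨z, fun h => hz (h ▸ hg.mem z), rfl⟩)

/-- Without cut-vertices every block is the whole vertex set, so the cut-tree has at most one node.
-/
theorem exists_isCutVertex_of_nontrivial (hG : IsCactus G)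
    (hT : Nontrivial (CutTreeNode G)) : ∃ a, IsCutVertex G a := by
  by_contra! hno
  have := Fintype.ofFinite V
  obtain ⟨x, y, hxy⟩ := hT
  rcases x with x | x
  · rcases y with y | y
    · refine hxy (congrArg Sum.inl (Subtype.ext ?_))
      rcases subsingleton_or_nontrivial V with hV | hV
      · obtain ⟨⟨a, ha⟩⟩ := x.2.1.1.nonempty
        obtain ⟨⟨b, hb⟩⟩ := y.2.1.1.nonempty
        ext z
        rw [Subsingleton.elim a z] at ha
        rw [Subsingleton.elim b z] at hb
        exact iff_of_true ha hb
      · rw [eq_univ_of_no_isCutVertex hG hno x.2, eq_univ_of_no_isCutVertex hG hno y.2]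
    · exact hno _ y.2
  · exact hno _ x.2

/-- If `S` contains a vertex off the cut-vertex in every leaf block, then it meets every component
of the graph minus a cut-vertex. -/
theorem exists_mem_avoiding (hG : IsCactus G) {S : Finset V}
    (hS : ∀ B, IsLeafBlock G B → ∀ a ∈ B, IsCutVertex G a → ∃ s ∈ S, s ∈ B ∧ s ≠ a)
    {a z : V} (ha : IsCutVertex G a) (hz : z ≠ a) :
    ∃ s ∈ S, ∃ p : G.Walk z s, a ∉ p.support := by
  have := nontrivial_of_isCutVertex hG.1 ha
  -- Induction on the size of the component of `z` in `G - a`. If it contains a cut-vertex `b`, then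
  -- a component of `G - b` without `a` lies inside it and misses `b`, so it is smaller.
  obtain ⟨N, hN⟩ : ∃ N, N = {y | ∃ p : G.Walk z y, a ∉ p.support}.ncard := ⟨_, rfl⟩
  induction N using Nat.strong_induction_on generalizing a z with
  | _ N ih =>
  by_cases hcut : ∃ b, IsCutVertex G b ∧ ∃ p : G.Walk z b, a ∉ p.support
  · obtain ⟨b, hb, p, hp⟩ := hcut
    have hba : b ≠ a := fun h => hp (h ▸ p.end_mem_support)
    obtain ⟨z', hz'b, hz'⟩ : ∃ z', z' ≠ b ∧ ∀ q : G.Walk z' a, b ∈ q.support := by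
      obtain ⟨u, w, hu, hw, h⟩ := (isCutVertex_iff hG.1).1 hb
      by_contra! hcon
      obtain ⟨q1, hq1⟩ := hcon u hu
      obtain ⟨q2, hq2⟩ := hcon w hw
      have := h (q1.append q2.reverse)
      simp [hq1, hq2] at this
    obtain ⟨q, hq⟩ : ∃ q : G.Walk z' b, a ∉ q.support := by
      obtain ⟨q, hq, -⟩ := hG.1.exists_path_of_dist z' b
      refine ⟨q, fun haq => ?_⟩
      exact SimpleGraph.Walk.endpoint_notMem_support_takeUntil hq haq hba (hz' _)
    have hsub : ∀ y, (∃ r : G.Walk z' y, b ∉ r.support) → ∃ r : G.Walk z y, a ∉ r.support := by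
      rintro y ⟨r, hr⟩
      refine ⟨(p.append q.reverse).append r, ?_⟩
      have har : a ∉ r.support := fun har =>
        hr (r.support_takeUntil_subset_support har (hz' _))
      simp [hp, hq, har]
    have hlt : {y | ∃ r : G.Walk z' y, b ∉ r.support}.ncard < N := by
      rw [hN]
      apply Set.ncard_lt_ncard ?_ (Set.toFinite _)
      refine ⟨hsub, fun hcon => ?_⟩
      obtain ⟨r, hr⟩ := hcon (show b ∈ {y | ∃ r : G.Walk z y, a ∉ r.support} from ⟨p, hp⟩)
      exact hr r.end_mem_support
    obtain ⟨s, hs, hr⟩ := ih _ hlt hb hz'b rfl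
    exact ⟨s, hs, hsub s hr⟩
  -- With no cut-vertex in the component, consider an edge from it to `a`. The block of that edge
  -- lies in the component apart from `a`, so `a` is its only cut-vertex and it is a leaf.
  · push Not at hcut
    obtain ⟨p⟩ := hG.1.preconnected z a
    obtain ⟨⟨⟨w, a'⟩, had⟩, -, ⟨q, hq⟩, hnot⟩ :=
      p.exists_boundary_dart {y | ∃ p : G.Walk z y, a ∉ p.support} ⟨.nil, by simpa using hz.symm⟩
      (fun ⟨q, hq⟩ => hq q.end_mem_support)
    have haa : a' = a := by
      by_contra hne
      refine hnot ⟨q.concat had, ?_⟩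
      rw [SimpleGraph.Walk.support_concat]
      simp [hq, Ne.symm hne]
    subst haa
    obtain ⟨B, g, hB, hg, hwB, haB, -⟩ := exists_isBlock_of_adj hG had
    have hK : ∀ y ∈ B, y ≠ a' → ∃ p : G.Walk z y, a' ∉ p.support := by
      intro y hy hya
      obtain ⟨r, hr⟩ := hB.exists_avoiding haB hwB hy had.ne hya
      exact ⟨q.append r, by simp [hq, hr]⟩
    obtain ⟨s, hs, hsB, hsa⟩ := hS B (isLeafBlock_iff.2 ⟨hB, a', haB, ha, fun b hb hbc => by
      by_contra hne
      obtain ⟨r, hr⟩ := hK b hb hne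
      exact hr (hcut b hbc r)⟩) a' haB ha
    exact ⟨s, hs, hK s hsB hsa⟩

end Blocks

/-! ### Exchanging parts of geodesics, and coverings of a single cycle -/

section Covering

variable {V : Type u} {G : SimpleGraph V}

theorem IsGate.exists_split {B : Finset V} {g : V → V} (h : IsGate G B g) (hG : G.Connected)
    {x y : V} (hne : g x ≠ g y) (P : G.Walk x y) (hP : P.length = G.dist x y) :
    ∃ (P₁ : G.Walk x (g x)) (P₂ : G.Walk (g x) (g y)) (P₃ : G.Walk (g y) y),
      P = (P₁.append P₂).append P₃ ∧ P₁.length = G.dist x (g x) ∧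
      P₂.length = G.dist (g x) (g y) ∧ P₃.length = G.dist (g y) y := by
  classical
  have hx := h.mem_support_of_ne P hne
  have hy : g y ∈ (P.dropUntil (g x) hx).support := by
    have := h.mem_support_of_ne (P.dropUntil (g x) hx).reverse
      (by rw [h.fix _ (h.mem x)]; exact hne.symm)
    simpa using this
  have hP' : P = ((P.takeUntil _ hx).append ((P.dropUntil _ hx).takeUntil _ hy)).append
      ((P.dropUntil _ hx).dropUntil _ hy) := by
    rw [← SimpleGraph.Walk.append_assoc, SimpleGraph.Walk.take_spec, SimpleGraph.Walk.take_spec]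
  have hlen := congrArg SimpleGraph.Walk.length hP'
  rw [SimpleGraph.Walk.length_append, SimpleGraph.Walk.length_append, hP,
    h.dist_eq_of_ne hG hne] at hlen
  have h1 := SimpleGraph.dist_le (P.takeUntil _ hx)
  have h2 := SimpleGraph.dist_le ((P.dropUntil _ hx).takeUntil _ hy)
  have h3 := SimpleGraph.dist_le ((P.dropUntil _ hx).dropUntil _ hy)
  exact ⟨_, _, _, hP', by omega, by omega, by omega⟩

/-- Replace the part of the geodesic `P` inside the gated set by that of the geodesic `Q`. -/
theorem IsGate.exists_exchange {B : Finset V} {g : V → V} (h : IsGate G B g) (hG : G.Connected)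
    {x y : V} (hne : g x ≠ g y) (P Q : G.Walk x y) (hP : P.length = G.dist x y)
    (hQ : Q.length = G.dist x y) :
    ∃ R : G.Walk x y, R.length = G.dist x y ∧ (∀ t ∈ P.support, t ∉ B → t ∈ R.support) ∧
      ∀ t ∈ Q.support, t ∈ B → t ∈ R.support := by
  obtain ⟨P₁, P₂, P₃, hPe, hP1, hP2, hP3⟩ := h.exists_split hG hne P hP
  obtain ⟨Q₁, Q₂, Q₃, hQe, hQ1, hQ2, hQ3⟩ := h.exists_split hG hne Q hQ
  refine ⟨(P₁.append Q₂).append P₃, ?_, ?_, ?_⟩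
  · rw [SimpleGraph.Walk.length_append, SimpleGraph.Walk.length_append,
      h.dist_eq_of_ne hG hne]
    omega
  · intro t ht htB
    rw [hPe, SimpleGraph.Walk.mem_support_append_iff, SimpleGraph.Walk.mem_support_append_iff] at ht
    rw [SimpleGraph.Walk.mem_support_append_iff, SimpleGraph.Walk.mem_support_append_iff]
    rcases ht with (ht | ht) | ht
    · exact Or.inl (Or.inl ht)
    · exact absurd (h.mem_of_dist_add hG (h.mem x) (h.mem y)
        (dist_add_dist_of_mem_support P₂ hP2 ht hG)) htB
    · exact Or.inr ht
  · intro t ht htB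
    rw [hQe, SimpleGraph.Walk.mem_support_append_iff, SimpleGraph.Walk.mem_support_append_iff] at ht
    rw [SimpleGraph.Walk.mem_support_append_iff, SimpleGraph.Walk.mem_support_append_iff]
    rcases ht with (ht | ht) | ht
    · have h1 := dist_add_dist_of_mem_support Q₁ hQ1 ht hG
      have h2 := h.dist_eq hG x htB
      have h3 : G.dist (g x) t = 0 := by omega
      rw [hG.dist_eq_zero_iff] at h3
      exact Or.inl (Or.inl (h3 ▸ P₁.end_mem_support))
    · exact Or.inl (Or.inr ht)
    · have h1 := dist_add_dist_of_mem_support Q₃ hQ3 ht hG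
      have h2 := h.dist_eq hG y htB
      rw [G.dist_comm (u := y), G.dist_comm (u := y)] at h2
      have h3 : G.dist (g y) t = 0 := by omega
      rw [hG.dist_eq_zero_iff] at h3
      exact Or.inr (h3 ▸ P₃.start_mem_support)

/-- Starting from any geodesic, an exchange in the gated set `B` of a missing `t` gains `t`. It
loses nothing of `T`: outside `B` the old geodesic is kept, and inside `B` the new part contains all
of `T ∩ B`. So the number of vertices of `T` on the geodesic grows until all are there. -/
theorem exists_geodesic_superset [Finite V] [DecidableEq V] (hG : G.Connected) {x y : V}
    (T : Finset V)
    (hT : ∀ t ∈ T, t ≠ x → ∃ B g, IsGate G B g ∧ t ∈ B ∧ g x ≠ g y ∧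
      ∃ Q : G.Walk x y, Q.length = G.dist x y ∧ ∀ t' ∈ T, t' ∈ B → t' ∈ Q.support) :
    ∃ P : G.Walk x y, P.length = G.dist x y ∧ ∀ t ∈ T, t ∈ P.support := by
  have key : ∀ n ≤ T.card, ∃ P : G.Walk x y, P.length = G.dist x y ∧
      n ≤ (T.filter (· ∈ P.support)).card := by
    intro n
    induction n with
    | zero =>
      intro _
      obtain ⟨P, hP⟩ := hG.exists_walk_length_eq_dist x y
      exact ⟨P, hP, Nat.zero_le _⟩
    | succ n ih =>
      intro hn
      obtain ⟨P, hP, hPn⟩ := ih (by omega)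
      by_cases hall : ∀ t ∈ T, t ∈ P.support
      · refine ⟨P, hP, ?_⟩
        rwa [Finset.filter_true_of_mem hall]
      · push Not at hall
        obtain ⟨t, htT, htP⟩ := hall
        obtain ⟨B, g, hg, htB, hne, Q, hQ, hQT⟩ := hT t htT
          (fun h => htP (h ▸ P.start_mem_support))
        obtain ⟨R, hR, hR1, hR2⟩ := hg.exists_exchange hG hne P Q hP hQ
        refine ⟨R, hR, ?_⟩
        have hlt : T.filter (· ∈ P.support) ⊂ T.filter (· ∈ R.support) := by
          rw [Finset.ssubset_iff_of_subset]
          · exact ⟨t, by simp [htT, hR2 t (hQT t htT htB) htB], by simp [htP]⟩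
          · intro s hs
            rw [Finset.mem_filter] at hs ⊢
            refine ⟨hs.1, ?_⟩
            by_cases hsB : s ∈ B
            · exact hR2 s (hQT s hs.1 hsB) hsB
            · exact hR1 s hs.2 hsB
        have := Finset.card_lt_card hlt
        omega
  obtain ⟨P, hP, hPn⟩ := key _ le_rfl
  refine ⟨P, hP, fun t ht => ?_⟩
  have := Finset.eq_of_subset_of_card_le (Finset.filter_subset (· ∈ P.support) T) hPn
  rw [← this] at ht
  exact (Finset.mem_filter.1 ht).2

/-- Geodesics between the vertices of `S` can be chosen so that all vertices of `C` are covered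
which are neither in `S` nor cut-vertices. -/
def LocallyCovered (G : SimpleGraph V) (S C : Finset V) : Prop :=
  ∃ T : Sym2 V → Set V,
    (∀ x ∈ S, ∀ y ∈ S, ∃ Q : G.Walk x y, Q.length = G.dist x y ∧ ∀ t ∈ T s(x, y), t ∈ Q.support) ∧
    ∀ w ∈ C, w ∉ S → ¬ IsCutVertex G w → ∃ x ∈ S, ∃ y ∈ S, w ∈ T s(x, y)

/-- The fixed path of a pair must not depend on the order of its ends; an enumeration of `S` selects
one of the two candidates, and on the diagonal both are trivial. -/
theorem exists_symmetric_system [Finite V] {S : Finset V}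
    (P : ∀ x y : {x // x ∈ S}, G.Walk x.1 y.1) (hP : ∀ x y, (P x y).length = G.dist x.1 y.1) :
    ∃ Q : ∀ x y : {x // x ∈ S}, G.Walk x.1 y.1, (∀ x y, (Q x y).length = G.dist x.1 y.1) ∧
      (∀ x y, Q y x = (Q x y).reverse) ∧ ∀ x y, Q x y = P x y ∨ Q x y = (P y x).reverse := by
  classical
  obtain ⟨n, ⟨e⟩⟩ := Finite.exists_equiv_fin {x // x ∈ S}
  refine ⟨fun x y => if e x ≤ e y then P x y else (P y x).reverse, ?_, ?_, ?_⟩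
  · intro x y
    dsimp only
    split_ifs
    · exact hP x y
    · rw [SimpleGraph.Walk.length_reverse, hP, G.dist_comm]
  · intro x y
    dsimp only
    rcases lt_trichotomy (e x) (e y) with h | h | h
    · rw [if_neg (not_le.2 h), if_pos h.le]
    · obtain rfl := e.injective h
      have : P x x = .nil := SimpleGraph.Walk.eq_nil_iff_nil.2
        (SimpleGraph.Walk.length_eq_zero_iff.1 (by rw [hP, SimpleGraph.dist_self]))
      simp [this]
    · rw [if_pos h.le, if_neg (not_le.2 h), SimpleGraph.Walk.reverse_reverse]
  · intro x y
    dsimp only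
    split_ifs
    · exact Or.inl rfl
    · exact Or.inr rfl

/-- Local coverings glue. A vertex that is no cut-vertex belongs to one cycle only, so what is
demanded of a pair inside `C` comes from the covering of `C` alone and is met by one geodesic;
`exists_geodesic_superset` then meets the demands of all cycles at once. -/
theorem isStrongGeodeticSet_of_locallyCovered [Finite V] [DecidableEq V] [Nontrivial V]
    (hG : IsCactus G) {S : Finset V}
    (hcut : ∀ w, IsCutVertex G w → w ∉ S → ∃ x ∈ S, ∃ y ∈ S, ∀ p : G.Walk x y, w ∈ p.support)
    (hnc : ∀ w, ¬ IsCutVertex G w → w ∉ S → ∃ C, IsCycleOn G C ∧ w ∈ C)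
    (hC : ∀ C, IsCycleOn G C → LocallyCovered G S C) : IsStrongGeodeticSet G S := by
  classical
  have := Fintype.ofFinite V
  choose! T hT1 hT2 using hC
  let T' : Sym2 V → Finset V := fun e => Finset.univ.filter fun t =>
    ¬ IsCutVertex G t ∧ t ∉ S ∧ ∃ C, IsCycleOn G C ∧ t ∈ C ∧ t ∈ T C e
  have hT' : ∀ e t, t ∈ T' e ↔ ¬ IsCutVertex G t ∧ t ∉ S ∧
      ∃ C, IsCycleOn G C ∧ t ∈ C ∧ t ∈ T C e := fun e t => by simp [T']
  have hP : ∀ x y : {x // x ∈ S}, ∃ P : G.Walk x.1 y.1, P.length = G.dist x.1 y.1 ∧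
      ∀ t ∈ T' s(x.1, y.1), t ∈ P.support := by
    intro x y
    refine exists_geodesic_superset hG.1 _ fun t ht htx => ?_
    obtain ⟨htc, htS, C, hC, htC, htT⟩ := (hT' _ _).1 ht
    obtain ⟨f, g, h⟩ := hC.exists_isGatedCycle hG
    obtain ⟨Q, hQ, hQT⟩ := hT1 C hC x.1 x.2 y.1 y.2
    refine ⟨C, g, h.gate, htC, fun hxy => ?_, Q, hQ, fun t' ht' ht'C => ?_⟩
    -- If the gates of `x` and `y` were equal, `t` would be that gate; as `x ≠ t` hangs there, `t`
    -- would be a cut-vertex.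
    · have h1 := h.gate.dist_gate_add hG.1 htC
        (dist_add_dist_of_mem_support Q hQ (hQT t htT) hG.1)
      rw [hxy, SimpleGraph.dist_self] at h1
      have h2 : G.dist (g y) t = 0 := by omega
      rw [hG.1.dist_eq_zero_iff] at h2
      exact htc (((hC.isBlock hG).isCutVertex_iff_exists hG h.gate htC).2
        ⟨x, htx.symm, hxy.trans h2⟩)
    · obtain ⟨h1, h2, C', hC', h3, h4⟩ := (hT' _ _).1 ht'
      obtain rfl := (hC.isBlock hG).eq_of_not_isCutVertex hG (hC'.isBlock hG) h1 ht'C h3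
      exact hQT t' h4
  choose P hP1 hP2 using hP
  obtain ⟨Q, hQ1, hQ2, hQ3⟩ := exists_symmetric_system P hP1
  refine ⟨Q, hQ1, hQ2, fun w hw => ?_⟩
  by_cases hwc : IsCutVertex G w
  · obtain ⟨x, hx, y, hy, hp⟩ := hcut w hwc hw
    exact ⟨⟨x, hx⟩, ⟨y, hy⟩, hp _⟩
  · obtain ⟨C, hC, hwC⟩ := hnc w hwc hw
    obtain ⟨x, hx, y, hy, hxy⟩ := hT2 C hC w hwC hw hwc
    refine ⟨⟨x, hx⟩, ⟨y, hy⟩, ?_⟩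
    rcases hQ3 ⟨x, hx⟩ ⟨y, hy⟩ with h | h <;> rw [h]
    · exact hP2 ⟨x, hx⟩ ⟨y, hy⟩ w ((hT' _ _).2 ⟨hwc, hw, C, hC, hwC, hxy⟩)
    · rw [SimpleGraph.Walk.support_reverse, List.mem_reverse]
      refine hP2 ⟨y, hy⟩ ⟨x, hx⟩ w ((hT' _ _).2 ⟨hwc, hw, C, hC, hwC, ?_⟩)
      rwa [Sym2.eq_swap]

/-- The three pairs are different, so their demands never compete for the same fixed path. -/
theorem locallyCovered_of_three (hG : G.Connected) {S C : Finset V} {x y z : V}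
    (hx : x ∈ S) (hy : y ∈ S) (hz : z ∈ S) (hxy : x ≠ y) (hxz : x ≠ z) (hyz : y ≠ z)
    (Q₁ : G.Walk x y) (Q₂ : G.Walk x z) (Q₃ : G.Walk z y) (h₁ : Q₁.length = G.dist x y)
    (h₂ : Q₂.length = G.dist x z) (h₃ : Q₃.length = G.dist z y)
    (hC : ∀ w ∈ C, w ∈ Q₁.support ∨ w ∈ Q₂.support ∨ w ∈ Q₃.support) :
    LocallyCovered G S C := by
  have hrev : ∀ {a b a' b' : V} (Q : G.Walk a b), Q.length = G.dist a b → s(a', b') = s(a, b) →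
      ∃ R : G.Walk a' b', R.length = G.dist a' b' ∧ ∀ t ∈ Q.support, t ∈ R.support := by
    intro a b a' b' Q hQ he
    rw [Sym2.eq_iff] at he
    rcases he with ⟨rfl, rfl⟩ | ⟨rfl, rfl⟩
    · exact ⟨Q, hQ, fun _ h => h⟩
    · exact ⟨Q.reverse, by rw [SimpleGraph.Walk.length_reverse, hQ, G.dist_comm], by simp⟩
  have hne1 : s(x, y) ≠ s(x, z) := by simp [hxz, hyz]
  have hne2 : s(x, y) ≠ s(z, y) := by simp [hxz, hxy]
  have hne3 : s(x, z) ≠ s(z, y) := by simp [hxz, hxy]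
  refine ⟨fun e => {w | (e = s(x, y) ∧ w ∈ Q₁.support) ∨ (e = s(x, z) ∧ w ∈ Q₂.support) ∨
    (e = s(z, y) ∧ w ∈ Q₃.support)}, ?_, ?_⟩
  · intro a ha b hb
    by_cases h1 : s(a, b) = s(x, y)
    · obtain ⟨R, hR, hR'⟩ := hrev Q₁ h₁ h1
      refine ⟨R, hR, ?_⟩
      rintro t (⟨-, ht⟩ | ⟨he, -⟩ | ⟨he, -⟩)
      · exact hR' t ht
      · exact absurd (h1.symm.trans he) hne1
      · exact absurd (h1.symm.trans he) hne2
    · by_cases h2 : s(a, b) = s(x, z)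
      · obtain ⟨R, hR, hR'⟩ := hrev Q₂ h₂ h2
        refine ⟨R, hR, ?_⟩
        rintro t (⟨he, -⟩ | ⟨-, ht⟩ | ⟨he, -⟩)
        · exact absurd he h1
        · exact hR' t ht
        · exact absurd (h2.symm.trans he) hne3
      · by_cases h3 : s(a, b) = s(z, y)
        · obtain ⟨R, hR, hR'⟩ := hrev Q₃ h₃ h3
          refine ⟨R, hR, ?_⟩
          rintro t (⟨he, -⟩ | ⟨he, -⟩ | ⟨-, ht⟩)
          · exact absurd he h1
          · exact absurd he h2
          · exact hR' t ht
        · obtain ⟨R, hR⟩ := hG.exists_walk_length_eq_dist a b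
          refine ⟨R, hR, ?_⟩
          rintro t (⟨he, -⟩ | ⟨he, -⟩ | ⟨he, -⟩)
          · exact absurd he h1
          · exact absurd he h2
          · exact absurd he h3
  · intro w hw _ _
    rcases hC w hw with h | h | h
    · exact ⟨x, hx, y, hy, Or.inl ⟨rfl, h⟩⟩
    · exact ⟨x, hx, z, hz, Or.inr (Or.inl ⟨rfl, h⟩)⟩
    · exact ⟨z, hz, y, hy, Or.inr (Or.inr ⟨rfl, h⟩)⟩

namespace IsGatedCycle

variable {C : Finset V} {l : ℕ} {f : ℤ → V} {g : V → V}

theorem exists_base_pair (h : IsGatedCycle G C l f g) {p q : V} (hp : p ∈ C) (hq : q ∈ C) :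
    ∃ (f' : ℤ → V) (k : ℕ), IsGatedCycle G C l f' g ∧ f' 0 = p ∧ f' k = q ∧ 2 * k ≤ l := by
  obtain ⟨f, h, rfl⟩ := h.exists_base hp
  obtain ⟨k, hk, rfl⟩ := h.exists_index hq
  by_cases hkl : 2 * k ≤ l
  · exact ⟨f, k, h, rfl, rfl, hkl⟩
  · refine ⟨_, l - k, h.reflect, by simp, ?_, by omega⟩
    rw [← h.per]
    congr 1
    omega

theorem exists_geodesic (h : IsGatedCycle G C l f g) (hG : G.Connected) {x y : V} {i : ℤ} {k : ℕ}
    (hx : g x = f i) (hy : g y = f (i + k)) (hk : 0 < k) (hkl : 2 * k ≤ l) :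
    ∃ Q : G.Walk x y, Q.length = G.dist x y ∧ ∀ j : ℕ, j ≤ k → f (i + j) ∈ Q.support := by
  have hd := h.dist_add hG i (k := k) (by omega)
  have hne : g x ≠ g y := by
    intro he
    rw [hx, hy] at he
    rw [← he, SimpleGraph.dist_self] at hd
    omega
  have hxy := h.gate.dist_eq_of_ne hG hne
  obtain ⟨P, hP⟩ := hG.exists_walk_length_eq_dist x (f i)
  obtain ⟨R, hR⟩ := hG.exists_walk_length_eq_dist (f (i + k)) y
  refine ⟨(P.append (h.arc i k)).append R, ?_, ?_⟩
  · rw [SimpleGraph.Walk.length_append, SimpleGraph.Walk.length_append, hP, hR, h.length_arc, hxy,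
      hx, hy, hd]
    omega
  · intro j hj
    rw [SimpleGraph.Walk.mem_support_append_iff, SimpleGraph.Walk.mem_support_append_iff]
    exact Or.inl (Or.inr ((h.mem_support_arc _ _ _).2 ⟨j, hj, rfl⟩))

/-- Below half the length the short arc is the only geodesic, so the interval between its ends is
the arc. -/
theorem exists_index_of_dist_add (h : IsGatedCycle G C l f g) (hG : G.Connected) {k : ℕ}
    (hkl : 2 * k < l) {w : V} (hw : w ∈ C)
    (hd : G.dist (f 0) w + G.dist w (f k) = G.dist (f 0) (f k)) : ∃ j ≤ k, w = f j := by
  obtain ⟨j, hj, rfl⟩ := h.exists_index hw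
  refine ⟨j, ?_, rfl⟩
  by_contra hjk
  rw [G.dist_comm (u := f j), h.dist_zero hG hj.le, h.dist_zero hG (by omega),
    h.dist_eq hG (by omega : k ≤ j) hj.le] at hd
  omega

/-- Gates less than half the cycle apart are joined in the cycle by a unique geodesic, so a pair
covers the whole interval between its gates without any choice and no conflict can arise. -/
theorem locallyCovered_of_dist_lt (h : IsGatedCycle G C l f g) (hG : G.Connected) {S : Finset V}
    (hS : ∀ w ∈ C, w ∉ S → ¬ IsCutVertex G w → ∃ x ∈ S, ∃ y ∈ S, g x ≠ g y ∧
      2 * G.dist (g x) (g y) < l ∧ G.dist (g x) w + G.dist w (g y) = G.dist (g x) (g y)) :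
    LocallyCovered G S C := by
  refine ⟨fun e => {w | w ∈ C ∧ ∃ x y, e = s(x, y) ∧ g x ≠ g y ∧
      2 * G.dist (g x) (g y) < l ∧ G.dist (g x) w + G.dist w (g y) = G.dist (g x) (g y)}, ?_, ?_⟩
  · intro x hx y hy
    by_cases hxy : g x ≠ g y ∧ 2 * G.dist (g x) (g y) < l
    · obtain ⟨hne, hlt⟩ := hxy
      obtain ⟨f, k, h, hf0, hfk, hkl⟩ := h.exists_base_pair (h.gate.mem x) (h.gate.mem y)
      have hd := h.dist_zero hG (k := k) (by omega)
      rw [hf0, hfk] at hd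
      have hk0 : 0 < k := by
        rcases Nat.eq_zero_or_pos k with rfl | hk
        · exact absurd (hf0.symm.trans hfk) hne
        · exact hk
      obtain ⟨Q, hQ, hQ'⟩ := h.exists_geodesic hG (i := 0) (k := k) hf0.symm
        (by rw [zero_add]; exact hfk.symm) hk0 hkl
      refine ⟨Q, hQ, ?_⟩
      rintro t ⟨htC, a, b, he, -, -, hab⟩
      have hab' : G.dist (g x) t + G.dist t (g y) = G.dist (g x) (g y) := by
        rw [Sym2.eq_iff] at he
        rcases he with ⟨rfl, rfl⟩ | ⟨rfl, rfl⟩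
        · exact hab
        · have e1 := G.dist_comm (u := g x) (v := t)
          have e2 := G.dist_comm (u := g y) (v := t)
          have e3 := G.dist_comm (u := g x) (v := g y)
          omega
      rw [← hf0, ← hfk] at hab'
      obtain ⟨j, hj, rfl⟩ := h.exists_index_of_dist_add hG (by omega) htC hab'
      have := hQ' j hj
      rwa [zero_add] at this
    · obtain ⟨Q, hQ⟩ := hG.exists_walk_length_eq_dist x y
      refine ⟨Q, hQ, ?_⟩
      rintro t ⟨htC, a, b, he, h1, h2, -⟩
      exfalso
      apply hxy
      rw [Sym2.eq_iff] at he
      rcases he with ⟨rfl, rfl⟩ | ⟨rfl, rfl⟩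
      · exact ⟨h1, h2⟩
      · exact ⟨h1.symm, by rwa [G.dist_comm]⟩
  · intro w hw hwS hwc
    obtain ⟨x, hx, y, hy, hxy⟩ := hS w hw hwS hwc
    exact ⟨x, hx, y, hy, hw, x, y, rfl, hxy⟩

/-- The pair `x`, `y` can cover only one half of the cycle. If the third vertex `z` has the gate of
`x` or of `y`, it covers the other half together with the opposite end; otherwise its gate lies
inside one half, which the pairs `x`, `z` and `z`, `y` cover, leaving the opposite half to `x`, `y`.
-/
theorem locallyCovered_of_antipodal [DecidableEq V] (h : IsGatedCycle G C l f g)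
    (hG : G.Connected) {S : Finset V} (hS : 3 ≤ S.card) {x y : V} (hx : x ∈ S) (hy : y ∈ S)
    (hxy : 2 * G.dist (g x) (g y) = l) : LocallyCovered G S C := by
  obtain ⟨f, k, h, hf0, hfk, hkl⟩ := h.exists_base_pair (h.gate.mem x) (h.gate.mem y)
  have hl := h.three_le
  have hd := h.dist_zero hG (k := k) (by omega)
  rw [hf0, hfk] at hd
  have hlk : l = 2 * k := by omega
  have hxy' : x ≠ y := by
    rintro rfl
    rw [SimpleGraph.dist_self] at hxy
    omega
  obtain ⟨z, hz, hzxy⟩ : ∃ z ∈ S, z ∉ ({x, y} : Finset V) := by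
    apply Finset.exists_mem_notMem_of_card_lt_card
    have := Finset.card_le_two (a := x) (b := y)
    omega
  simp only [Finset.mem_insert, Finset.mem_singleton, not_or] at hzxy
  obtain ⟨hzx, hzy⟩ := hzxy
  have hneg : ∀ j : ℕ, f (-j) = f (((l : ℤ) - j)) := fun j => by
    rw [← h.per]; congr 1; ring
  have hfk' : f (-(k : ℤ)) = g y := by
    rw [hneg, ← hfk]; congr 1; omega
  have hcov : ∀ (f : ℤ → V), IsGatedCycle G C l f g → ∀ w ∈ C, ∃ j : ℕ, j ≤ k ∧
      (w = f j ∨ w = f (-j)) := by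
    intro f h w hw
    obtain ⟨j, hj, rfl⟩ := h.exists_index hw
    by_cases hjk : j ≤ k
    · exact ⟨j, hjk, Or.inl rfl⟩
    · refine ⟨l - j, by omega, Or.inr ?_⟩
      rw [← h.per (-((l - j : ℕ) : ℤ))]; congr 1; omega
  have hQ : ∀ (f : ℤ → V), IsGatedCycle G C l f g → ∀ x y, g x = f 0 → g y = f k →
      ∃ Q : G.Walk x y, Q.length = G.dist x y ∧ ∀ j : ℕ, j ≤ k → f j ∈ Q.support := by
    intro f h x y hx hy
    have := h.exists_geodesic hG (i := 0) (k := k) hx (by rwa [zero_add]) (by omega) hkl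
    simpa using this
  by_cases hgx : g z = g x
  · obtain ⟨Q₁, h1, h1'⟩ := hQ f h x y hf0.symm hfk.symm
    obtain ⟨Q₃, h3, h3'⟩ := hQ _ h.reflect z y (by simp [hgx, hf0]) (by simp [hfk'])
    obtain ⟨Q₂, h2⟩ := hG.exists_walk_length_eq_dist x z
    refine locallyCovered_of_three hG hx hy hz hxy' (Ne.symm hzx) (Ne.symm hzy) Q₁ Q₂ Q₃ h1 h2 h3 ?_
    intro w hw
    obtain ⟨j, hj, rfl | rfl⟩ := hcov f h w hw
    · exact Or.inl (h1' j hj)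
    · exact Or.inr (Or.inr (h3' j hj))
  by_cases hgy : g z = g y
  · obtain ⟨Q₁, h1, h1'⟩ := hQ f h x y hf0.symm hfk.symm
    obtain ⟨Q₂, h2, h2'⟩ := hQ _ h.reflect x z (by simp [hf0]) (by simp [hgy, hfk'])
    obtain ⟨Q₃, h3⟩ := hG.exists_walk_length_eq_dist z y
    refine locallyCovered_of_three hG hx hy hz hxy' (Ne.symm hzx) (Ne.symm hzy) Q₁ Q₂ Q₃ h1 h2 h3 ?_
    intro w hw
    obtain ⟨j, hj, rfl | rfl⟩ := hcov f h w hw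
    · exact Or.inl (h1' j hj)
    · exact Or.inr (Or.inl (h2' j hj))
  -- A reflection puts the gate of `z` on the half with indices from `0` to `k`; the antipode keeps
  -- the index `k`, as `-k` and `k` agree modulo `l`.
  obtain ⟨f, h, hf0, hfk, m, hm0, hmk, hfm⟩ : ∃ f, IsGatedCycle G C l f g ∧ f 0 = g x ∧ f k = g y ∧
      ∃ m : ℕ, 0 < m ∧ m < k ∧ f m = g z := by
    obtain ⟨m, hml, hm⟩ := h.exists_index (h.gate.mem z)
    have hm0 : m ≠ 0 := by rintro rfl; exact hgx (hm.symm.trans hf0)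
    have hmk : m ≠ k := by rintro rfl; exact hgy (hm.symm.trans hfk)
    by_cases hmk' : m < k
    · exact ⟨f, h, hf0, hfk, m, by omega, hmk', hm⟩
    · refine ⟨_, h.reflect, by simpa using hf0, hfk', l - m, by omega, by omega, ?_⟩
      rw [hneg, ← hm]; congr 1; omega
  obtain ⟨Q₁, h1, h1'⟩ := hQ _ h.reflect x y (by simp [hf0]) (by
    rw [← hfk, ← h.per (-(k : ℤ))]; congr 1; omega)
  obtain ⟨Q₂, h2, h2'⟩ := h.exists_geodesic hG (x := x) (y := z) (i := 0) (k := m) hf0.symm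
    (by rw [zero_add]; exact hfm.symm) hm0 (by omega)
  obtain ⟨Q₃, h3, h3'⟩ := h.exists_geodesic hG (x := z) (y := y) (i := m) (k := k - m) hfm.symm
    (by rw [← hfk]; congr 1; omega) (by omega) (by omega)
  refine locallyCovered_of_three hG hx hy hz hxy' (Ne.symm hzx) (Ne.symm hzy) Q₁ Q₂ Q₃ h1 h2 h3 ?_
  intro w hw
  obtain ⟨j, hj, rfl | rfl⟩ := hcov f h w hw
  · by_cases hjm : j ≤ m
    · have := h2' j hjm
      rw [zero_add] at this
      exact Or.inr (Or.inl this)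
    · have := h3' (j - m) (by omega)
      rw [show (m : ℤ) + ((j - m : ℕ) : ℤ) = j by omega] at this
      exact Or.inr (Or.inr this)
  · exact Or.inl (h1' j hj)

end IsGatedCycle

end Covering

/-! ### Paths inside a cycle, middle vertices, simplicial vertices -/

section CyclePaths

variable {V : Type u} {G : SimpleGraph V}

namespace IsGatedCycle

variable {C : Finset V} {l : ℕ} {f : ℤ → V} {g : V → V}

theorem eq_succ_or_eq_pred (h : IsGatedCycle G C l f g) {i : ℤ} {w : V} (hw : w ∈ C)
    (hadj : G.Adj (f i) w) : w = f (i + 1) ∨ w = f (i - 1) := by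
  obtain ⟨j, rfl⟩ := (h.mem_iff w).1 hw
  rcases h.chordless _ _ hadj with ⟨c, hc⟩ | ⟨c, hc⟩
  · right
    rw [← periodic_mul h.per j c]
    congr 1; omega
  · left
    rw [← periodic_mul h.per j c]
    congr 1; omega

/-- A path in the cycle cannot turn back, since the only neighbour of `f i` in `C` besides its
successor has just been visited. Its first step determines its direction. -/
theorem getVert_eq_of_getVert_one (h : IsGatedCycle G C l f g) {y : V} {P : G.Walk (f 0) y}
    (hP : IsPathIn C P) (h1 : P.getVert 1 = f 1) {i : ℕ} (hi : i ≤ P.length) :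
    P.getVert i = f i := by
  induction i using Nat.strong_induction_on with
  | _ i ih =>
  rcases i with _ | _ | i
  · simp
  · simpa using h1
  · have e1 := ih i (by omega) (by omega)
    have e2 := ih (i + 1) (by omega) (by omega)
    have hadj := P.adj_getVert_succ (i := i + 1) (by omega)
    rw [e2] at hadj
    rcases h.eq_succ_or_eq_pred (hP.2 _ (P.getVert_mem_support _)) hadj with h' | h'
    · rw [h']; push_cast; rfl
    · rw [show ((i + 1 : ℕ) : ℤ) - 1 = i by push_cast; ring, ← e1] at h'
      have := hP.1.getVert_injOn (by simp only [Set.mem_ofPred_eq]; omega)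
        (by simp only [Set.mem_ofPred_eq]; omega) h'
      omega

theorem getVert_cases (h : IsGatedCycle G C l f g) {y : V} {P : G.Walk (f 0) y}
    (hP : IsPathIn C P) : (∀ i : ℕ, i ≤ P.length → P.getVert i = f i) ∨
      ∀ i : ℕ, i ≤ P.length → P.getVert i = f (-i) := by
  rcases Nat.eq_zero_or_pos P.length with h0 | h0
  · left
    intro i hi
    have : i = 0 := by omega
    subst this
    simp
  · have hadj := P.adj_getVert_succ (i := 0) h0
    rw [P.getVert_zero] at hadj
    rcases h.eq_succ_or_eq_pred (hP.2 _ (P.getVert_mem_support _)) hadj with h' | h'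
    · left
      exact fun i hi => h.getVert_eq_of_getVert_one hP (by simpa using h') hi
    · right
      have e0 : f 0 = f (-0) := by simp
      have hP' : IsPathIn C (P.copy e0 rfl) :=
        ⟨by simpa using hP.1, by simpa using hP.2⟩
      intro i hi
      have := h.reflect.getVert_eq_of_getVert_one hP' (by simpa using h') (i := i) (by simpa using hi)
      simpa using this

theorem length_lt (h : IsGatedCycle G C l f g) {y : V} {P : G.Walk (f 0) y}
    (hP : IsPathIn C P) : P.length < l := by
  by_contra hlen
  have hl := h.three_le
  have : P.getVert l = P.getVert 0 := by
    rcases h.getVert_cases hP with h' | h'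
    · rw [h' l (by omega), P.getVert_zero, ← h.per 0, zero_add]
    · rw [h' l (by omega), P.getVert_zero, ← h.per, neg_add_cancel]
  have := hP.1.getVert_injOn (by simp only [Set.mem_ofPred_eq]; omega)
        (by simp only [Set.mem_ofPred_eq]; omega) this
  omega

theorem length_eq_or (h : IsGatedCycle G C l f g) {k : ℕ} (hk : k < l) {P : G.Walk (f 0) (f k)}
    (hP : IsPathIn C P) : P.length = k ∨ P.length = l - k := by
  have hlt := h.length_lt hP
  have he := P.getVert_length
  rcases h.getVert_cases hP with h' | h'
  · rw [h' _ le_rfl] at he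
    left
    have := h.eq_of_lt he (by omega) (by omega)
    omega
  · rw [h' _ le_rfl] at he
    -- Here `-P.length - k = l * c` with both lengths in `[0, l)`, which leaves `c = 0` (the trivial
    -- path) and `c = -1` (the complementary arc).
    obtain ⟨c, hc⟩ := h.inj _ _ he
    have hl0 : (0 : ℤ) < l := by omega
    have h1 : -2 < c := by
      by_contra hcon
      have : (l : ℤ) * c ≤ l * (-2) := mul_le_mul_of_nonneg_left (by omega) hl0.le
      omega
    have h2 : c ≤ 0 := by
      by_contra hcon
      have : (l : ℤ) * 1 ≤ l * c := mul_le_mul_of_nonneg_left (by omega) hl0.le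
      omega
    have : c = 0 ∨ c = -1 := by omega
    rcases this with rfl | rfl <;> omega

theorem isPath_arc (h : IsGatedCycle G C l f g) (i : ℤ) {k : ℕ} (hk : k < l) :
    (h.arc i k).IsPath := by
  induction k with
  | zero => simp [arc]
  | succ k ih =>
    simp only [arc, SimpleGraph.Walk.isPath_copy]
    refine (ih (by omega)).concat ?_ _
    rw [h.mem_support_arc]
    rintro ⟨j, hj, he⟩
    have := h.eq_of_lt he (by omega) (by omega)
    omega

theorem getVert_arc (h : IsGatedCycle G C l f g) (i : ℤ) {k j : ℕ} (hj : j ≤ k) :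
    (h.arc i k).getVert j = f (i + j) := by
  induction k with
  | zero =>
    have : j = 0 := by omega
    subst this
    simp
  | succ k ih =>
    rcases hj.eq_or_lt with rfl | hj
    · have := (h.arc i (k + 1)).getVert_length
      rwa [h.length_arc] at this
    · simp only [arc, SimpleGraph.Walk.getVert_copy, SimpleGraph.Walk.concat_eq_append,
        SimpleGraph.Walk.getVert_append, h.length_arc]
      split_ifs with hjk
      · exact ih (by omega)
      · have : j = k := by omega
        subst this
        simp

theorem isPathIn_arc (h : IsGatedCycle G C l f g) {k : ℕ} (hk : k < l) :
    IsPathIn C (h.arc 0 k) := by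
  refine ⟨h.isPath_arc 0 hk, fun w hw => ?_⟩
  obtain ⟨j, -, rfl⟩ := (h.mem_support_arc _ _ _).1 hw
  exact h.mem _

theorem isMiddleVertex (h : IsGatedCycle G C l f g) {k : ℕ} (hk : k < l) (hlk : l ≤ 2 * k)
    (h0 : IsCutVertex G (f 0)) (hk' : IsCutVertex G (f k)) :
    IsMiddleVertex G C (f ((k / 2 : ℕ) : ℤ)) := by
  have hl := h.three_le
  have e : f (0 + k) = f k := by rw [zero_add]
  refine ⟨f 0, h.mem _, f k, h.mem _, h0, hk', fun he => ?_, (h.arc 0 k).copy rfl e, ?_, ?_⟩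
  · have := h.eq_of_lt he (by omega) (by omega)
    omega
  · refine ⟨⟨by simpa using (h.isPathIn_arc hk).1, by simpa using (h.isPathIn_arc hk).2⟩, ?_⟩
    intro Q hQ
    rw [SimpleGraph.Walk.length_copy, h.length_arc]
    rcases h.length_eq_or hk hQ with h' | h' <;> omega
  -- The arc has `k + 1` vertices and `getVert` counts from zero: `(1 + (k + 1)) / 2 - 1 = k / 2`.
  · rw [SimpleGraph.Walk.getVert_copy, SimpleGraph.Walk.support_copy,
      SimpleGraph.Walk.length_support, h.length_arc, h.getVert_arc 0 (by omega), zero_add]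
    congr 2
    omega

/-- A reflection makes the longest path run in positive direction, and comparing it with the
complementary arc gives `l ≤ 2 * k`. -/
theorem exists_of_isMiddleVertex (h : IsGatedCycle G C l f g) {v : V}
    (hv : IsMiddleVertex G C v) : ∃ (f' : ℤ → V) (k : ℕ), IsGatedCycle G C l f' g ∧ k < l ∧
      l ≤ 2 * k ∧ IsCutVertex G (f' 0) ∧ IsCutVertex G (f' k) ∧ v = f' ((k / 2 : ℕ) : ℤ) := by
  obtain ⟨x, hx, y, hy, hxc, hyc, hxy, P, hP, rfl⟩ := hv
  obtain ⟨f, h, rfl⟩ := h.exists_base hx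
  have hl := h.three_le
  have key : ∀ (f : ℤ → V), IsGatedCycle G C l f g → ∀ P : G.Walk (f 0) y, IsLongestPathIn C P →
      IsCutVertex G (f 0) → f 0 ≠ y → (∀ i : ℕ, i ≤ P.length → P.getVert i = f i) →
      ∃ (f' : ℤ → V) (k : ℕ), IsGatedCycle G C l f' g ∧ k < l ∧
      l ≤ 2 * k ∧ IsCutVertex G (f' 0) ∧ IsCutVertex G (f' k) ∧
      P.getVert ((1 + P.support.length) / 2 - 1) = f' ((k / 2 : ℕ) : ℤ) := by
    intro f h P hP hxc hxy hget
    have hlt := h.length_lt hP.1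
    have hend : f P.length = y := by rw [← hget _ le_rfl, P.getVert_length]
    have h0 : 0 < P.length := by
      rcases Nat.eq_zero_or_pos P.length with h0 | h0
      · rw [h0] at hend; exact absurd hend hxy
      · exact h0
    refine ⟨f, P.length, h, hlt, ?_, hxc, by rw [hend]; exact hyc, ?_⟩
    · have e0 : f (-0) = f 0 := by simp
      have e1 : f (-(0 + ((l - P.length : ℕ) : ℤ))) = y := by
        refine Eq.trans ?_ hend
        rw [← h.per]; congr 1; omega
      have hpin := h.reflect.isPathIn_arc (k := l - P.length) (by omega)
      have := hP.2 ((h.reflect.arc 0 (l - P.length)).copy e0 e1)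
        ⟨by simpa using hpin.1, by simpa using hpin.2⟩
      rw [SimpleGraph.Walk.length_copy, h.reflect.length_arc] at this
      omega
    · rw [SimpleGraph.Walk.length_support, hget _ (by omega)]
      congr 2
      omega
  rcases h.getVert_cases hP.1 with h' | h'
  · exact key f h P hP hxc hxy h'
  · have e0 : f 0 = f (-0) := by simp
    have := key _ h.reflect (P.copy e0 rfl)
      ⟨⟨by simpa using hP.1.1, by simpa using hP.1.2⟩, fun Q hQ => by
        have := hP.2 (Q.copy e0.symm rfl) ⟨by simpa using hQ.1, by simpa using hQ.2⟩
        simpa using this⟩ (by simpa using hxc) (by simpa using hxy) (by simpa using h')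
    simpa using this

theorem exists_isShortestPathIn (h : IsGatedCycle G C l f g) (hG : G.Connected) {p q w : V}
    (hp : p ∈ C) (hq : q ∈ C) (hd : G.dist p w + G.dist w q = G.dist p q) :
    ∃ P : G.Walk p q, IsShortestPathIn C P ∧ w ∈ P.support ∧ P.length = G.dist p q := by
  obtain ⟨P, hP⟩ := hG.exists_walk_length_eq_dist p w
  obtain ⟨Q, hQ⟩ := hG.exists_walk_length_eq_dist w q
  have hlen : (P.append Q).length = G.dist p q := by
    rw [SimpleGraph.Walk.length_append]; omega
  refine ⟨P.append Q, ⟨⟨SimpleGraph.Walk.isPath_of_length_eq_dist _ hlen, fun t ht => ?_⟩,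
    fun R _ => hlen ▸ SimpleGraph.dist_le R⟩, by simp, hlen⟩
  exact h.gate.mem_of_dist_add hG hp hq (dist_add_dist_of_mem_support _ hlen ht hG)

/-- Geodesics of `G` between vertices of a gated set stay in it, so shortest paths in `C` are
geodesics of `G` and coverage becomes a statement about distances. -/
theorem coveredByCutVertices_iff (h : IsGatedCycle G C l f g) (hG : G.Connected) :
    CoveredByCutVertices G C ↔ ∀ w ∈ C, ∃ p ∈ C, ∃ q ∈ C, IsCutVertex G p ∧ IsCutVertex G q ∧
      G.dist p w + G.dist w q = G.dist p q := by
  refine forall₂_congr fun w hw => exists_congr fun p => and_congr_right fun hp =>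
    exists_congr fun q => and_congr_right fun hq => and_congr_right fun _ =>
    and_congr_right fun _ => ?_
  constructor
  · rintro ⟨P, hP, hwP⟩
    obtain ⟨Q, hQ, -, hQl⟩ := h.exists_isShortestPathIn hG (w := q) hp hq (by simp)
    have h1 := hP.2 Q hQ.1
    have h2 := SimpleGraph.dist_le P
    exact dist_add_dist_of_mem_support P (by omega) hwP hG
  · intro hd
    obtain ⟨P, hP, hw, -⟩ := h.exists_isShortestPathIn hG hp hq hd
    exact ⟨P, hP, hw⟩

end IsGatedCycle

theorem exists_adj_dist (hG : G.Connected) {u x : V} (hux : u ≠ x) :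
    ∃ y, G.Adj x y ∧ G.dist u y + 1 = G.dist u x := by
  obtain ⟨p, hp⟩ := hG.exists_walk_length_eq_dist x u
  cases p with
  | nil => exact absurd rfl hux
  | @cons _ y _ ha p =>
    refine ⟨y, ha, ?_⟩
    rw [SimpleGraph.Walk.length_cons] at hp
    have h1 := SimpleGraph.dist_le p
    have h2 := hG.dist_triangle (u := x) (v := y) (w := u)
    have h3 := SimpleGraph.dist_le ha.toWalk
    rw [G.dist_comm (u := u), G.dist_comm (u := u)]
    simp only [SimpleGraph.Walk.length_cons, SimpleGraph.Walk.length_nil] at h3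
    omega

/-- A geodesic through `x` could be shortened, since its neighbours on both sides of `x` are equal
or adjacent. So simplicial vertices belong to every strong geodetic set. -/
theorem IsSimplicial.dist_add_ne (hG : G.Connected) {u x w : V} (hx : IsSimplicial G x)
    (hu : u ≠ x) (hw : w ≠ x) : G.dist u x + G.dist x w ≠ G.dist u w := by
  obtain ⟨a, ha, hua⟩ := exists_adj_dist hG hu
  obtain ⟨b, hb, hwb⟩ := exists_adj_dist hG hw
  intro h
  have hab : G.dist a b ≤ 1 := by
    by_cases he : a = b
    · subst he; simp
    · exact SimpleGraph.dist_le (hx ha hb he).toWalk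
  have h1 := hG.dist_triangle (u := u) (v := a) (w := w)
  have h2 := hG.dist_triangle (u := a) (v := b) (w := w)
  rw [G.dist_comm (u := w), G.dist_comm (u := w)] at hwb
  omega

theorem IsSimplicial.not_isCutVertex [Finite V] (hG : G.Connected) {x : V}
    (hx : IsSimplicial G x) : ¬ IsCutVertex G x := by
  intro h
  obtain ⟨u, w, hu, hw, h⟩ := (isCutVertex_iff hG).1 h
  obtain ⟨p, hp⟩ := hG.exists_walk_length_eq_dist u w
  exact hx.dist_add_ne hG hu hw (dist_add_dist_of_mem_support p hp (h p) hG)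

end CyclePaths

/-! ### The chosen vertices form a strong geodetic set -/

section UpperBound

variable {V : Type u} {G : SimpleGraph V}

theorem IsCycleOn.three_le_card (hG : IsCactus G) {C : Finset V} (hC : IsCycleOn G C) :
    3 ≤ C.card := by
  obtain ⟨f, g, h⟩ := hC.exists_isGatedCycle hG
  exact h.three_le

/-- Cut-vertices of `C` are at most half the cycle apart; equality is excluded by parity if the
length is odd and by `hanti` if it is even. So the members of `S` behind them cover their intervals
without choices. -/
theorem locallyCovered_of_coveredByCutVertices (hG : IsCactus G) {S C : Finset V}
    (hC : IsCycleOn G C)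
    (hgate : ∀ g, IsGate G C g → ∀ p ∈ C, IsCutVertex G p → ∃ s ∈ S, g s = p)
    (hcov : CoveredByCutVertices G C) (hanti : Even C.card → ¬ HasAntipodalCutVertices G C) :
    LocallyCovered G S C := by
  obtain ⟨f, g, h⟩ := hC.exists_isGatedCycle hG
  rw [h.coveredByCutVertices_iff hG.1] at hcov
  refine h.locallyCovered_of_dist_lt hG.1 fun w hw _ hwc => ?_
  obtain ⟨p, hp, q, hq, hpc, hqc, hd⟩ := hcov w hw
  obtain ⟨x, hx, rfl⟩ := hgate g h.gate p hp hpc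
  obtain ⟨y, hy, rfl⟩ := hgate g h.gate q hq hqc
  refine ⟨x, hx, y, hy, fun he => ?_, ?_, hd⟩
  · rw [he, SimpleGraph.dist_self] at hd
    have h2 : G.dist (g y) w = 0 := by omega
    rw [hG.1.dist_eq_zero_iff] at h2
    exact hwc (h2 ▸ hqc)
  · have h1 := h.two_mul_dist_le hG.1 hp hq
    rcases Nat.even_or_odd C.card with heven | hodd
    · refine lt_of_le_of_ne h1 fun he => hanti heven ⟨_, hp, _, hq, hpc, hqc, by omega⟩
    · obtain ⟨m, hm⟩ := hodd
      omega

variable [DecidableEq V]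

/-- The two cut-vertices and the middle vertex divide the cycle into arcs of lengths `k / 2`, `k - k
/ 2` and `C.card - k`. The first is below half the length because `k < C.card`, the third because
the cut-vertices are not antipodal. -/
theorem locallyCovered_of_isMiddleVertex (hG : IsCactus G) {S C : Finset V}
    (hC : IsCycleOn G C)
    (hgate : ∀ g, IsGate G C g → ∀ p ∈ C, IsCutVertex G p → ∃ s ∈ S, g s = p)
    (h3 : Even C.card → 3 ≤ S.card) (hanti : Even C.card → ¬ HasAntipodalCutVertices G C)
    {v : V} (hv : IsMiddleVertex G C v) (hvS : v ∈ S) : LocallyCovered G S C := by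
  obtain ⟨f, g, h⟩ := hC.exists_isGatedCycle hG
  obtain ⟨f, k, h, hk, hlk, h0, hkc, rfl⟩ := h.exists_of_isMiddleVertex hv
  have hl := h.three_le
  obtain ⟨x, hx, hgx⟩ := hgate g h.gate _ (h.mem 0) h0
  obtain ⟨y, hy, hgy⟩ := hgate g h.gate _ (h.mem k) hkc
  have hgv := h.gate.fix _ (h.mem ((k / 2 : ℕ) : ℤ))
  have hlk' : C.card ≠ 2 * k := by
    intro he
    have heven : Even C.card := ⟨k, by omega⟩
    refine hanti heven ⟨_, h.mem 0, _, h.mem k, h0, hkc, ?_⟩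
    rw [h.dist_zero hG.1 hk.le]
    omega
  -- The second arc reaches half the length only if `k = C.card - 1` is odd; then the middle vertex
  -- and `f k` are antipodal, and a third member of `S` is needed.
  by_cases hap : 2 * (k - k / 2) = C.card
  · refine h.locallyCovered_of_antipodal hG.1 (h3 ⟨k - k / 2, by omega⟩) hvS hy ?_
    rw [hgv, hgy, h.dist_eq hG.1 (by omega : k / 2 ≤ k) hk.le]
    omega
  · refine h.locallyCovered_of_dist_lt hG.1 fun w hw _ _ => ?_
    obtain ⟨i, hi, rfl⟩ := h.exists_index hw
    by_cases h1 : i ≤ k / 2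
    · refine ⟨x, hx, _, hvS, ?_⟩
      rw [hgx, hgv, h.dist_zero hG.1 hi.le, h.dist_zero hG.1 (by omega),
        h.dist_eq hG.1 h1 (by omega)]
      refine ⟨fun he => ?_, by omega, by omega⟩
      have := h.eq_of_lt he (by omega) (by omega)
      omega
    · by_cases h2 : i ≤ k
      · refine ⟨_, hvS, y, hy, ?_⟩
        rw [hgy, hgv, h.dist_eq hG.1 (by omega : k / 2 ≤ k) (by omega),
          h.dist_eq hG.1 (by omega : k / 2 ≤ i) (by omega), h.dist_eq hG.1 h2 (by omega)]
        refine ⟨fun he => ?_, by omega, by omega⟩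
        have := h.eq_of_lt he (by omega) (by omega)
        omega
      · refine ⟨x, hx, y, hy, ?_⟩
        rw [hgx, hgy, G.dist_comm (u := f i), h.dist_zero hG.1 hi.le, h.dist_zero hG.1 (by omega),
          h.dist_eq hG.1 (by omega : k ≤ i) (by omega)]
        refine ⟨fun he => ?_, by omega, by omega⟩
        have := h.eq_of_lt he (by omega) (by omega)
        omega

theorem not_isCycleOn_pair (hG : IsCactus G) (x y : V) : ¬ IsCycleOn G {x, y} := by
  intro h
  have h1 := h.three_le_card hG
  have h2 := Finset.card_le_two (a := x) (b := y)
  omega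

theorem locallyCovered_of_leafStep (hG : IsCactus G) {S C X : Finset V} (hC : IsCycleOn G C)
    (hgate : ∀ g, IsGate G C g → ∀ p ∈ C, IsCutVertex G p → ∃ s ∈ S, g s = p)
    (h3 : Even C.card → 3 ≤ S.card) (hX : LeafStep G C X) (hXS : X ⊆ S) :
    LocallyCovered G S C := by
  obtain ⟨f, g, h⟩ := hC.exists_isGatedCycle hG
  cases hX with
  | edge x y _ _ => exact absurd hC (not_isCycleOn_pair hG _ _)
  | evenCycle _ a v _ heven ha hac hv hd =>
    obtain ⟨s, hs, hsa⟩ := hgate g h.gate a ha hac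
    refine h.locallyCovered_of_antipodal hG.1 (h3 heven) hs (hXS (by simp : v ∈ {v})) ?_
    rw [hsa, h.gate.fix _ hv, hd]
    obtain ⟨m, hm⟩ := heven
    omega
  | oddCycle _ a x y _ hodd ha hac hx hy hxy hdx hdy =>
    obtain ⟨s, hs, hsa⟩ := hgate g h.gate a ha hac
    obtain ⟨f, k, h, rfl, rfl, hk⟩ := h.exists_base_pair ha hx
    obtain ⟨j, hj, rfl⟩ := h.exists_index hy
    obtain ⟨m, hm⟩ := hodd
    have hkj : k ≠ j := fun h => hxy (by rw [h])
    rw [h.dist_zero hG.1 (by omega)] at hdx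
    rw [h.dist_zero hG.1 hj.le] at hdy
    -- The two far vertices are `f m` and `f (m + 1)`, both at distance `m` from the cut-vertex in a
    -- cycle of length `2 * m + 1`; the two short arcs to them cover the cycle.
    have hk' : k = m := by omega
    have hj' : j = m + 1 := by omega
    have := h.three_le
    refine h.locallyCovered_of_dist_lt hG.1 fun w hw _ _ => ?_
    obtain ⟨i, hi, rfl⟩ := h.exists_index hw
    by_cases him : i ≤ k
    · refine ⟨s, hs, f k, hXS (by simp), ?_⟩
      rw [hsa, h.gate.fix _ (h.mem _), h.dist_zero hG.1 hi.le, h.dist_zero hG.1 (by omega),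
        h.dist_eq hG.1 him (by omega)]
      refine ⟨fun he => ?_, by omega, by omega⟩
      have := h.eq_of_lt he (by omega) (by omega)
      omega
    · refine ⟨s, hs, f j, hXS (by simp), ?_⟩
      rw [hsa, h.gate.fix _ (h.mem _), G.dist_comm (u := f i), h.dist_zero hG.1 hi.le,
        h.dist_zero hG.1 (by omega), h.dist_eq hG.1 (by omega : j ≤ i) (by omega)]
      refine ⟨fun he => ?_, by omega, by omega⟩
      have := h.eq_of_lt he (by omega) (by omega)
      omega

theorem locallyCovered_of_internalStep (hG : IsCactus G) {S C X : Finset V} (hC : IsCycleOn G C)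
    (hgate : ∀ g, IsGate G C g → ∀ p ∈ C, IsCutVertex G p → ∃ s ∈ S, g s = p)
    (h3 : Even C.card → 3 ≤ S.card) (hX : InternalStep G C X) (hXS : X ⊆ S) :
    LocallyCovered G S C := by
  cases hX with
  | edge x y _ => exact absurd hC (not_isCycleOn_pair hG _ _)
  | oddCovered _ _ hodd hcov =>
    exact locallyCovered_of_coveredByCutVertices hG hC hgate hcov
      fun he => absurd he (Nat.not_even_iff_odd.2 hodd)
  | oddUncovered _ v _ hodd _ hv =>
    exact locallyCovered_of_isMiddleVertex hG hC hgate h3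
      (fun he => absurd he (Nat.not_even_iff_odd.2 hodd)) hv (hXS (by simp))
  | evenAntipodal _ _ heven hanti =>
    obtain ⟨p, hp, q, hq, hpc, hqc, hd⟩ := hanti
    obtain ⟨f, g, h⟩ := hC.exists_isGatedCycle hG
    obtain ⟨x, hx, rfl⟩ := hgate g h.gate p hp hpc
    obtain ⟨y, hy, rfl⟩ := hgate g h.gate q hq hqc
    refine h.locallyCovered_of_antipodal hG.1 (h3 heven) hx hy ?_
    obtain ⟨m, hm⟩ := heven
    omega
  | evenCovered _ _ heven hanti hcov =>
    exact locallyCovered_of_coveredByCutVertices hG hC hgate hcov fun _ => hanti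
  | evenUncovered _ v _ heven hanti _ hv =>
    exact locallyCovered_of_isMiddleVertex hG hC hgate h3 (fun _ => hanti) hv (hXS (by simp))

variable [Finite V]

theorem LeafStep.exists_mem_ne (hG : IsCactus G) {B X : Finset V} (h : LeafStep G B X)
    (hB : IsLeafBlock G B) {a : V} (ha : a ∈ B) (hac : IsCutVertex G a) :
    ∃ s ∈ X, s ∈ B ∧ s ≠ a := by
  obtain ⟨hb, a', ha', hac', hu⟩ := isLeafBlock_iff.1 hB
  cases h with
  | edge x y hxy hx =>
    exact ⟨x, by simp, by simp, fun h => hx.not_isCutVertex hG.1 (h ▸ hac)⟩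
  | evenCycle _ b v hC _ hb' hbc hv hd =>
    refine ⟨v, by simp, hv, ?_⟩
    rintro rfl
    obtain ⟨f, g, h⟩ := hC.exists_isGatedCycle hG
    have := h.three_le
    rw [(hu _ hb' hbc).trans (hu _ hv hac).symm, SimpleGraph.dist_self] at hd
    omega
  | oddCycle _ b v w hC _ hb' hbc hv hw _ hd _ =>
    refine ⟨v, by simp, hv, ?_⟩
    rintro rfl
    obtain ⟨f, g, h⟩ := hC.exists_isGatedCycle hG
    have := h.three_le
    rw [(hu _ hb' hbc).trans (hu _ hv hac).symm, SimpleGraph.dist_self] at hd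
    omega

/-- Some `z` hangs at `p`, and `S` meets the component of `z` in `G - p`; a member of that component
with another gate would be reached from `z` only through `p`. -/
theorem IsBlock.exists_gate_eq (hG : IsCactus G) {S : Finset V}
    (hS : ∀ B, IsLeafBlock G B → ∀ a ∈ B, IsCutVertex G a → ∃ s ∈ S, s ∈ B ∧ s ≠ a)
    {B : Finset V} {g : V → V} (hB : IsBlock G B) (hg : IsGate G B g) {p : V} (hp : p ∈ B)
    (hpc : IsCutVertex G p) : ∃ s ∈ S, g s = p := by
  have := nontrivial_of_isCutVertex hG.1 hpc
  obtain ⟨z, hzp, hz⟩ := (hB.isCutVertex_iff_exists hG hg hp).1 hpc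
  obtain ⟨s, hs, q, hq⟩ := exists_mem_avoiding hG hS hpc hzp
  refine ⟨s, hs, ?_⟩
  by_contra hne
  exact hq (hz ▸ hg.mem_support_of_ne q (by rw [hz]; exact Ne.symm hne))

theorem isStrongGeodeticSet_of_steps (hG : IsCactus G) (hcut : ∃ a, IsCutVertex G a)
    {S : Finset V} (hleaf : ∀ B, IsLeafBlock G B → ∃ X, LeafStep G B X ∧ X ⊆ S)
    (hinner : ∀ B, IsInternalBlock G B → ∃ X, InternalStep G B X ∧ X ⊆ S)
    (h3 : (∃ C, IsBlock G C ∧ IsCycleOn G C ∧ Even C.card) → 3 ≤ S.card) :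
    IsStrongGeodeticSet G S := by
  obtain ⟨a, ha⟩ := hcut
  have := nontrivial_of_isCutVertex hG.1 ha
  have hS : ∀ B, IsLeafBlock G B → ∀ a ∈ B, IsCutVertex G a → ∃ s ∈ S, s ∈ B ∧ s ≠ a := by
    intro B hB b hb hbc
    obtain ⟨X, hX, hXS⟩ := hleaf B hB
    obtain ⟨s, hs, h⟩ := hX.exists_mem_ne hG hB hb hbc
    exact ⟨s, hXS hs, h⟩
  refine isStrongGeodeticSet_of_locallyCovered hG ?_ ?_ ?_
  -- A cut-vertex separates two members of `S` taken from different components of its complement, so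
  -- every path between them contains it.
  · intro w hw _
    obtain ⟨u, v, hu, hv, h⟩ := (isCutVertex_iff hG.1).1 hw
    obtain ⟨s, hs, p, hp⟩ := exists_mem_avoiding hG hS hw hu
    obtain ⟨t, ht, q, hq⟩ := exists_mem_avoiding hG hS hw hv
    refine ⟨s, hs, t, ht, fun r => ?_⟩
    have := h ((p.append r).append q.reverse)
    simpa [hp, hq] using this
  · intro w hw hwS
    obtain ⟨v, hwv⟩ := exists_adj hG.1 w
    rcases exists_isCycleOn_or_isGate_edge hG hwv with ⟨C, hC, hwC, -⟩ | ⟨g, hg⟩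
    · exact ⟨C, hC, hwC⟩
    -- A non-cut-vertex `w` with an edge on no cycle is an end of a leaf block `{w, v}`: if `v` were
    -- no cut-vertex either, the edge would be the whole graph. The member of `S` in it other than
    -- `v` is `w`.
    · exfalso
      have hB := hg.isBlock (isBiconnected_edge hwv) (by simp) (by simp) hwv.ne
      have hvc : IsCutVertex G v := by
        by_contra hvc
        have hall : ∀ z, z ∈ ({w, v} : Finset V) := by
          intro z
          by_contra hz
          have h1 := (hB.isCutVertex_iff_exists hG hg (hg.mem z)).2
            ⟨z, fun h => hz (h ▸ hg.mem z), rfl⟩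
          have h2 := hg.mem z
          simp only [Finset.mem_insert, Finset.mem_singleton] at h2
          rcases h2 with h2 | h2 <;> rw [h2] at h1
          · exact hw h1
          · exact hvc h1
        have h2 := hall a
        simp only [Finset.mem_insert, Finset.mem_singleton] at h2
        rcases h2 with rfl | rfl
        · exact hw ha
        · exact hvc ha
      have hL : IsLeafBlock G {w, v} := by
        refine isLeafBlock_iff.2 ⟨hB, v, by simp, hvc, fun b hb hbc => ?_⟩
        simp only [Finset.mem_insert, Finset.mem_singleton] at hb
        rcases hb with rfl | rfl
        · exact absurd hbc hw
        · rfl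
      obtain ⟨s, hs, hs1, hs2⟩ := hS _ hL v (by simp) hvc
      simp only [Finset.mem_insert, Finset.mem_singleton] at hs1
      rcases hs1 with rfl | rfl
      · exact hwS hs
      · exact hs2 rfl
  · intro C hC
    have hB := hC.isBlock hG
    have hgate : ∀ g, IsGate G C g → ∀ p ∈ C, IsCutVertex G p → ∃ s ∈ S, g s = p :=
      fun g hg p hp hpc => hB.exists_gate_eq hG hS hg hp hpc
    have h3' : Even C.card → 3 ≤ S.card := fun he => h3 ⟨C, hB, hC, he⟩
    by_cases hL : IsLeafBlock G C
    · obtain ⟨X, hX, hXS⟩ := hleaf C hL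
      exact locallyCovered_of_leafStep hG hC hgate h3' hX hXS
    · obtain ⟨X, hX, hXS⟩ := hinner C (isInternalBlock_iff.2 ⟨hB, hL⟩)
      exact locallyCovered_of_internalStep hG hC hgate h3' hX hXS

end UpperBound

/-! ### What every strong geodetic set must contain -/

section LowerBound

variable {V : Type u} {G : SimpleGraph V}

theorem IsStrongGeodeticSet.exists_dist_add (hG : G.Connected) {S : Finset V}
    (hS : IsStrongGeodeticSet G S) {w : V} (hw : w ∉ S) :
    ∃ x ∈ S, ∃ y ∈ S, G.dist x w + G.dist w y = G.dist x y := by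
  obtain ⟨P, hP, -, hcov⟩ := hS
  obtain ⟨x, y, h⟩ := hcov w hw
  exact ⟨x.1, x.2, y.1, y.2, dist_add_dist_of_mem_support _ (hP x y) h hG⟩

theorem eq_of_dist_eq_of_mem_support (hG : G.Connected) {x y u w : V} (P : G.Walk x y)
    (hP : P.length = G.dist x y) (hu : u ∈ P.support) (hw : w ∈ P.support)
    (hd : G.dist x u = G.dist x w) : u = w := by
  classical
  have h1 := dist_add_dist_of_mem_support P hP hu hG
  have h2 := dist_add_dist_of_mem_support P hP hw hG
  have hlen : (P.takeUntil w hw).length + (P.dropUntil w hw).length = P.length := by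
    rw [← SimpleGraph.Walk.length_append, SimpleGraph.Walk.take_spec]
  have h3 := SimpleGraph.dist_le (P.takeUntil w hw)
  have h4 := SimpleGraph.dist_le (P.dropUntil w hw)
  rw [← P.take_spec hw, SimpleGraph.Walk.mem_support_append_iff] at hu
  rcases hu with hu | hu
  · have h5 := dist_add_dist_of_mem_support _ (by omega) hu hG
    exact hG.dist_eq_zero_iff.1 (by omega)
  · have h5 := dist_add_dist_of_mem_support _ (by omega) hu hG
    exact (hG.dist_eq_zero_iff.1 (by omega)).symm

/-- At most two vertices have essentially one fixed path: the reversed path has the same vertices,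
and the paths on the diagonal are trivial. For a single vertex, `x = y`. -/
theorem IsStrongGeodeticSet.exists_covering_walk (hG : G.Connected) {S : Finset V}
    (hS : IsStrongGeodeticSet G S) (hcard : S.card < 3) :
    ∃ (x y : V) (P : G.Walk x y), P.length = G.dist x y ∧ ∀ w, w ∈ P.support := by
  classical
  obtain ⟨P, hP, hrev, hcov⟩ := hS
  have hself : ∀ x, (P x x).support = [x.1] := fun x => by
    have : P x x = .nil := SimpleGraph.Walk.eq_nil_iff_nil.2
        (SimpleGraph.Walk.length_eq_zero_iff.1 (by rw [hP, SimpleGraph.dist_self]))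
    rw [this]; simp
  obtain ⟨v⟩ := hG.nonempty
  have hSne : S.Nonempty := by
    by_cases hv : v ∈ S
    · exact ⟨v, hv⟩
    · obtain ⟨x, -⟩ := hcov v hv
      exact ⟨x.1, x.2⟩
  obtain ⟨x, hx⟩ := hSne
  obtain ⟨y, hy, hSxy⟩ : ∃ y ∈ S, ∀ z ∈ S, z = x ∨ z = y := by
    by_cases h : ∃ y ∈ S, y ≠ x
    · obtain ⟨y, hy, hyx⟩ := h
      refine ⟨y, hy, fun z hz => ?_⟩
      by_contra! hcon
      have : ({x, y, z} : Finset V).card ≤ S.card := by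
        apply Finset.card_le_card
        intro t ht
        simp only [Finset.mem_insert, Finset.mem_singleton] at ht
        rcases ht with rfl | rfl | rfl <;> assumption
      rw [Finset.card_eq_three.2 ⟨x, y, z, hyx.symm, hcon.1.symm, hcon.2.symm, rfl⟩] at this
      omega
    · push Not at h
      exact ⟨x, hx, fun z hz => Or.inl (h z hz)⟩
  refine ⟨x, y, P ⟨x, hx⟩ ⟨y, hy⟩, hP _ _, fun w => ?_⟩
  by_cases hw : w ∈ S
  · rcases hSxy w hw with rfl | rfl
    · exact SimpleGraph.Walk.start_mem_support _
    · exact SimpleGraph.Walk.end_mem_support _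
  · obtain ⟨⟨a, ha⟩, ⟨b, hb⟩, hab⟩ := hcov w hw
    rcases hSxy a ha with rfl | rfl <;> rcases hSxy b hb with rfl | rfl
    · rw [hself, List.mem_singleton] at hab
      exact absurd (hab ▸ ha) hw
    · exact hab
    · rw [hrev, SimpleGraph.Walk.support_reverse, List.mem_reverse] at hab
      exact hab
    · rw [hself, List.mem_singleton] at hab
      exact absurd (hab ▸ ha) hw

/-- With fewer vertices one geodesic from some `x` would contain all of `G`. But the two cycle
neighbours of the gate of `x` are equally far from `x`, and a geodesic has only one vertex at each
distance from its start. -/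
theorem IsStrongGeodeticSet.three_le_card (hG : IsCactus G) {S C : Finset V}
    (hS : IsStrongGeodeticSet G S) (hC : IsCycleOn G C) : 3 ≤ S.card := by
  by_contra hcard
  obtain ⟨x, y, P, hP, hcov⟩ := hS.exists_covering_walk hG.1 (by omega)
  obtain ⟨f, g, h⟩ := hC.exists_isGatedCycle hG
  obtain ⟨f, h, hf⟩ := h.exists_base (h.gate.mem x)
  have hl := h.three_le
  have h1 : G.dist x (f 1) = G.dist x (g x) + 1 := by
    rw [h.gate.dist_eq hG.1 x (h.mem 1), ← hf]
    have := h.dist_zero hG.1 (k := 1) (by omega)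
    rw [Nat.cast_one] at this
    omega
  have h2 : G.dist x (f (-1)) = G.dist x (g x) + 1 := by
    rw [h.gate.dist_eq hG.1 x (h.mem (-1)), ← hf]
    have := h.reflect.dist_zero hG.1 (k := 1) (by omega)
    rw [Nat.cast_one, neg_zero] at this
    omega
  have := h.eq_of_lt (eq_of_dist_eq_of_mem_support hG.1 P hP (hcov _) (hcov _) (h1.trans h2.symm))
    (by omega) (by omega)
  omega

variable [DecidableEq V]

open Classical in
/-- The vertices of `S` in `B` that are not cut-vertices. -/
noncomputable def innerPart (G : SimpleGraph V) (S B : Finset V) : Finset V :=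
  S.filter fun s => s ∈ B ∧ ¬ IsCutVertex G s

theorem mem_innerPart {S B : Finset V} {s : V} :
    s ∈ innerPart G S B ↔ s ∈ S ∧ s ∈ B ∧ ¬ IsCutVertex G s := by
  simp [innerPart]

variable [Finite V]

/-- The ends of a path through `w` are replaced by their gates. A gate that is no cut-vertex is the
gate of itself only, so it is the end in `S` itself. -/
theorem IsStrongGeodeticSet.exists_gates_dist_add (hG : IsCactus G) {S C : Finset V} {g : V → V}
    (hS : IsStrongGeodeticSet G S) (hC : IsBlock G C) (hg : IsGate G C g) {w : V} (hw : w ∈ C)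
    (hwS : w ∉ S) :
    ∃ p ∈ C, ∃ q ∈ C, (IsCutVertex G p ∨ p ∈ innerPart G S C) ∧
      (IsCutVertex G q ∨ q ∈ innerPart G S C) ∧ G.dist p w + G.dist w q = G.dist p q := by
  have hgate : ∀ x ∈ S, IsCutVertex G (g x) ∨ g x ∈ innerPart G S C := by
    intro x hx
    by_cases hc : IsCutVertex G (g x)
    · exact Or.inl hc
    · right
      have hxg : x = g x := by
        by_contra hne
        have : Nontrivial V := ⟨x, g x, hne⟩
        exact hc ((hC.isCutVertex_iff_exists hG hg (hg.mem x)).2 ⟨x, hne, rfl⟩)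
      exact mem_innerPart.2 ⟨hxg ▸ hx, hg.mem x, hc⟩
  obtain ⟨x, hx, y, hy, hd⟩ := hS.exists_dist_add hG.1 hwS
  exact ⟨g x, hg.mem x, g y, hg.mem y, hgate x hx, hgate y hy, hg.dist_gate_add hG.1 hw hd⟩

/-- In a leaf cycle without inner members of `S` the single cut-vertex would be the only gate, and
nothing else would be covered. A simplicial end of an edge is indispensable. -/
theorem LeafStep.card_le (hG : IsCactus G) {S B X : Finset V} (hS : IsStrongGeodeticSet G S)
    (hB : IsLeafBlock G B) (hX : LeafStep G B X) : X.card ≤ (innerPart G S B).card := by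
  obtain ⟨hb, a', ha', hac', hu⟩ := isLeafBlock_iff.1 hB
  have hne : IsCycleOn G B → (innerPart G S B).Nonempty := by
    intro hC
    by_contra hempty
    rw [Finset.not_nonempty_iff_eq_empty] at hempty
    obtain ⟨f, g, h⟩ := hC.exists_isGatedCycle hG
    obtain ⟨f, h, rfl⟩ := h.exists_base ha'
    have hl := h.three_le
    have h1c : ¬ IsCutVertex G (f 1) := by
      intro hc
      have := h.eq_of_lt (hu _ (h.mem 1) hc) (by omega) (by omega)
      omega
    have h1 : f 1 ∉ S := by
      intro h1
      have : f 1 ∈ innerPart G S B := mem_innerPart.2 ⟨h1, h.mem 1, h1c⟩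
      rw [hempty] at this
      simp at this
    obtain ⟨p, hp, q, hq, hp', hq', hd⟩ := hS.exists_gates_dist_add hG hb h.gate (h.mem 1) h1
    rw [hempty] at hp' hq'
    simp only [Finset.notMem_empty, or_false] at hp' hq'
    rw [hu p hp hp', hu q hq hq', SimpleGraph.dist_self] at hd
    have : f 0 = f 1 := hG.1.dist_eq_zero_iff.1 (by omega)
    have := h.eq_of_lt this (by omega) (by omega)
    omega
  cases hX with
  | edge x y hxy hx =>
    rw [Finset.card_singleton, Nat.one_le_iff_ne_zero, Finset.card_ne_zero]
    refine ⟨x, mem_innerPart.2 ⟨?_, by simp, hx.not_isCutVertex hG.1⟩⟩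
    by_contra hxS
    obtain ⟨u, hu, w, hw, hd⟩ := hS.exists_dist_add hG.1 hxS
    exact hx.dist_add_ne hG.1 (fun h => hxS (h ▸ hu)) (fun h => hxS (h ▸ hw)) hd
  | evenCycle _ a v hC _ _ _ _ _ =>
    rw [Finset.card_singleton]
    exact Finset.card_pos.2 (hne hC)
  | oddCycle _ a x y hC hodd ha hac _ _ _ _ _ =>
    refine (Finset.card_le_two).trans ?_
    by_contra hcard
    obtain ⟨v, hv⟩ := hne hC
    have hall : ∀ z ∈ innerPart G S B, z = v := by
      intro z hz
      by_contra hzv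
      exact hcard (Finset.one_lt_card.2 ⟨z, hz, v, hv, hzv⟩)
    obtain ⟨hvS, hvB, hvc⟩ := mem_innerPart.1 hv
    obtain ⟨f, g, h⟩ := hC.exists_isGatedCycle hG
    obtain ⟨f, k, h, hf0, rfl, hk⟩ := h.exists_base_pair ha' hvB
    have hl := h.three_le
    obtain ⟨m, hm⟩ := hodd
    have hk0 : 0 < k := by
      rcases Nat.eq_zero_or_pos k with rfl | hk
      · rw [Nat.cast_zero, hf0] at hvc; exact absurd hac' hvc
      · exact hk
    -- One inner vertex `f k` is not enough in an odd cycle: here `2 * k < B.card`, so `f (k + 1)`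
    -- is off the short arc from `f 0` to `f k`, the only geodesic between these gates.
    have hw0 : ¬ IsCutVertex G (f (k + 1)) := by
      intro hc
      have := h.eq_of_lt (hf0.trans (hu _ (h.mem _) hc).symm) (by omega) (by omega)
      omega
    have hwS : f (k + 1) ∉ S := by
      intro hwS
      have := hall _ (mem_innerPart.2 ⟨hwS, h.mem _, hw0⟩)
      have := h.eq_of_lt this (by omega) (by omega)
      omega
    obtain ⟨p, hp, q, hq, hp', hq', hd⟩ := hS.exists_gates_dist_add hG hb h.gate (h.mem _) hwS
    have hgate : ∀ p ∈ B, (IsCutVertex G p ∨ p ∈ innerPart G S B) → p = f 0 ∨ p = f k := by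
      rintro p hp (h' | h')
      · exact Or.inl ((hu p hp h').trans hf0.symm)
      · exact Or.inr (hall p h')
    have e1 := h.dist_zero hG.1 (k := k) (by omega)
    have e2 := h.dist_zero hG.1 (k := k + 1) (by omega)
    have e3 := h.dist_eq hG.1 (i := k) (j := k + 1) (by omega) (by omega)
    push_cast at e2 e3
    have e4 := G.dist_comm (u := f 0) (v := f (k + 1))
    have e5 := G.dist_comm (u := f k) (v := f (k + 1))
    have e6 := G.dist_comm (u := f 0) (v := f k)
    rcases hgate p hp hp' with rfl | rfl <;> rcases hgate q hq hq' with rfl | rfl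
    · rw [SimpleGraph.dist_self] at hd; omega
    · omega
    · omega
    · rw [SimpleGraph.dist_self] at hd; omega

/-- Without inner members of `S` all gates involved are cut-vertices, so the cycle is covered by the
intervals between cut-vertices; in that case the algorithm adds nothing. -/
theorem InternalStep.card_le (hG : IsCactus G) {S B X : Finset V} (hS : IsStrongGeodeticSet G S)
    (hX : InternalStep G B X) : X.card ≤ (innerPart G S B).card := by
  have hne : IsCycleOn G B → ¬ CoveredByCutVertices G B → 1 ≤ (innerPart G S B).card := by
    intro hC hcov
    by_contra hempty
    have hempty' : innerPart G S B = ∅ := Finset.card_eq_zero.1 (by omega)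
    obtain ⟨f, g, h⟩ := hC.exists_isGatedCycle hG
    refine hcov ((h.coveredByCutVertices_iff hG.1).2 fun w hw => ?_)
    by_cases hwc : IsCutVertex G w
    · exact ⟨w, hw, w, hw, hwc, hwc, by simp⟩
    · have hwS : w ∉ S := by
        intro hwS
        have : w ∈ innerPart G S B := mem_innerPart.2 ⟨hwS, hw, hwc⟩
        rw [hempty'] at this
        simp at this
      obtain ⟨p, hp, q, hq, hp', hq', hd⟩ :=
        hS.exists_gates_dist_add hG (hC.isBlock hG) h.gate hw hwS
      rw [hempty'] at hp' hq'
      simp only [Finset.notMem_empty, or_false] at hp' hq'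
      exact ⟨p, hp, q, hq, hp', hq', hd⟩
  cases hX with
  | edge x y _ => simp
  | oddCovered _ _ _ _ => simp
  | oddUncovered _ v hC _ hcov _ => rw [Finset.card_singleton]; exact hne hC hcov
  | evenAntipodal _ _ _ _ => simp
  | evenCovered _ _ _ _ _ => simp
  | evenUncovered _ v hC _ _ hcov _ => rw [Finset.card_singleton]; exact hne hC hcov

end LowerBound

/-! ### Bookkeeping for the passes over the blocks -/

section Passes

variable {V : Type u} [DecidableEq V] {step : Finset V → Finset V → Prop}

theorem Pass.subset {Bs : List (Finset V)} {S S' : Finset V} (h : Pass step Bs S S') :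
    S ⊆ S' ∧ ∀ B ∈ Bs, ∃ X, step B X ∧ X ⊆ S' := by
  induction h with
  | nil S => simp
  | cons B Bs X S S' hX _ ih =>
    refine ⟨Finset.subset_union_left.trans ih.1, fun B' hB' => ?_⟩
    rcases List.mem_cons.1 hB' with rfl | hB'
    · exact ⟨X, hX, Finset.subset_union_right.trans ih.1⟩
    · exact ih.2 B' hB'

theorem Pass.card_le {Bs : List (Finset V)} {S S' : Finset V} (h : Pass step Bs S S')
    {c : Finset V → ℕ} (hc : ∀ B ∈ Bs, ∀ X, step B X → X.card ≤ c B) :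
    S'.card ≤ S.card + (Bs.map c).sum := by
  induction h with
  | nil S => simp
  | cons B Bs X S S' hX _ ih =>
    have h1 := ih fun B' hB' => hc B' (List.mem_cons_of_mem _ hB')
    have h2 := hc B List.mem_cons_self X hX
    have h3 := Finset.card_union_le S X
    rw [List.map_cons, List.sum_cons]
    omega

theorem Pass.of_forall {Bs : List (Finset V)} {X : Finset V → Finset V}
    (h : ∀ B ∈ Bs, step B (X B)) (S : Finset V) : Pass step Bs S (S ∪ Bs.toFinset.biUnion X) := by
  induction Bs generalizing S with
  | nil => simpa using Pass.nil S
  | cons B Bs ih =>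
    have := Pass.cons B Bs (X B) S _ (h B List.mem_cons_self)
      (ih (fun B' hB' => h B' (List.mem_cons_of_mem _ hB')) (S ∪ X B))
    convert this using 1
    rw [List.toFinset_cons, Finset.biUnion_insert, Finset.union_assoc]

end Passes

/-! ### Every output of the algorithm is minimum -/

section Correctness

variable {V : Type u} {G : SimpleGraph V} [Fintype V] [DecidableEq V]

theorem isMinimumStrongGeodeticSet_of_isAlgorithmOutput (hG : IsCactus G)
    (hcut : ∃ a, IsCutVertex G a) {S : Finset V} (h : IsAlgorithmOutput G S) :
    IsMinimumStrongGeodeticSet G S := by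
  classical
  obtain ⟨leaves, internals, S₀, S₁, hnd, hleaf, hnd', hinner, hp, hp', hfin⟩ := h
  obtain ⟨a, ha⟩ := hcut
  have := nontrivial_of_isCutVertex hG.1 ha
  -- Summing the local bounds over all blocks is legitimate because the inner parts of `S'` in
  -- different blocks are disjoint.
  have hS₁ : ∀ S', IsStrongGeodeticSet G S' → S₁.card ≤ S'.card := by
    intro S' hS'
    have h1 := hp.card_le (c := fun B => (innerPart G S' B).card)
      fun B hB X hX => hX.card_le hG hS' ((hleaf B).1 hB)
    have h2 := hp'.card_le (c := fun B => (innerPart G S' B).card)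
      fun B hB X hX => hX.card_le hG hS'
    have hdisj : List.Disjoint leaves internals := by
      intro B hB hB'
      exact (isInternalBlock_iff.1 ((hinner B).1 hB')).2 ((hleaf B).1 hB)
    have hblock : ∀ B ∈ leaves ++ internals, IsBlock G B := by
      intro B hB
      rcases List.mem_append.1 hB with hB | hB
      · exact (isLeafBlock_iff.1 ((hleaf B).1 hB)).1
      · exact (isInternalBlock_iff.1 ((hinner B).1 hB)).1
    have hnd'' : (leaves ++ internals).Nodup := hnd.append hnd' hdisj
    have h3 : ((leaves ++ internals).map fun B => (innerPart G S' B).card).sum ≤ S'.card := by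
      rw [← List.sum_toFinset _ hnd'', ← Finset.card_biUnion]
      · apply Finset.card_le_card
        intro s hs
        obtain ⟨B, -, hs⟩ := Finset.mem_biUnion.1 hs
        exact (mem_innerPart.1 hs).1
      · intro B hB B' hB' hne
        rw [Function.onFun, Finset.disjoint_left]
        intro s hs hs'
        obtain ⟨-, hsB, hsc⟩ := mem_innerPart.1 hs
        obtain ⟨-, hsB', -⟩ := mem_innerPart.1 hs'
        exact hne ((hblock B (by simpa using hB)).eq_of_not_isCutVertex hG
          (hblock B' (by simpa using hB')) hsc hsB hsB')
    rw [List.map_append, List.sum_append] at h3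
    rw [Finset.card_empty] at h1
    omega
  have hstep1 : ∀ B, IsLeafBlock G B → ∃ X, LeafStep G B X ∧ X ⊆ S₁ := by
    intro B hB
    obtain ⟨X, hX, hXS⟩ := hp.subset.2 B ((hleaf B).2 hB)
    exact ⟨X, hX, hXS.trans hp'.subset.1⟩
  have hstep2 : ∀ B, IsInternalBlock G B → ∃ X, InternalStep G B X ∧ X ⊆ S₁ := fun B hB =>
    hp'.subset.2 B ((hinner B).2 hB)
  -- Two components at a cut-vertex each contain a member. Hence an addition in the last step leads
  -- to exactly three vertices, as many as any cycle requires.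
  have htwo : 2 ≤ S₁.card := by
    have hS : ∀ B, IsLeafBlock G B → ∀ a ∈ B, IsCutVertex G a → ∃ s ∈ S₁, s ∈ B ∧ s ≠ a := by
      intro B hB b hb hbc
      obtain ⟨X, hX, hXS⟩ := hstep1 B hB
      obtain ⟨s, hs, h⟩ := hX.exists_mem_ne hG hB hb hbc
      exact ⟨s, hXS hs, h⟩
    obtain ⟨u, v, hu, hv, h⟩ := (isCutVertex_iff hG.1).1 ha
    obtain ⟨s, hs, p, hp⟩ := exists_mem_avoiding hG hS ha hu
    obtain ⟨t, ht, q, hq⟩ := exists_mem_avoiding hG hS ha hv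
    refine Finset.one_lt_card.2 ⟨s, hs, t, ht, ?_⟩
    rintro rfl
    have := h (p.append q.reverse)
    simp [hp, hq] at this
  cases hfin with
  | large h3 =>
    exact ⟨isStrongGeodeticSet_of_steps hG ⟨a, ha⟩ hstep1 hstep2 fun _ => h3, hS₁⟩
  | evenBlock w hlt heven hw =>
    have hc : (insert w S₁).card = S₁.card + 1 := Finset.card_insert_of_notMem hw
    refine ⟨isStrongGeodeticSet_of_steps hG ⟨a, ha⟩ ?_ ?_ fun _ => by omega, ?_⟩
    · intro B hB
      obtain ⟨X, hX, hXS⟩ := hstep1 B hB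
      exact ⟨X, hX, hXS.trans (Finset.subset_insert _ _)⟩
    · intro B hB
      obtain ⟨X, hX, hXS⟩ := hstep2 B hB
      exact ⟨X, hX, hXS.trans (Finset.subset_insert _ _)⟩
    · intro S' hS'
      obtain ⟨C, -, hC, -⟩ := heven
      have := hS'.three_le_card hG hC
      omega
  | noEvenBlock hlt hno =>
    exact ⟨isStrongGeodeticSet_of_steps hG ⟨a, ha⟩ hstep1 hstep2 fun h => absurd h hno, hS₁⟩

end Correctness

/-! ### A deterministic choice described by distances -/

section Choice

variable {V : Type u}

/-- `v` is a middle vertex of a longer arc of the cycle `B` between two cut-vertices. -/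
def IsArcMiddle (G : SimpleGraph V) (B : Finset V) (v : V) : Prop :=
  v ∈ B ∧ ∃ x ∈ B, ∃ y ∈ B, IsCutVertex G x ∧ IsCutVertex G y ∧ x ≠ y ∧
    G.dist x v = (B.card - G.dist x y) / 2 ∧ G.dist x v + G.dist v y = B.card - G.dist x y

/-- `B` contains exactly one cut-vertex. -/
def HasUniqueCutVertex (G : SimpleGraph V) (B : Finset V) : Prop :=
  ∃ a ∈ B, IsCutVertex G a ∧ ∀ b ∈ B, IsCutVertex G b → b = a

/-- `B` is covered by the metric intervals between its cut-vertices. -/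
def CoveredByIntervals (G : SimpleGraph V) (B : Finset V) : Prop :=
  ∀ w ∈ B, ∃ p ∈ B, ∃ q ∈ B, IsCutVertex G p ∧ IsCutVertex G q ∧
    G.dist p w + G.dist w q = G.dist p q

/-- The vertices that are added for the block `B`; ties are broken by `idx`. -/
def IsChosen (G : SimpleGraph V) (idx : V → ℕ) (B : Finset V) (v : V) : Prop :=
  v ∈ B ∧ ((HasUniqueCutVertex G B ∧ ∃ a ∈ B, IsCutVertex G a ∧ G.dist a v = B.card / 2) ∨
    (¬ HasUniqueCutVertex G B ∧ ¬ (Even B.card ∧ HasAntipodalCutVertices G B) ∧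
      ¬ CoveredByIntervals G B ∧ IsArcMiddle G B v ∧
      ∀ v', idx v' < idx v → ¬ IsArcMiddle G B v'))

/-- Some block is an even cycle. -/
def HasEvenCycleBlock (G : SimpleGraph V) : Prop :=
  ∃ C, IsBlock G C ∧ IsCycleOn G C ∧ Even C.card

variable {G : SimpleGraph V}

/-- The longer arc has length `C.card - G.dist x y`, so the two distance equations locate its middle
without mentioning paths. -/
theorem IsArcMiddle.isMiddleVertex (hG : IsCactus G) {C : Finset V} (hC : IsCycleOn G C)
    (hanti : ¬ (Even C.card ∧ HasAntipodalCutVertices G C)) {v : V} (hv : IsArcMiddle G C v) :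
    IsMiddleVertex G C v := by
  obtain ⟨hvC, x, hx, y, hy, hxc, hyc, hxy, h1, h2⟩ := hv
  obtain ⟨f, g, h⟩ := hC.exists_isGatedCycle hG
  obtain ⟨f, k, h, rfl, rfl, hk⟩ := h.exists_base_pair hx hy
  have hl := h.three_le
  have hd := h.dist_zero hG.1 (k := k) (by omega)
  have hk' : 2 * k ≠ C.card := by
    intro he
    exact hanti ⟨⟨k, by omega⟩, _, hx, _, hy, hxc, hyc, by omega⟩
  have hk0 : k ≠ 0 := by rintro rfl; exact hxy rfl
  obtain ⟨j, hj, rfl⟩ := h.exists_index hvC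
  rw [hd, h.dist_zero hG.1 hj.le] at h1
  rw [hd, h.dist_zero hG.1 hj.le, G.dist_comm] at h2
  -- On the short arc the distances to the ends would add up to `k`, not to `C.card - k`.
  have hkj : k < j := by
    by_contra hjk
    rw [G.dist_comm, h.dist_eq hG.1 (by omega : j ≤ k) (by omega)] at h2
    omega
  rw [h.dist_eq hG.1 hkj.le hj.le] at h2
  have hjk : C.card - j = (C.card - k) / 2 := by omega
  have e0 : ∀ i : ℕ, i ≤ C.card → f (-((C.card - i : ℕ) : ℤ)) = f i := by
    intro i hi
    rw [← h.per]; congr 1; omega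
  have := h.reflect.isMiddleVertex (k := C.card - k) (by omega) (by omega)
    (by rw [neg_zero]; exact hxc) (by rw [e0 k (by omega)]; exact hyc)
  rwa [← hjk, e0 j (by omega)] at this

theorem exists_isArcMiddle (hG : IsCactus G) {C : Finset V} (hC : IsCycleOn G C) {x y : V}
    (hx : x ∈ C) (hy : y ∈ C) (hxc : IsCutVertex G x) (hyc : IsCutVertex G y) (hxy : x ≠ y) :
    ∃ v, IsArcMiddle G C v := by
  obtain ⟨f, g, h⟩ := hC.exists_isGatedCycle hG
  obtain ⟨f, k, h, rfl, rfl, hk⟩ := h.exists_base_pair hx hy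
  have hl := h.three_le
  have hk0 : k ≠ 0 := by rintro rfl; exact hxy rfl
  have hd := h.dist_zero hG.1 (k := k) (by omega)
  -- Half of the long arc, counted backwards from `x = f 0`.
  refine ⟨f ((C.card - (C.card - k) / 2 : ℕ) : ℤ), h.mem _, _, hx, _, hy, hxc, hyc, hxy, ?_, ?_⟩
  · rw [hd, h.dist_zero hG.1 (by omega)]
    omega
  · rw [hd, h.dist_zero hG.1 (by omega), G.dist_comm, h.dist_eq hG.1 (by omega) (by omega)]
    omega

variable [Fintype V]

open Classical in
/-- The vertices chosen in the blocks of a graph with cut-vertices. -/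
noncomputable def blockSet (G : SimpleGraph V) (idx : V → ℕ) : Finset V :=
  Finset.univ.filter fun v => ∃ B, IsBlock G B ∧ IsChosen G idx B v

open Classical in
/-- The vertices chosen in a graph without cut-vertices, where `idx` has the value `0` at the
base vertex. -/
noncomputable def singleBlockSet (G : SimpleGraph V) (idx : V → ℕ) : Finset V :=
  Finset.univ.filter fun v => idx v = 0 ∨ ∃ a, idx a = 0 ∧ G.dist a v = Fintype.card V / 2

open Classical in
/-- The set chosen before the last step. -/
noncomputable def baseSet (G : SimpleGraph V) (idx : V → ℕ) : Finset V :=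
  if ∃ a, IsCutVertex G a then blockSet G idx else singleBlockSet G idx

open Classical in
/-- The set returned by the deterministic version of the algorithm. -/
noncomputable def resultSet (G : SimpleGraph V) (idx : V → ℕ) : Finset V :=
  Finset.univ.filter fun v => v ∈ baseSet G idx ∨
    ((baseSet G idx).card < 3 ∧ HasEvenCycleBlock G ∧ v ∉ baseSet G idx ∧
      ∀ v', idx v' < idx v → v' ∈ baseSet G idx)

variable {idx : V → ℕ}

theorem mem_blockSet {v : V} : v ∈ blockSet G idx ↔ ∃ B, IsBlock G B ∧ IsChosen G idx B v := by
  simp [blockSet]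

theorem mem_singleBlockSet {v : V} : v ∈ singleBlockSet G idx ↔
    idx v = 0 ∨ ∃ a, idx a = 0 ∧ G.dist a v = Fintype.card V / 2 := by
  simp [singleBlockSet]

theorem mem_resultSet {v : V} : v ∈ resultSet G idx ↔ v ∈ baseSet G idx ∨
    ((baseSet G idx).card < 3 ∧ HasEvenCycleBlock G ∧ v ∉ baseSet G idx ∧
      ∀ v', idx v' < idx v → v' ∈ baseSet G idx) := by
  simp [resultSet]

variable [DecidableEq V]

theorem IsBlock.exists_isCutVertex [Nontrivial V] (hG : IsCactus G) (hcut : ∃ a, IsCutVertex G a)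
    {B : Finset V} (hB : IsBlock G B) : ∃ a ∈ B, IsCutVertex G a := by
  by_contra! hno
  obtain ⟨a, ha⟩ := hcut
  obtain ⟨g, hg⟩ := hB.exists_isGate hG
  by_cases haB : a ∈ B
  · exact hno a haB ha
  · exact hno (g a) (hg.mem a) ((hB.isCutVertex_iff_exists hG hg (hg.mem a)).2
      ⟨a, fun h => haB (h ▸ hg.mem a), rfl⟩)

theorem isSimplicial_of_isGate_edge [Nontrivial V] (hG : IsCactus G) {w a : V} (hwa : G.Adj w a)
    {g : V → V} (hg : IsGate G {w, a} g) (hw : ¬ IsCutVertex G w) : IsSimplicial G w := by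
  have hB := hg.isBlock (isBiconnected_edge hwa) (by simp) (by simp) hwa.ne
  have hnb : ∀ z, G.Adj w z → z = a := by
    intro z hz
    rcases hg.adj _ _ hz with h | ⟨-, h⟩
    · rw [hg.fix w (by simp)] at h
      exact absurd ((hB.isCutVertex_iff_exists hG hg (by simp)).2 ⟨z, hz.ne', h.symm⟩) hw
    · simp only [Finset.mem_insert, Finset.mem_singleton] at h
      exact h.resolve_left hz.ne'
  intro x hx y hy hxy
  exact absurd ((hnb x hx).trans (hnb y hy).symm) hxy

end Choice

/-! ### The deterministic set is an output, and is minimum also without cut-vertices -/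

section Deterministic

variable {V : Type u} [Fintype V] {G : SimpleGraph V}

theorem isStrongGeodeticSet_univ (hG : G.Connected) : IsStrongGeodeticSet G Finset.univ := by
  choose P hP using fun x y : {x // x ∈ (Finset.univ : Finset V)} =>
    hG.exists_walk_length_eq_dist x.1 y.1
  obtain ⟨Q, h1, h2, -⟩ := exists_symmetric_system P hP
  exact ⟨Q, h1, h2, fun w hw => absurd (Finset.mem_univ w) hw⟩

variable [DecidableEq V] {idx : V → ℕ}

open Classical in
-- Distance `B.card / 2` from the cut-vertex serves all leaf blocks: it selects the other end of an
-- edge, the antipode in an even cycle, and the two farthest vertices of an odd cycle.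
theorem leafStep_isChosen (hG : IsCactus G) {B : Finset V} (hB : IsLeafBlock G B) :
    LeafStep G B (Finset.univ.filter (IsChosen G idx B)) := by
  obtain ⟨hb, a, ha, hac, hu⟩ := isLeafBlock_iff.1 hB
  have := nontrivial_of_isCutVertex hG.1 hac
  have hch : ∀ v, IsChosen G idx B v ↔ v ∈ B ∧ G.dist a v = B.card / 2 := by
    intro v
    have huniq : HasUniqueCutVertex G B := ⟨a, ha, hac, hu⟩
    constructor
    · rintro ⟨hv, ⟨-, b, hb, hbc, hd⟩ | ⟨h, -⟩⟩
      · exact ⟨hv, hu b hb hbc ▸ hd⟩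
      · exact absurd huniq h
    · rintro ⟨hv, hd⟩
      exact ⟨hv, Or.inl ⟨huniq, a, ha, hac, hd⟩⟩
  have hedge : ∀ w, G.Adj w a → B = {w, a} → ∀ g, IsGate G {w, a} g →
      LeafStep G B (Finset.univ.filter (IsChosen G idx B)) := by
    rintro w hwa rfl g hg
    have hwc : ¬ IsCutVertex G w := fun h => hwa.ne (hu w (by simp) h)
    have : Finset.univ.filter (IsChosen G idx {w, a}) = {w} := by
      ext v
      simp only [Finset.mem_filter, Finset.mem_univ, true_and, hch, Finset.mem_insert,
        Finset.mem_singleton, Finset.card_pair hwa.ne]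
      constructor
      · rintro ⟨rfl | rfl, h⟩
        · rfl
        · simp at h
      · rintro rfl
        exact ⟨Or.inl rfl, by rw [SimpleGraph.dist_eq_one_iff_adj.2 hwa.symm]⟩
    rw [this]
    exact LeafStep.edge w a hwa (isSimplicial_of_isGate_edge hG hwa hg hwc)
  rcases hb.cases hG with hC | ⟨u, v, g, huv, he, hg⟩
  · obtain ⟨f, g, h⟩ := hC.exists_isGatedCycle hG
    obtain ⟨f, h, rfl⟩ := h.exists_base ha
    have hl := h.three_le
    have hch' : ∀ i : ℕ, i < B.card → (IsChosen G idx B (f i) ↔ min i (B.card - i) = B.card / 2) := by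
      intro i hi
      rw [hch, h.dist_zero hG.1 hi.le]
      exact and_iff_right (h.mem _)
    rcases Nat.even_or_odd' B.card with ⟨m, hm | hm⟩
    · have : Finset.univ.filter (IsChosen G idx B) = {f m} := by
        ext v
        simp only [Finset.mem_filter, Finset.mem_univ, true_and, Finset.mem_singleton]
        constructor
        · intro hv
          obtain ⟨i, hi, rfl⟩ := h.exists_index hv.1
          rw [hch' i hi] at hv
          congr 2
          omega
        · rintro rfl
          rw [hch' m (by omega)]
          omega
      rw [this]
      refine LeafStep.evenCycle B (f 0) (f m) hC ⟨m, by omega⟩ (h.mem _) hac (h.mem _) ?_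
      rw [h.dist_zero hG.1 (by omega)]
      omega
    · have : Finset.univ.filter (IsChosen G idx B) = {f m, f ((m + 1 : ℕ) : ℤ)} := by
        ext v
        simp only [Finset.mem_filter, Finset.mem_univ, true_and, Finset.mem_insert,
          Finset.mem_singleton]
        constructor
        · intro hv
          obtain ⟨i, hi, rfl⟩ := h.exists_index hv.1
          rw [hch' i hi] at hv
          have : i = m ∨ i = m + 1 := by omega
          rcases this with rfl | rfl
          · exact Or.inl rfl
          · exact Or.inr rfl
        · rintro (rfl | rfl)
          · rw [hch' m (by omega)]; omega
          · rw [hch' (m + 1) (by omega)]; omega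
      rw [this]
      refine LeafStep.oddCycle B (f 0) (f m) (f ((m + 1 : ℕ) : ℤ)) hC ⟨m, by omega⟩ (h.mem _) hac
        (h.mem _) (h.mem _) (fun he => ?_) ?_ ?_
      · have := h.eq_of_lt he (by omega) (by omega)
        omega
      · rw [h.dist_zero hG.1 (by omega)]; omega
      · rw [h.dist_zero hG.1 (by omega)]; omega
  · have ha' := ha
    rw [he, Finset.mem_insert, Finset.mem_singleton] at ha'
    rcases ha' with rfl | rfl
    · exact hedge v huv.symm (he.trans (Finset.pair_comm _ _)) g (Finset.pair_comm a v ▸ hg)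
    · exact hedge u huv he g hg

open Classical in
theorem internalStep_isChosen (hG : IsCactus G) (hidx : Function.Injective idx)
    (hcut : ∃ a, IsCutVertex G a) {B : Finset V} (hB : IsInternalBlock G B) :
    InternalStep G B (Finset.univ.filter (IsChosen G idx B)) := by
  obtain ⟨hb, hnl⟩ := isInternalBlock_iff.1 hB
  have : Nontrivial V := by
    obtain ⟨a, ha⟩ := hcut
    exact nontrivial_of_isCutVertex hG.1 ha
  have huniq : ¬ HasUniqueCutVertex G B := fun h => hnl (isLeafBlock_iff.2 ⟨hb, h⟩)
  obtain ⟨a, ha, hac⟩ := hb.exists_isCutVertex hG hcut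
  obtain ⟨b, hb', hbc, hba⟩ : ∃ b ∈ B, IsCutVertex G b ∧ b ≠ a := by
    by_contra! hcon
    exact huniq ⟨a, ha, hac, fun b hb hbc => hcon b hb hbc⟩
  have hempty : (Even B.card ∧ HasAntipodalCutVertices G B) ∨ CoveredByIntervals G B →
      Finset.univ.filter (IsChosen G idx B) = ∅ := by
    intro h
    rw [Finset.filter_eq_empty_iff]
    rintro v - ⟨-, ⟨h1, -⟩ | ⟨-, h1, h2, -⟩⟩
    · exact huniq h1
    · exact h.elim h1 h2
  rcases hb.cases hG with hC | ⟨u, v, g, huv, rfl, hg⟩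
  · obtain ⟨f, g, h⟩ := hC.exists_isGatedCycle hG
    have hcoviff := h.coveredByCutVertices_iff hG.1
    by_cases hcov : CoveredByIntervals G B
    · rw [hempty (Or.inr hcov)]
      rcases Nat.even_or_odd B.card with heven | hodd
      · by_cases hanti : HasAntipodalCutVertices G B
        · exact .evenAntipodal B hC heven hanti
        · exact .evenCovered B hC heven hanti (hcoviff.2 hcov)
      · exact .oddCovered B hC hodd (hcoviff.2 hcov)
    by_cases hanti : Even B.card ∧ HasAntipodalCutVertices G B
    · rw [hempty (Or.inl hanti)]
      exact .evenAntipodal B hC hanti.1 hanti.2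
    obtain ⟨v, hv, hmin⟩ : ∃ v, IsArcMiddle G B v ∧ ∀ v', idx v' < idx v → ¬ IsArcMiddle G B v' := by
      obtain ⟨v, hv, hmin⟩ := Finset.exists_min_image (Finset.univ.filter (IsArcMiddle G B)) idx
        (by
          obtain ⟨v, hv⟩ := exists_isArcMiddle hG hC ha hb' hac hbc hba.symm
          exact ⟨v, by simpa using hv⟩)
      refine ⟨v, by simpa using hv, fun v' hlt hv' => ?_⟩
      exact absurd (hmin v' (by simpa using hv')) (not_le.2 hlt)
    have hset : Finset.univ.filter (IsChosen G idx B) = {v} := by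
      ext w
      simp only [Finset.mem_filter, Finset.mem_univ, true_and, Finset.mem_singleton]
      constructor
      · rintro ⟨-, ⟨h1, -⟩ | ⟨-, -, -, hw, hw'⟩⟩
        · exact absurd h1 huniq
        · rcases lt_trichotomy (idx v) (idx w) with h1 | h1 | h1
          · exact absurd hv (hw' v h1)
          · exact (hidx h1).symm
          · exact absurd hw (hmin w h1)
      · rintro rfl
        exact ⟨hv.1, Or.inr ⟨huniq, hanti, hcov, hv, hmin⟩⟩
    rw [hset]
    have hmid := hv.isMiddleVertex hG hC hanti
    rcases Nat.even_or_odd B.card with heven | hodd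
    · exact .evenUncovered B v hC heven (fun h => hanti ⟨heven, h⟩) (fun h => hcov (hcoviff.1 h)) hmid
    · exact .oddUncovered B v hC hodd (fun h => hcov (hcoviff.1 h)) hmid
  -- Both ends of an internal edge are cut-vertices, so trivial intervals cover it and nothing is
  -- chosen.
  · rw [hempty]
    · exact .edge u v huv
    · right
      intro w hw
      refine ⟨w, hw, w, hw, ?_⟩
      have : IsCutVertex G w := by
        simp only [Finset.mem_insert, Finset.mem_singleton] at ha hb' hw
        rcases ha with rfl | rfl <;> rcases hb' with rfl | rfl <;> rcases hw with rfl | rfl <;>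
          first | assumption | exact absurd rfl hba
      exact ⟨this, this, by simp⟩

theorem finalStep_resultSet (hG : IsCactus G) (hidx : Function.Injective idx) :
    FinalStep G (baseSet G idx) (resultSet G idx) := by
  by_cases h3 : (baseSet G idx).card < 3
  · by_cases he : HasEvenCycleBlock G
    -- A cycle has at least three vertices, so some vertex is still available.
    · obtain ⟨C, -, hC, -⟩ := id he
      obtain ⟨w, hw, hmin⟩ := Finset.exists_min_image (Finset.univ \ baseSet G idx) idx (by
        have h1 := hC.three_le_card hG
        obtain ⟨w, -, hw⟩ := Finset.exists_mem_notMem_of_card_lt_card (lt_of_lt_of_le h3 h1)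
        exact ⟨w, by simpa using hw⟩)
      have hw' : w ∉ baseSet G idx := by simpa using hw
      have hset : resultSet G idx = insert w (baseSet G idx) := by
        ext v
        rw [mem_resultSet, Finset.mem_insert]
        constructor
        · rintro (h | ⟨-, -, hv, hv'⟩)
          · exact Or.inr h
          · left
            rcases lt_trichotomy (idx v) (idx w) with h1 | h1 | h1
            · exact absurd (hmin v (by simpa using hv)) (not_le.2 h1)
            · exact hidx h1
            · exact absurd (hv' w h1) hw'
        · rintro (rfl | h)
          · refine Or.inr ⟨h3, he, hw', fun v' hv' => ?_⟩
            by_contra hcon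
            exact absurd (hmin v' (by simpa using hcon)) (not_le.2 hv')
          · exact Or.inl h
      rw [hset]
      exact .evenBlock _ w h3 he hw'
    · have hset : resultSet G idx = baseSet G idx := by
        ext v
        rw [mem_resultSet]
        exact ⟨fun h => h.elim id fun h' => absurd h'.2.1 he, Or.inl⟩
      rw [hset]
      exact .noEvenBlock _ h3 he
  · have hset : resultSet G idx = baseSet G idx := by
      ext v
      rw [mem_resultSet]
      exact ⟨fun h => h.elim id fun h' => absurd h'.1 h3, Or.inl⟩
    rw [hset]
    exact .large _ (by omega)

theorem isAlgorithmOutput_resultSet (hG : IsCactus G) (hidx : Function.Injective idx)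
    (hcut : ∃ a, IsCutVertex G a) : IsAlgorithmOutput G (resultSet G idx) := by
  classical
  let L : Finset (Finset V) := Finset.univ.filter (IsLeafBlock G)
  let I : Finset (Finset V) := Finset.univ.filter (IsInternalBlock G)
  let X : Finset V → Finset V := fun B => Finset.univ.filter (IsChosen G idx B)
  have hL : ∀ B, B ∈ L.toList ↔ IsLeafBlock G B := fun B => by simp [L]
  have hI : ∀ B, B ∈ I.toList ↔ IsInternalBlock G B := fun B => by simp [I]
  refine ⟨L.toList, I.toList, _, baseSet G idx, L.nodup_toList, hL, I.nodup_toList, hI,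
    Pass.of_forall (X := X) (fun B hB => leafStep_isChosen hG ((hL B).1 hB)) ∅, ?_,
    finalStep_resultSet hG hidx⟩
  have := Pass.of_forall (X := X)
    (fun B hB => internalStep_isChosen hG hidx hcut ((hI B).1 hB)) (∅ ∪ L.toList.toFinset.biUnion X)
  convert this using 1
  ext v
  rw [baseSet, if_pos hcut, mem_blockSet]
  simp only [Finset.toList_toFinset, Finset.empty_union, Finset.mem_union, Finset.mem_biUnion, L, I,
    X, Finset.mem_filter, Finset.mem_univ, true_and]
  constructor
  · rintro ⟨B, hB, hv⟩
    by_cases hl : IsLeafBlock G B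
    · exact Or.inl ⟨B, hl, hv⟩
    · exact Or.inr ⟨B, isInternalBlock_iff.2 ⟨hB, hl⟩, hv⟩
  · rintro (⟨B, hB, hv⟩ | ⟨B, hB, hv⟩)
    · exact ⟨B, (isLeafBlock_iff.1 hB).1, hv⟩
    · exact ⟨B, (isInternalBlock_iff.1 hB).1, hv⟩

/-- In an even cycle an antipodal pair is completed by any third vertex; in an odd cycle the base
vertex and its two farthest vertices are pairwise less than half the length apart. Three are
necessary in any cycle. -/
theorem isMinimumStrongGeodeticSet_of_single_cycle (hG : IsCactus G)
    (hidx : Function.Injective idx) {a : V} (ha : idx a = 0) (hno : ¬ ∃ a, IsCutVertex G a)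
    (hC : IsCycleOn G (Finset.univ : Finset V)) :
    IsMinimumStrongGeodeticSet G (resultSet G idx) := by
  have hfin := finalStep_resultSet hG hidx
  have hbase : ∀ v, v ∈ baseSet G idx ↔ v = a ∨ G.dist a v = Fintype.card V / 2 := by
    intro v
    rw [baseSet, if_neg hno, mem_singleBlockSet]
    have h1 : ∀ b, idx b = 0 ↔ b = a := fun b =>
      ⟨fun h => hidx (h.trans ha.symm), fun h => h ▸ ha⟩
    simp [h1]
  have hsub : baseSet G idx ⊆ resultSet G idx := fun v hv => mem_resultSet.2 (Or.inl hv)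
  obtain ⟨f, g, h⟩ := hC.exists_isGatedCycle hG
  obtain ⟨f, h, rfl⟩ := h.exists_base (Finset.mem_univ a)
  rw [Finset.card_univ] at h
  have hl := h.three_le
  have : Nontrivial V := ⟨f 0, f 1, (h.adj 0).ne⟩
  have hbase' : ∀ i : ℕ, i < Fintype.card V → (f i ∈ baseSet G idx ↔
      i = 0 ∨ min i (Fintype.card V - i) = Fintype.card V / 2) := by
    intro i hi
    rw [hbase, h.dist_zero hG.1 hi.le]
    refine or_congr ⟨fun he => ?_, fun he => by rw [he]; rfl⟩ Iff.rfl
    have := h.eq_of_lt he (by omega) (by omega)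
    omega
  have hunique : ∀ C, IsCycleOn G C → C = Finset.univ := fun C hC' =>
    eq_univ_of_no_isCutVertex hG (fun v hv => hno ⟨v, hv⟩) (hC'.isBlock hG)
  have key : (resultSet G idx).card ≤ 3 ∧ LocallyCovered G (resultSet G idx) Finset.univ := by
    rcases Nat.even_or_odd' (Fintype.card V) with ⟨m, hm | hm⟩
    · have hset : baseSet G idx = {f 0, f m} := by
        ext v
        obtain ⟨i, hi, rfl⟩ := h.exists_index (Finset.mem_univ v)
        rw [hbase' i hi, Finset.mem_insert, Finset.mem_singleton]
        refine or_congr ⟨fun he => by rw [he]; rfl, fun he => ?_⟩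
          ⟨fun he => by congr 2; omega, fun he => ?_⟩
        · have := h.eq_of_lt he (by omega) (by omega)
          omega
        · have := h.eq_of_lt he (by omega) (by omega)
          omega
      have hcard : (baseSet G idx).card = 2 := by
        rw [hset]
        refine Finset.card_pair fun he => ?_
        have := h.eq_of_lt he (by omega) (by omega)
        omega
      have heven : HasEvenCycleBlock G :=
        ⟨Finset.univ, hC.isBlock hG, hC, ⟨m, by rw [Finset.card_univ]; omega⟩⟩
      have h3 : (resultSet G idx).card = 3 := by
        generalize resultSet G idx = R at hfin
        cases hfin with
        | large h => omega
        | evenBlock w _ _ hw => rw [Finset.card_insert_of_notMem hw, hcard]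
        | noEvenBlock _ h => exact absurd heven h
      refine ⟨h3.le, h.locallyCovered_of_antipodal hG.1 h3.ge (x := f 0) (y := f m)
        (hsub (by rw [hset]; simp)) (hsub (by rw [hset]; simp)) ?_⟩
      rw [h.gate.fix _ (h.mem _), h.gate.fix _ (h.mem _), h.dist_zero hG.1 (by omega)]
      omega
    · have hset : baseSet G idx = {f 0, f m, f ((m + 1 : ℕ) : ℤ)} := by
        ext v
        obtain ⟨i, hi, rfl⟩ := h.exists_index (Finset.mem_univ v)
        rw [hbase' i hi, Finset.mem_insert, Finset.mem_insert, Finset.mem_singleton]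
        refine or_congr ⟨fun he => by rw [he]; rfl, fun he => ?_⟩ ⟨fun he => ?_, fun he => ?_⟩
        · have := h.eq_of_lt he (by omega) (by omega)
          omega
        · have : i = m ∨ i = m + 1 := by omega
          rcases this with rfl | rfl
          · exact Or.inl rfl
          · exact Or.inr rfl
        · rcases he with he | he
          · have := h.eq_of_lt he (by omega) (by omega)
            omega
          · have := h.eq_of_lt he (by omega) (by omega)
            omega
      have hcard : (baseSet G idx).card ≤ 3 := by
        rw [hset]
        exact Finset.card_le_three
      have hno' : ¬ HasEvenCycleBlock G := by
        rintro ⟨C, -, hC', heven⟩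
        rw [hunique C hC', Finset.card_univ, hm] at heven
        exact absurd heven (by simp)
      have h3 : resultSet G idx = baseSet G idx := by
        generalize resultSet G idx = R at hfin
        cases hfin with
        | large h => rfl
        | evenBlock w _ he hw => exact absurd he hno'
        | noEvenBlock _ h => rfl
      rw [h3]
      refine ⟨hcard, h.locallyCovered_of_dist_lt hG.1 fun w hw _ _ => ?_⟩
      obtain ⟨i, hi, rfl⟩ := h.exists_index hw
      refine ⟨f 0, by rw [hset]; simp, ?_⟩
      rw [h.gate.fix _ (h.mem _)]
      by_cases him : i ≤ m
      · refine ⟨f m, by rw [hset]; simp, ?_⟩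
        rw [h.gate.fix _ (h.mem _), h.dist_zero hG.1 hi.le, h.dist_zero hG.1 (by omega),
          h.dist_eq hG.1 him (by omega)]
        refine ⟨fun he => ?_, by omega, by omega⟩
        have := h.eq_of_lt he (by omega) (by omega)
        omega
      · refine ⟨f ((m + 1 : ℕ) : ℤ), by rw [hset]; simp, ?_⟩
        rw [h.gate.fix _ (h.mem _), G.dist_comm (u := f i), h.dist_zero hG.1 hi.le,
          h.dist_zero hG.1 (by omega), h.dist_eq hG.1 (by omega : m + 1 ≤ i) (by omega)]
        refine ⟨fun he => ?_, by omega, by omega⟩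
        have := h.eq_of_lt he (by omega) (by omega)
        omega
  refine ⟨isStrongGeodeticSet_of_locallyCovered hG (fun w hw => absurd ⟨w, hw⟩ hno)
    (fun w _ _ => ⟨_, hC, Finset.mem_univ w⟩) fun C hC' => by rw [hunique C hC']; exact key.2, ?_⟩
  intro S' hS'
  exact key.1.trans (hS'.three_le_card hG hC)

/-- Without cut-vertices one block is everything, so the graph is a vertex, an edge or a cycle. In
the first two cases the base vertex and the vertices at distance `Fintype.card V / 2` from it are
all of `V`, and none can be spared; the ends of the edge are simplicial. -/
theorem isMinimumStrongGeodeticSet_resultSet (hG : IsCactus G) (hidx : Function.Injective idx)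
    (h0 : ∃ a, idx a = 0) : IsMinimumStrongGeodeticSet G (resultSet G idx) := by
  by_cases hcut : ∃ a, IsCutVertex G a
  · exact isMinimumStrongGeodeticSet_of_isAlgorithmOutput hG hcut
      (isAlgorithmOutput_resultSet hG hidx hcut)
  obtain ⟨a, ha⟩ := h0
  have hbase : ∀ v, v = a ∨ G.dist a v = Fintype.card V / 2 → v ∈ resultSet G idx := by
    intro v hv
    refine mem_resultSet.2 (Or.inl ?_)
    rw [baseSet, if_neg hcut, mem_singleBlockSet]
    rcases hv with rfl | hv
    · exact Or.inl ha
    · exact Or.inr ⟨a, ha, hv⟩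
  rcases subsingleton_or_nontrivial V with hV | hV
  · have huniv : resultSet G idx = Finset.univ := by
      ext v
      simp [hbase v (Or.inl (Subsingleton.elim _ _))]
    rw [huniv]
    refine ⟨isStrongGeodeticSet_univ hG.1, fun S' hS' => Finset.card_le_card fun v _ => ?_⟩
    by_contra hv
    obtain ⟨x, hx, -⟩ := hS'.exists_dist_add hG.1 hv
    exact hv (Subsingleton.elim x v ▸ hx)
  · obtain ⟨b, hab⟩ := exists_adj hG.1 a
    obtain ⟨B, g, hB, hg, haB, hbB, hBc⟩ := exists_isBlock_of_adj hG hab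
    obtain rfl := eq_univ_of_no_isCutVertex hG (fun v hv => hcut ⟨v, hv⟩) hB
    rcases hBc with hC | hBc
    · exact isMinimumStrongGeodeticSet_of_single_cycle hG hidx ha hcut hC
    · have hmem : ∀ v, v = a ∨ v = b := fun v => by
        have := Finset.mem_univ v
        rwa [hBc, Finset.mem_insert, Finset.mem_singleton] at this
      have hcard : Fintype.card V = 2 := by
        rw [← Finset.card_univ, hBc, Finset.card_pair hab.ne]
      have huniv : resultSet G idx = Finset.univ := by
        ext v
        simp only [Finset.mem_univ, iff_true]
        refine hbase v ((hmem v).imp id ?_)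
        rintro rfl
        rw [hcard, SimpleGraph.dist_eq_one_iff_adj.2 hab]
      rw [huniv]
      refine ⟨isStrongGeodeticSet_univ hG.1, fun S' hS' => Finset.card_le_card fun v _ => ?_⟩
      by_contra hv
      obtain ⟨x, hx, y, hy, hd⟩ := hS'.exists_dist_add hG.1 hv
      have hsimp : IsSimplicial G v := by
        intro s hs t ht hst
        have h1 := SimpleGraph.Adj.ne (show G.Adj v s from hs)
        have h2 := SimpleGraph.Adj.ne (show G.Adj v t from ht)
        exfalso
        rcases hmem v with rfl | rfl <;> rcases hmem s with rfl | rfl <;>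
          rcases hmem t with rfl | rfl <;> simp_all
      exact hsimp.dist_add_ne hG.1 (fun h => hv (h ▸ hx)) (fun h => hv (h ▸ hy)) hd

end Deterministic

/-! ### A term language compiled to programs with polynomial time bounds -/

section Compiler

/-- A total expression language compiled to programs. `lev x` is the loop variable bound at level
`x` (level `0` holds the size `n`), `inp` reads the input array, `loc a` reads the local array bound
at level `a` (with value `0` at indices from `n` on), `sum` sums over a new loop variable below `n`,
and `iter src step i` is the entry `i` of the array obtained by `n` synchronous updates `step` from
the array with the entry `1` at `src` and `0` elsewhere. -/
inductive Term
  | const (c : ℕ)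
  | lev (x : ℕ)
  | inp (i : Term)
  | loc (a : ℕ) (i : Term)
  | add (S T : Term)
  | sub (S T : Term)
  | sum (T : Term)
  | iter (src step i : Term)

/-- The value of a term with `d` levels of loop variables with values `e` and `m` levels of local
arrays with contents `L`. -/
def Term.eval (I : ℕ → ℕ) : Term → (d m : ℕ) → (e : ℕ → ℕ) → (L : ℕ → ℕ → ℕ) → ℕ
  | .const c, _, _, _, _ => c
  | .lev x, d, _, e, _ => if x < d then e x else 0
  | .inp i, d, m, e, L => I (i.eval I d m e L)
  | .loc a i, d, m, e, L => if a < m ∧ i.eval I d m e L < e 0 then L a (i.eval I d m e L) else 0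
  | .add S T, d, m, e, L => S.eval I d m e L + T.eval I d m e L
  | .sub S T, d, m, e, L => S.eval I d m e L - T.eval I d m e L
  | .sum T, d, m, e, L =>
      ∑ i ∈ Finset.range (e 0), T.eval I (d + 1) m (Function.update e d i) L
  | .iter src step i, d, m, e, L =>
      if i.eval I d m e L < e 0 then
        Nat.rec (motive := fun _ => ℕ → ℕ)
          (fun x => if x = src.eval I d m e L then 1 else 0)
          (fun _ h x => step.eval I (d + 1) (m + 1) (Function.update e d x) (Function.update L m h))
          (e 0) (i.eval I d m e L)
      else 0

/-- Run `p` for all values of the variable `x` below the value of the variable `0`. -/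
def Program.forLoop (x : ℕ) (p : Program) : Program :=
  .seq (.assign x (.const 0))
    (.loop (.sub (.var 0) (.var x)) (.seq p (.assign x (.add (.var x) (.const 1)))))

/-- Read the entry of the array `a` at the value of the variable `x` into `x`, or `0` if that value
is not below the value of the variable `0`. -/
def Program.guardedGet (a x : ℕ) : Program :=
  .ite (.sub (.var 0) (.var x)) (.assign x (.get a (.var x))) (.assign x (.const 0))

/-- Compilation: the level `x` is kept in the variable `2 * x`, the local array `a` in the
array `2 * a + 2`, and the result is put into the variable `2 * k + 1`. -/
def Term.compile : Term → (d m k : ℕ) → Program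
  | .const c, _, _, k => .assign (2 * k + 1) (.const c)
  | .lev x, d, _, k => .assign (2 * k + 1) (if x < d then .var (2 * x) else .const 0)
  | .inp i, d, m, k =>
      .seq (i.compile d m k) (.assign (2 * k + 1) (.get 0 (.var (2 * k + 1))))
  | .loc a i, d, m, k =>
      .seq (i.compile d m k)
        (if a < m then .guardedGet (2 * a + 2) (2 * k + 1) else .assign (2 * k + 1) (.const 0))
  | .add S T, d, m, k =>
      .seq (S.compile d m k) (.seq (T.compile d m (k + 1))
        (.assign (2 * k + 1) (.add (.var (2 * k + 1)) (.var (2 * (k + 1) + 1)))))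
  | .sub S T, d, m, k =>
      .seq (S.compile d m k) (.seq (T.compile d m (k + 1))
        (.assign (2 * k + 1) (.sub (.var (2 * k + 1)) (.var (2 * (k + 1) + 1)))))
  | .sum T, d, m, k =>
      .seq (.assign (2 * k + 1) (.const 0))
        (.forLoop (2 * d) (.seq (T.compile (d + 1) m (k + 1))
          (.assign (2 * k + 1) (.add (.var (2 * k + 1)) (.var (2 * (k + 1) + 1))))))
  | .iter src step i, d, m, k =>
      .seq (i.compile d m k) <| .seq (src.compile d m (k + 1)) <|
      .seq (.forLoop (2 * d) (.seq .skip (.store (2 * m + 2) (.var (2 * d)) (.sub (.const 1)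
        (.add (.sub (.var (2 * d)) (.var (2 * (k + 1) + 1)))
          (.sub (.var (2 * (k + 1) + 1)) (.var (2 * d)))))))) <|
      .seq (.forLoop (2 * (k + 1) + 1) (.seq
          (.forLoop (2 * d) (.seq (step.compile (d + 1) (m + 1) (k + 2))
            (.store (2 * m + 3) (.var (2 * d)) (.var (2 * (k + 2) + 1)))))
          (.forLoop (2 * d) (.seq .skip
            (.store (2 * m + 2) (.var (2 * d)) (.get (2 * m + 3) (.var (2 * d)))))))) <|
      .guardedGet (2 * m + 2) (2 * k + 1)

/-- A bound for the running time of a compiled term. -/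
noncomputable def Term.time : Term → Polynomial ℕ
  | .const _ => 2
  | .lev _ => 2
  | .inp i => i.time + 3
  | .loc _ i => i.time + 7
  | .add S T => S.time + T.time + 4
  | .sub S T => S.time + T.time + 4
  | .sum T => Polynomial.X * (T.time + 12) + 8
  | .iter src step i =>
      i.time + src.time + (Polynomial.X * 20 + 6) +
        (Polynomial.X * ((Polynomial.X * (step.time + 11) + 6) + (Polynomial.X * 13 + 6) + 8) + 6) + 7

/-- The store `s'` agrees with `s` on the first `d` levels, the first `k` temporary variables, the
input, the output and the first `m` local arrays. -/
structure Frame (d m k : ℕ) (s s' : Store) : Prop where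
  lev : ∀ x < d, s'.var (2 * x) = s.var (2 * x)
  tmp : ∀ j < k, s'.var (2 * j + 1) = s.var (2 * j + 1)
  arr : ∀ a < 2 * m + 2, s'.arr a = s.arr a

namespace Frame

variable {d m k : ℕ} {s s' s'' : Store}

theorem refl (d m k : ℕ) (s : Store) : Frame d m k s s :=
  ⟨fun _ _ => rfl, fun _ _ => rfl, fun _ _ => rfl⟩

theorem trans (h : Frame d m k s s') (h' : Frame d m k s' s'') : Frame d m k s s'' :=
  ⟨fun x hx => (h'.lev x hx).trans (h.lev x hx), fun x hx => (h'.tmp x hx).trans (h.tmp x hx),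
    fun x hx => (h'.arr x hx).trans (h.arr x hx)⟩

theorem mono {d' m' k' : ℕ} (h : Frame d' m' k' s s') (hd : d ≤ d') (hm : m ≤ m') (hk : k ≤ k') :
    Frame d m k s s' :=
  ⟨fun x hx => h.lev x (by omega), fun x hx => h.tmp x (by omega), fun x hx => h.arr x (by omega)⟩

theorem setTmp (d m k : ℕ) (s : Store) {j : ℕ} (hj : k ≤ j) (v : ℕ) :
    Frame d m k s ⟨Function.update s.var (2 * j + 1) v, s.arr⟩ :=
  ⟨fun x _ => Function.update_of_ne (by omega) _ _, fun x hx => Function.update_of_ne (by omega) _ _,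
    fun _ _ => rfl⟩

theorem setLev (d m k : ℕ) (s : Store) {j : ℕ} (hj : d ≤ j) (v : ℕ) :
    Frame d m k s ⟨Function.update s.var (2 * j) v, s.arr⟩ :=
  ⟨fun x hx => Function.update_of_ne (by omega) _ _, fun x _ => Function.update_of_ne (by omega) _ _,
    fun _ _ => rfl⟩

theorem setArr (d m k : ℕ) (s : Store) {a : ℕ} (ha : 2 * m + 2 ≤ a) (f : ℕ → ℕ) :
    Frame d m k s ⟨s.var, Function.update s.arr a f⟩ :=
  ⟨fun _ _ => rfl, fun _ _ => rfl, fun x hx => Function.update_of_ne (by omega) _ _⟩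

end Frame

/-- The store `s` holds the input `I`, the loop variables `e` and the local arrays `L`. -/
structure Represents (I : ℕ → ℕ) (d m : ℕ) (e : ℕ → ℕ) (L : ℕ → ℕ → ℕ) (s : Store) : Prop where
  inp : s.arr 0 = I
  lev : ∀ x < d, s.var (2 * x) = e x
  loc : ∀ a < m, ∀ i < e 0, s.arr (2 * a + 2) i = L a i

theorem Represents.frame {I : ℕ → ℕ} {d m k : ℕ} {e : ℕ → ℕ} {L : ℕ → ℕ → ℕ} {s s' : Store}
    (h : Represents I d m e L s) (h' : Frame d m k s s') : Represents I d m e L s' :=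
  ⟨(h'.arr 0 (by omega)).trans h.inp, fun x hx => (h'.lev x hx).trans (h.lev x hx),
    fun a ha i hi => by rw [h'.arr _ (by omega)]; exact h.loc a ha i hi⟩

theorem Represents.succ {I : ℕ → ℕ} {d m : ℕ} {e : ℕ → ℕ} {L : ℕ → ℕ → ℕ} {s : Store}
    (h : Represents I d m e L s) (hd : 0 < d) {i : ℕ} (hi : s.var (2 * d) = i) :
    Represents I (d + 1) m (Function.update e d i) L s := by
  refine ⟨h.inp, fun x hx => ?_, fun a ha j hj => ?_⟩
  · rcases Nat.lt_succ_iff_lt_or_eq.1 hx with hx | rfl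
    · rw [Function.update_of_ne (by omega)]; exact h.lev x hx
    · rw [Function.update_self, hi]
  · rw [Function.update_of_ne (by omega)] at hj
    exact h.loc a ha j hj

theorem Represents.succLoc {I : ℕ → ℕ} {d m : ℕ} {e : ℕ → ℕ} {L : ℕ → ℕ → ℕ} {s : Store}
    (h : Represents I d m e L s) {f : ℕ → ℕ} (hf : ∀ i < e 0, s.arr (2 * m + 2) i = f i) :
    Represents I d (m + 1) e (Function.update L m f) s := by
  refine ⟨h.inp, h.lev, fun a ha j hj => ?_⟩
  rcases Nat.lt_succ_iff_lt_or_eq.1 ha with ha | rfl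
  · rw [Function.update_of_ne (by omega)]; exact h.loc a ha j hj
  · rw [Function.update_self, hf j hj]

/-- The invariant has to be insensitive to the loop variable, which is reset and incremented. A
round costs `4` for the test, at most `c` for the body and `4` for the increment; initialisation and
the failing test cost `6`. -/
theorem exec_forLoop {x n c : ℕ} {p : Program} (hx : x ≠ 0) (Inv : ℕ → Store → Prop)
    (hp : ∀ i s, i < n → s.var 0 = n → s.var x = i → Inv i s →
      ∃ s' t, Exec p s s' t ∧ t ≤ c ∧ s'.var 0 = n ∧ s'.var x = i ∧ Inv (i + 1) s')
    (hInv : ∀ i s v, Inv i s → Inv i ⟨Function.update s.var x v, s.arr⟩)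
    {s : Store} (hn : s.var 0 = n) (h0 : Inv 0 s) :
    ∃ s' t, Exec (.forLoop x p) s s' t ∧ t ≤ n * (c + 8) + 6 ∧ s'.var 0 = n ∧ Inv n s' := by
  have key : ∀ j i s, i + j = n → s.var 0 = n → s.var x = i → Inv i s →
      ∃ s' t, Exec (.loop (.sub (.var 0) (.var x))
        (.seq p (.assign x (.add (.var x) (.const 1))))) s s' t ∧ t ≤ j * (c + 8) + 4 ∧
        s'.var 0 = n ∧ Inv n s' := by
    intro j
    induction j with
    | zero =>
      intro i s hi h0 hx hI
      refine ⟨s, _, .loopDone (by simp only [Expr.eval]; omega), by simp [Expr.cost], h0, ?_⟩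
      rw [← hi]; exact hI
    | succ j ih =>
      intro i s hi h0 hxi hI
      obtain ⟨s₁, t₁, h1, ht1, h10, h1x, hI1⟩ := hp i s (by omega) h0 hxi hI
      obtain ⟨s₂, t₂, h2, ht2, h20, hI2⟩ := ih (i + 1)
        ⟨Function.update s₁.var x (i + 1), s₁.arr⟩ (by omega)
        (by simp only; rw [Function.update_of_ne hx.symm]; exact h10)
        (by simp) (hInv _ _ _ hI1)
      rw [← h1x] at h2
      refine ⟨s₂, _, .loopStep (by simp only [Expr.eval]; omega) (.seq h1 (.assign _ _ _)) h2, ?_,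
        h20, hI2⟩
      simp only [Expr.cost]
      have : (j + 1) * (c + 8) = j * (c + 8) + (c + 8) := by ring
      omega
  obtain ⟨s', t, h, ht, h0', hI⟩ := key n 0 ⟨Function.update s.var x 0, s.arr⟩ (by omega)
    (by simp only; rw [Function.update_of_ne hx.symm]; exact hn) (by simp) (hInv _ _ _ h0)
  exact ⟨s', _, .seq (.assign _ _ _) h, by simp only [Expr.cost]; omega, h0', hI⟩

theorem exec_guardedGet {a x : ℕ} (s : Store) :
    ∃ t, Exec (.guardedGet a x) s
      ⟨Function.update s.var x (if s.var x < s.var 0 then s.arr a (s.var x) else 0), s.arr⟩ t ∧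
      t ≤ 7 := by
  by_cases h : s.var x < s.var 0
  · rw [if_pos h]
    exact ⟨_, .iteTrue (by simp only [Expr.eval]; omega) (.assign _ _ _), by simp [Expr.cost]⟩
  · rw [if_neg h]
    exact ⟨_, .iteFalse (by simp only [Expr.eval]; omega) (.assign _ _ _), by simp [Expr.cost]⟩

/-- Filling the array `a` by a loop over a program that computes the entries; the array `b` is not
changed. -/
theorem exec_fill {d m k k' a b c n : ℕ} {p : Program} {E : Expr} {F : ℕ → ℕ} {s : Store}
    (hd : 0 < d) (hk : k ≤ k') (ha : 2 * m + 2 ≤ a) (hba : b ≠ a) (hn : s.var 0 = n)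
    (hp : ∀ i s', i < n → Frame d m k s s' → s'.var (2 * d) = i → s'.arr b = s.arr b →
      ∃ s'' t, Exec p s' s'' t ∧ t ≤ c ∧ Frame (d + 1) m k' s' s'' ∧ E.eval s'' = F i ∧
        s''.arr a = s'.arr a ∧ s''.arr b = s'.arr b) :
    ∃ s' t, Exec (.forLoop (2 * d) (.seq p (.store a (.var (2 * d)) E))) s s' t ∧
      t ≤ n * (c + E.cost + 10) + 6 ∧ Frame d m k s s' ∧ (∀ i < n, s'.arr a i = F i) ∧
      s'.arr b = s.arr b := by
  obtain ⟨s', t, h, ht, -, ⟨h1, h2, h3⟩⟩ := exec_forLoop (x := 2 * d) (n := n) (c := c + E.cost + 2)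
    (p := .seq p (.store a (.var (2 * d)) E)) (by omega)
    (fun i s' => Frame d m k s s' ∧ (∀ j < i, s'.arr a j = F j) ∧ s'.arr b = s.arr b)
    (by
      rintro i s₁ hi h0 hxi ⟨hf, hF, hb⟩
      obtain ⟨s₂, t, h, ht, hf2, hv, harr, harrb⟩ := hp i s₁ hi hf hxi hb
      refine ⟨_, _, .seq h (.store _ _ _ _), by simp only [Expr.cost]; omega, ?_, ?_, ?_, ?_, ?_⟩
      · have := hf2.lev 0 (by omega)
        exact this.trans h0
      · exact (hf2.lev d (by omega)).trans hxi
      · exact (hf.trans (hf2.mono (by omega) le_rfl hk)).trans (Frame.setArr d m k s₂ ha _)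
      · intro j hj
        simp only [Function.update_self]
        rw [hv, Expr.eval, hf2.lev d (by omega), hxi]
        rcases Nat.lt_succ_iff_lt_or_eq.1 hj with hj | rfl
        · rw [Function.update_of_ne (by omega), harr]; exact hF j hj
        · rw [Function.update_self]
      · simp only
        rw [Function.update_of_ne hba, harrb, hb])
    (by
      rintro i s₁ v ⟨hf, hF, hb⟩
      exact ⟨hf.trans (Frame.setLev d m k s₁ le_rfl v), hF, hb⟩) hn
    ⟨Frame.refl _ _ _ _, fun j hj => absurd hj (by omega), rfl⟩
  exact ⟨s', t, h, ht, h1, h2, h3⟩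

/-- Correctness and running time of compiled terms. -/
theorem Term.exec_compile (I : ℕ → ℕ) (T : Term) : ∀ {d m k : ℕ} {e : ℕ → ℕ} {L : ℕ → ℕ → ℕ}
    {s : Store}, 0 < d → Represents I d m e L s →
    ∃ s' t, Exec (T.compile d m k) s s' t ∧ t ≤ T.time.eval (e 0) ∧ Frame d m k s s' ∧
      s'.var (2 * k + 1) = T.eval I d m e L := by
  induction T with
  | const c =>
    intro d m k e L s hd hs
    exact ⟨_, _, .assign _ _ _, by simp [Expr.cost, Term.time], Frame.setTmp _ _ _ _ le_rfl _,
      by simp [Expr.eval, Term.eval]⟩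
  | lev x =>
    intro d m k e L s hd hs
    refine ⟨_, _, .assign _ _ _, ?_, Frame.setTmp _ _ _ _ le_rfl _, ?_⟩
    · split_ifs <;> simp [Expr.cost, Term.time]
    · by_cases h : x < d
      · simp [Expr.eval, Term.eval, h, hs.lev x h]
      · simp [Expr.eval, Term.eval, h]
  | inp i ih =>
    intro d m k e L s hd hs
    obtain ⟨s₁, t₁, h1, ht1, hf1, hv1⟩ := ih (k := k) hd hs
    refine ⟨_, _, .seq h1 (.assign _ _ _), ?_, hf1.trans (Frame.setTmp _ _ _ _ le_rfl _), ?_⟩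
    · simp only [Expr.cost, Term.time, Polynomial.eval_add, Polynomial.eval_ofNat]
      omega
    · simp only [Function.update_self, Expr.eval, Term.eval]
      rw [(hs.frame hf1).inp, hv1]
  | loc a i ih =>
    intro d m k e L s hd hs
    obtain ⟨s₁, t₁, h1, ht1, hf1, hv1⟩ := ih (k := k) hd hs
    have hs1 := hs.frame hf1
    by_cases ha : a < m
    · obtain ⟨t₂, h2, ht2⟩ := exec_guardedGet (a := 2 * a + 2) (x := 2 * k + 1) s₁
      refine ⟨_, _, .seq h1 (by rw [if_pos ha]; exact h2), ?_,
        hf1.trans (Frame.setTmp _ _ _ _ le_rfl _), ?_⟩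
      · simp only [Term.time, Polynomial.eval_add, Polynomial.eval_ofNat]
        omega
      · have h0 : s₁.var 0 = e 0 := hs1.lev 0 hd
        simp only [Function.update_self, Term.eval, ha, true_and]
        rw [hv1, h0]
        split_ifs with h
        · exact hs1.loc a ha _ h
        · rfl
    · refine ⟨_, _, .seq h1 (by rw [if_neg ha]; exact .assign _ _ _), ?_,
        hf1.trans (Frame.setTmp _ _ _ _ le_rfl _), ?_⟩
      · simp only [Expr.cost, Term.time, Polynomial.eval_add, Polynomial.eval_ofNat]
        omega
      · simp [Expr.eval, Term.eval, ha]
  | add S T ihS ihT =>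
    intro d m k e L s hd hs
    obtain ⟨s₁, t₁, h1, ht1, hf1, hv1⟩ := ihS (k := k) hd hs
    obtain ⟨s₂, t₂, h2, ht2, hf2, hv2⟩ := ihT (k := k + 1) hd (hs.frame hf1)
    refine ⟨_, _, .seq h1 (.seq h2 (.assign _ _ _)), ?_,
      (hf1.trans (hf2.mono le_rfl le_rfl (by omega))).trans (Frame.setTmp _ _ _ _ le_rfl _), ?_⟩
    · simp only [Expr.cost, Term.time, Polynomial.eval_add, Polynomial.eval_ofNat]
      omega
    · simp only [Function.update_self, Expr.eval, Term.eval]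
      rw [hf2.tmp k (by omega), hv1, hv2]
  | sub S T ihS ihT =>
    intro d m k e L s hd hs
    obtain ⟨s₁, t₁, h1, ht1, hf1, hv1⟩ := ihS (k := k) hd hs
    obtain ⟨s₂, t₂, h2, ht2, hf2, hv2⟩ := ihT (k := k + 1) hd (hs.frame hf1)
    refine ⟨_, _, .seq h1 (.seq h2 (.assign _ _ _)), ?_,
      (hf1.trans (hf2.mono le_rfl le_rfl (by omega))).trans (Frame.setTmp _ _ _ _ le_rfl _), ?_⟩
    · simp only [Expr.cost, Term.time, Polynomial.eval_add, Polynomial.eval_ofNat]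
      omega
    · simp only [Function.update_self, Expr.eval, Term.eval]
      rw [hf2.tmp k (by omega), hv1, hv2]
  | sum T ih =>
    intro d m k e L s hd hs
    have hf0 : Frame d m k s ⟨Function.update s.var (2 * k + 1) 0, s.arr⟩ :=
      Frame.setTmp _ _ _ _ le_rfl _
    obtain ⟨s', t, h, ht, -, hf, hv⟩ := exec_forLoop (x := 2 * d) (n := e 0)
      (c := T.time.eval (e 0) + 4)
      (p := .seq (T.compile (d + 1) m (k + 1))
        (.assign (2 * k + 1) (.add (.var (2 * k + 1)) (.var (2 * (k + 1) + 1))))) (by omega)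
      (fun i s' => Frame d m k s s' ∧ s'.var (2 * k + 1) =
        ∑ j ∈ Finset.range i, T.eval I (d + 1) m (Function.update e d j) L)
      (by
        rintro i s₁ hi h0 hxi ⟨hf, hsum⟩
        obtain ⟨s₂, t, h, ht, hf2, hv⟩ := ih (k := k + 1) (Nat.succ_pos d)
          ((hs.frame hf).succ hd hxi)
        rw [Function.update_of_ne (by omega)] at ht
        refine ⟨_, _, .seq h (.assign _ _ _), by simp only [Expr.cost]; omega, ?_, ?_,
          (hf.trans (hf2.mono (by omega) le_rfl (by omega))).trans (Frame.setTmp _ _ _ _ le_rfl _),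
          ?_⟩
        · simp only
          rw [Function.update_of_ne (by omega)]
          exact (hf2.lev 0 (by omega)).trans h0
        · simp only
          rw [Function.update_of_ne (by omega)]
          exact (hf2.lev d (by omega)).trans hxi
        · simp only [Function.update_self, Expr.eval]
          rw [hf2.tmp k (by omega), hsum, hv, Finset.sum_range_succ])
      (by
        rintro i s₁ v ⟨hf, hsum⟩
        refine ⟨hf.trans (Frame.setLev d m k s₁ le_rfl v), ?_⟩
        simp only
        rw [Function.update_of_ne (by omega)]
        exact hsum) (s := ⟨Function.update s.var (2 * k + 1) 0, s.arr⟩)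
      ((hs.frame hf0).lev 0 hd) ⟨hf0, by simp⟩
    refine ⟨s', _, .seq (.assign _ _ _) h, ?_, hf, hv⟩
    simp only [Expr.cost, Term.time, Polynomial.eval_add, Polynomial.eval_mul, Polynomial.eval_X,
      Polynomial.eval_ofNat]
    have : T.time.eval (e 0) + 4 + 8 = T.time.eval (e 0) + 12 := rfl
    rw [this] at ht
    omega
  | iter src step i ihsrc ihstep ihi =>
    intro d m k e L s hd hs
    obtain ⟨s₁, t₁, h1, ht1, hf1, hv1⟩ := ihi (k := k) hd hs
    obtain ⟨s₂, t₂, h2, ht2, hf2, hv2⟩ := ihsrc (k := k + 1) hd (hs.frame hf1)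
    have hf12 := hf1.trans (hf2.mono le_rfl le_rfl (by omega))
    let F : ℕ → ℕ → ℕ := fun t => Nat.rec (motive := fun _ => ℕ → ℕ)
      (fun x => if x = src.eval I d m e L then 1 else 0)
      (fun _ h x => step.eval I (d + 1) (m + 1) (Function.update e d x) (Function.update L m h)) t
    -- With truncated subtraction, `1 - ((x - y) + (y - x))` is the indicator of `x = y`.
    obtain ⟨s₃, t₃, h3, ht3, hf3, hF3, -⟩ := exec_fill (d := d) (m := m) (k := k + 2) (k' := k + 2)
      (a := 2 * m + 2) (b := 2 * m + 3) (c := 1) (n := e 0) (p := .skip)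
      (E := .sub (.const 1) (.add (.sub (.var (2 * d)) (.var (2 * (k + 1) + 1)))
          (.sub (.var (2 * (k + 1) + 1)) (.var (2 * d))))) (F := F 0) (s := s₂) hd le_rfl le_rfl
      (by omega) ((hs.frame hf12).lev 0 hd)
      (by
        intro i s' hi hf hx _
        refine ⟨s', 1, .skip _, le_rfl, Frame.refl _ _ _ _, ?_, rfl, rfl⟩
        simp only [Expr.eval, hx, hf.tmp (k + 1) (by omega), hv2]
        change _ = if i = src.eval I d m e L then 1 else 0
        split_ifs <;> omega)
    -- The rounds are counted in temporary `k + 1`, where the source was held until the first fill;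
    -- so the invariant protects only the temporaries up to `k`.
    obtain ⟨s₄, t₄, h4, ht4, -, hf4, hF4⟩ := exec_forLoop (x := 2 * (k + 1) + 1) (n := e 0)
      (c := (e 0 * (step.time.eval (e 0) + 11) + 6) + (e 0 * 13 + 6))
      (p := .seq
          (.forLoop (2 * d) (.seq (step.compile (d + 1) (m + 1) (k + 2))
            (.store (2 * m + 3) (.var (2 * d)) (.var (2 * (k + 2) + 1)))))
          (.forLoop (2 * d) (.seq .skip
            (.store (2 * m + 2) (.var (2 * d)) (.get (2 * m + 3) (.var (2 * d)))))))
      (by omega)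
      (fun t s' => Frame d m (k + 1) s₃ s' ∧ ∀ x < e 0, s'.arr (2 * m + 2) x = F t x)
      (by
        rintro t s' ht h0 hxt ⟨hf, hF⟩
        have hs' := (hs.frame (hf12.trans (hf3.mono le_rfl le_rfl (by omega)))).frame hf
        -- Synchronous update: the new entries go to the array `2 * m + 3` while `2 * m + 2` keeps
        -- the old ones, and are copied back afterwards. Compiling `step` with `m + 1` local arrays
        -- keeps it from touching either.
        obtain ⟨s₅, t₅, h5, ht5, hf5, hF5, -⟩ := exec_fill (d := d) (m := m) (k := k + 2)
          (k' := k + 2) (a := 2 * m + 3) (b := 2 * m + 2) (c := step.time.eval (e 0)) (n := e 0)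
          (p := step.compile (d + 1) (m + 1) (k + 2)) (E := .var (2 * (k + 2) + 1))
          (F := F (t + 1)) (s := s') hd le_rfl (by omega) (by omega) h0
          (by
            intro i s'' hi hf'' hx hb
            have hr := ((hs'.frame hf'').succLoc (f := F t)
              (fun j hj => by rw [hb]; exact hF j hj)).succ hd hx
            obtain ⟨s₆, t₆, h6, ht6, hf6, hv6⟩ := ihstep (k := k + 2) (Nat.succ_pos d) hr
            rw [Function.update_of_ne (by omega)] at ht6
            exact ⟨s₆, t₆, h6, ht6, hf6.mono le_rfl (by omega) le_rfl, hv6, hf6.arr _ (by omega),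
              hf6.arr _ (by omega)⟩)
        obtain ⟨s₆, t₆, h6, ht6, hf6, hF6, -⟩ := exec_fill (d := d) (m := m) (k := k + 2)
          (k' := k + 2) (a := 2 * m + 2) (b := 2 * m + 3) (c := 1) (n := e 0)
          (p := .skip) (E := .get (2 * m + 3) (.var (2 * d)))
          (F := F (t + 1)) (s := s₅) hd le_rfl le_rfl (by omega) ((hs'.frame hf5).lev 0 hd)
          (by
            intro i s'' hi hf'' hx hb
            refine ⟨s'', 1, .skip _, le_rfl, Frame.refl _ _ _ _, ?_, rfl, rfl⟩
            simp only [Expr.eval]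
            rw [hb, hx, hF5 i hi])
        have hf56 := hf5.trans hf6
        refine ⟨s₆, _, .seq h5 h6, ?_, (hf56.lev 0 hd).trans h0, (hf56.tmp (k + 1) (by omega)).trans hxt,
          hf.trans (hf56.mono le_rfl le_rfl (by omega)), hF6⟩
        simp only [Expr.cost, Nat.reduceAdd, add_assoc] at ht5 ht6
        omega)
      (by
        rintro t s' v ⟨hf, hF⟩
        exact ⟨hf.trans (Frame.setTmp d m (k + 1) s' le_rfl v), hF⟩)
      (((hs.frame hf12).frame hf3).lev 0 hd) ⟨Frame.refl _ _ _ _, hF3⟩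
    have hf14 := (hf12.trans (hf3.mono le_rfl le_rfl (by omega))).trans
      (hf4.mono le_rfl le_rfl (by omega))
    obtain ⟨t₅, h5, ht5⟩ := exec_guardedGet (a := 2 * m + 2) (x := 2 * k + 1) s₄
    refine ⟨_, _, .seq h1 (.seq h2 (.seq h3 (.seq h4 h5))), ?_,
      hf14.trans (Frame.setTmp _ _ _ _ le_rfl _), ?_⟩
    · simp only [Expr.cost, Nat.reduceAdd] at ht3
      simp only [Term.time, Polynomial.eval_add, Polynomial.eval_mul, Polynomial.eval_X,
        Polynomial.eval_ofNat]
      omega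
    · have h0 : s₄.var 0 = e 0 := (hs.frame hf14).lev 0 hd
      have hk : s₄.var (2 * k + 1) = i.eval I d m e L := by
        rw [hf4.tmp k (by omega), hf3.tmp k (by omega), hf2.tmp k (by omega), hv1]
      simp only [Function.update_self, Term.eval]
      rw [hk, h0]
      split_ifs with h
      · exact hF4 _ h
      · rfl

end Compiler

/-! ### Blocks named by vertices -/

section BlockRecognition

variable {V : Type u}

/-- There is a walk from `u` to `w` avoiding `v`. -/
def ReachableAvoiding (G : SimpleGraph V) (v u w : V) : Prop :=
  ∃ p : G.Walk u w, v ∉ p.support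

/-- No third vertex separates `u` from `w`. -/
def NotSeparated (G : SimpleGraph V) (u w : V) : Prop :=
  ∀ v, v ≠ u → v ≠ w → ReachableAvoiding G v u w

variable [Fintype V]

open Classical in
/-- The vertices that are separated neither from `u` nor from `v` by a third vertex. -/
noncomputable def blockAt (G : SimpleGraph V) (u v : V) : Finset V :=
  Finset.univ.filter fun z => NotSeparated G u z ∧ NotSeparated G v z

variable {G : SimpleGraph V}

theorem mem_blockAt {u v z : V} :
    z ∈ blockAt G u v ↔ NotSeparated G u z ∧ NotSeparated G v z := by
  simp [blockAt]

theorem isCutVertex_iff_reachableAvoiding (hG : G.Connected) {v : V} :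
    IsCutVertex G v ↔ ∃ u w, u ≠ v ∧ w ≠ v ∧ ¬ ReachableAvoiding G v u w := by
  simp [isCutVertex_iff hG, ReachableAvoiding]

theorem IsBlock.notSeparated {B : Finset V} (hB : IsBlock G B) {u w : V} (hu : u ∈ B)
    (hw : w ∈ B) : NotSeparated G u w := by
  intro v hvu hvw
  by_cases hv : v ∈ B
  · exact hB.exists_avoiding hv hu hw hvu.symm hvw.symm
  · obtain ⟨p⟩ := hB.1.1.preconnected ⟨u, hu⟩ ⟨w, hw⟩
    refine ⟨p.map (SimpleGraph.Embedding.induce (B : Set V)).toHom, fun h => hv ?_⟩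
    obtain ⟨z, -, rfl⟩ := List.mem_map.1 ((SimpleGraph.Walk.support_map _ p).symm ▸ h)
    exact z.2

variable [DecidableEq V]

/-- The gate of a vertex `z` outside `B` separates `z` from all other vertices of `B`. Two different
vertices cannot both be that gate, and a single one that is no cut-vertex is not the gate of
anything else. -/
theorem IsBlock.eq_blockAt [Nontrivial V] (hG : IsCactus G) {B : Finset V} (hB : IsBlock G B)
    {u v : V} (hu : u ∈ B) (hv : v ∈ B) (huv : u = v → ¬ IsCutVertex G u) :
    B = blockAt G u v := by
  ext z
  rw [mem_blockAt]
  refine ⟨fun hz => ⟨hB.notSeparated hu hz, hB.notSeparated hv hz⟩, fun ⟨h1, h2⟩ => ?_⟩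
  by_contra hz
  obtain ⟨g, hg⟩ := hB.exists_isGate hG
  have hzg : g z ≠ z := fun h => hz (h ▸ hg.mem z)
  have hsep : ∀ x ∈ B, NotSeparated G x z → g z = x := by
    intro x hx hns
    by_contra hne
    obtain ⟨p, hp⟩ := hns (g z) hne hzg
    exact hp (by simpa using hg.mem_support p.reverse hx)
  have hgu := hsep u hu h1
  exact huv (hgu.symm.trans (hsep v hv h2))
    ((hB.isCutVertex_iff_exists hG hg hu).2 ⟨z, hgu ▸ hzg.symm, hgu⟩)

theorem isBlock_blockAt [Nontrivial V] (hG : IsCactus G) {u : V} (hu : ¬ IsCutVertex G u) :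
    IsBlock G (blockAt G u u) := by
  obtain ⟨v, hv⟩ := exists_adj hG.1 u
  obtain ⟨B, g, hB, -, huB, -, -⟩ := exists_isBlock_of_adj hG hv
  rwa [← hB.eq_blockAt hG huB huB fun _ => hu]

/-- This replaces a quantifier over vertex sets by one over vertices. A block of cut-vertices only
contributes nothing: it has more than one of them and is covered by trivial intervals. -/
theorem mem_blockSet_iff {idx : V → ℕ} (hG : IsCactus G) (hcut : ∃ a, IsCutVertex G a) {v : V} :
    v ∈ blockSet G idx ↔ ∃ u, ¬ IsCutVertex G u ∧ IsChosen G idx (blockAt G u u) v := by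
  obtain ⟨a, ha⟩ := hcut
  have := nontrivial_of_isCutVertex hG.1 ha
  rw [mem_blockSet]
  constructor
  · rintro ⟨B, hB, hv⟩
    obtain ⟨u, huB, hu⟩ : ∃ u ∈ B, ¬ IsCutVertex G u := by
      by_contra! hall
      rcases hv.2 with ⟨⟨b, -, -, hb⟩, -⟩ | ⟨-, -, hcov, -⟩
      · obtain ⟨x, hx, y, hy, hxy⟩ := hB.exists_adj hG.1
        exact hxy.ne ((hb x hx (hall x hx)).trans (hb y hy (hall y hy)).symm)
      · exact hcov fun w hw => ⟨w, hw, w, hw, hall w hw, hall w hw, by simp⟩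
    exact ⟨u, hu, hB.eq_blockAt hG huB huB (fun _ => hu) ▸ hv⟩
  · rintro ⟨u, hu, hv⟩
    exact ⟨_, isBlock_blockAt hG hu, hv⟩

/-- Every block with an edge is named by the ends of that edge, and the bound `3` excludes the
blocks that are single edges. -/
theorem hasEvenCycleBlock_iff (hG : IsCactus G) : HasEvenCycleBlock G ↔
    ∃ u v, G.Adj u v ∧ Even (blockAt G u v).card ∧ 3 ≤ (blockAt G u v).card := by
  constructor
  · rintro ⟨C, hB, hC, heven⟩
    have h3 := hC.three_le_card hG
    obtain ⟨x, hx, y, hy, hne⟩ := Finset.one_lt_card.1 (by omega : 1 < C.card)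
    have : Nontrivial V := ⟨x, y, hne⟩
    obtain ⟨u, hu, v, hv, huv⟩ := hB.exists_adj hG.1
    rw [hB.eq_blockAt hG hu hv fun h => absurd h huv.ne] at h3 heven
    exact ⟨u, v, huv, heven, h3⟩
  · rintro ⟨u, v, huv, heven, h3⟩
    have : Nontrivial V := ⟨u, v, huv.ne⟩
    obtain ⟨B, g, hB, -, hu, hv, h⟩ := exists_isBlock_of_adj hG huv
    rw [← hB.eq_blockAt hG hu hv fun h => absurd h huv.ne] at h3 heven
    rcases h with h | rfl
    · exact ⟨B, hB, h, heven⟩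
    · have := Finset.card_le_two (a := u) (b := v)
      omega

end BlockRecognition

/-! ### Distance and reachability by counting search rounds -/

section BreadthFirstSearch

open Classical in
/-- The truth value of a proposition as a number. -/
noncomputable def truth (P : Prop) : ℕ := if P then 1 else 0

theorem truth_pos {P : Prop} (h : P) : truth P = 1 := if_pos h

theorem truth_neg {P : Prop} (h : ¬ P) : truth P = 0 := if_neg h

theorem truth_pos_iff {P : Prop} : 0 < truth P ↔ P := by
  by_cases h : P <;> simp [truth_pos, truth_neg, h]

variable {V : Type u}

/-- The number of rounds among the first `t + 1` after which a breadth-first search from `u` through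
the vertices satisfying `A` has reached a given vertex. -/
noncomputable def searchCount (G : SimpleGraph V) (A : V → Prop) (u : V) : ℕ → V → ℕ
  | 0, x => truth (x = u)
  | t + 1, x => searchCount G A u t x +
      truth (0 < searchCount G A u t x ∨ (A x ∧ ∃ y, 0 < searchCount G A u t y ∧ G.Adj y x))

variable {G : SimpleGraph V}

/-- A vertex at distance `d` is reached in round `d` and counted in every round from then on.
Counting instead of marking makes one array yield both reachability and distance. -/
theorem searchCount_eq_sub_dist (hG : G.Connected) {u : V} (t : ℕ) (x : V) :
    searchCount G (fun _ => True) u t x = t + 1 - G.dist u x := by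
  induction t generalizing x with
  | zero =>
    rw [searchCount]
    by_cases h : x = u
    · simp [h, truth_pos]
    · have := hG.pos_dist_of_ne (Ne.symm h)
      rw [truth_neg h]
      omega
  | succ t ih =>
    have hiff : (0 < t + 1 - G.dist u x ∨ (True ∧ ∃ y, 0 < t + 1 - G.dist u y ∧ G.Adj y x)) ↔
        G.dist u x ≤ t + 1 := by
      constructor
      · rintro (h | ⟨-, y, h, hy⟩)
        · omega
        · have := hG.dist_triangle (u := u) (v := y) (w := x)
          rw [SimpleGraph.dist_eq_one_iff_adj.2 hy] at this
          omega
      · intro h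
        by_cases h' : G.dist u x ≤ t
        · left; omega
        · right
          obtain ⟨p, hp⟩ := hG.exists_walk_length_eq_dist x u
          cases p with
          | nil => simp at h'
          | cons hadj q =>
            refine ⟨trivial, _, ?_, hadj.symm⟩
            have := SimpleGraph.dist_le q
            rw [SimpleGraph.Walk.length_cons, SimpleGraph.dist_comm] at hp
            rw [SimpleGraph.dist_comm] at this
            omega
    simp only [searchCount, ih]
    rw [hiff]
    by_cases h : G.dist u x ≤ t + 1
    · rw [truth_pos h]; omega
    · rw [truth_neg h]; omega

/-- The search never tests its starting vertex, hence the assumption `u ≠ v`. -/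
theorem searchCount_pos_iff {u v : V} (huv : u ≠ v) (t : ℕ) (x : V) :
    0 < searchCount G (fun y => y ≠ v) u t x ↔ ∃ p : G.Walk u x, v ∉ p.support ∧ p.length ≤ t := by
  induction t generalizing x with
  | zero =>
    rw [searchCount, truth_pos_iff]
    constructor
    · rintro rfl
      exact ⟨.nil, by simpa using huv.symm, le_rfl⟩
    · rintro ⟨p, -, hp⟩
      exact (SimpleGraph.Walk.eq_of_length_eq_zero (Nat.le_zero.1 hp)).symm
  | succ t ih =>
    rw [searchCount]
    simp only [Nat.add_pos_iff_pos_or_pos, truth_pos_iff, ih]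
    constructor
    · rintro (⟨p, h, hp⟩ | ⟨p, h, hp⟩ | ⟨hx, y, ⟨p, h, hp⟩, hy⟩)
      · exact ⟨p, h, by omega⟩
      · exact ⟨p, h, by omega⟩
      · refine ⟨p.concat hy, ?_, by rw [SimpleGraph.Walk.length_concat]; omega⟩
        rw [SimpleGraph.Walk.support_concat]
        simp [h, hx.symm]
    · rintro ⟨p, h, hp⟩
      cases p with
      | nil => exact Or.inl ⟨.nil, h, Nat.zero_le t⟩
      | cons h' p =>
        obtain ⟨y, q, hy, hpq⟩ := SimpleGraph.Walk.exists_cons_eq_concat h' p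
        rw [hpq, SimpleGraph.Walk.length_concat] at hp
        rw [hpq, SimpleGraph.Walk.support_concat] at h
        simp only [List.mem_append, List.mem_singleton, not_or] at h
        exact Or.inr (Or.inr ⟨Ne.symm h.2, y, ⟨q, h.1, by omega⟩, hy⟩)

/-- Bypassing repetitions turns the walk into a path, which has fewer than `Fintype.card V` edges;
so that many rounds suffice. -/
theorem reachableAvoiding_iff_searchCount [Fintype V] {u v w : V} :
    ReachableAvoiding G v u w ↔
      u ≠ v ∧ 0 < searchCount G (fun y => y ≠ v) u (Fintype.card V) w := by
  classical
  constructor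
  · rintro ⟨p, hp⟩
    have huv : u ≠ v := fun h => hp (h ▸ p.start_mem_support)
    refine ⟨huv, (searchCount_pos_iff huv _ _).2 ⟨p.bypass, fun h => hp ?_, ?_⟩⟩
    · exact p.support_bypass_subset_support h
    · exact p.bypass_isPath.length_lt.le
  · rintro ⟨huv, h⟩
    obtain ⟨p, hp, -⟩ := (searchCount_pos_iff huv _ _).1 h
    exact ⟨p, hp⟩

theorem dist_eq_sub_searchCount [Fintype V] (hG : G.Connected) (u w : V) :
    G.dist u w =
      Fintype.card V + 1 - searchCount G (fun _ => True) u (Fintype.card V) w := by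
  obtain ⟨p, hp, hl⟩ := hG.exists_path_of_dist u w
  have := hp.length_lt
  rw [searchCount_eq_sub_dist hG]
  omega

end BreadthFirstSearch

/-! ### Closure properties of the functions and predicates given by terms -/

section Computability

/-- A family of cacti together with the loop variables and local arrays that are in scope. -/
structure Context where
  Pt : Type
  n : Pt → ℕ
  graph : ∀ p, SimpleGraph (Fin (n p))
  cactus : ∀ p, IsCactus (graph p)
  depth : ℕ
  width : ℕ
  env : Pt → ℕ → ℕ
  arr : Pt → ℕ → ℕ → ℕ
  depth_pos : 0 < depth
  env_zero : ∀ p, env p 0 = n p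

/-- The context with one more loop variable. -/
@[reducible] def Context.ext (Γ : Context) : Context where
  Pt := Σ p : Γ.Pt, Fin (Γ.n p)
  n p := Γ.n p.1
  graph p := Γ.graph p.1
  cactus p := Γ.cactus p.1
  depth := Γ.depth + 1
  width := Γ.width
  env p := Function.update (Γ.env p.1) Γ.depth p.2
  arr p := Γ.arr p.1
  depth_pos := Nat.succ_pos _
  env_zero p := by rw [Function.update_of_ne Γ.depth_pos.ne]; exact Γ.env_zero p.1

/-- The context with one more local array. -/
@[reducible] def Context.extArr (Γ : Context) : Context where
  Pt := Γ.Pt × (ℕ → ℕ)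
  n p := Γ.n p.1
  graph p := Γ.graph p.1
  cactus p := Γ.cactus p.1
  depth := Γ.depth
  width := Γ.width + 1
  env p := Γ.env p.1
  arr p := Function.update (Γ.arr p.1) Γ.width p.2
  depth_pos := Γ.depth_pos
  env_zero p := Γ.env_zero p.1

/-- The adjacency matrix as an input array. -/
noncomputable def adjInput {n : ℕ} (G : SimpleGraph (Fin n)) : ℕ → ℕ :=
  (inputStore G 0).arr 0

theorem adjInput_eq {n : ℕ} (G : SimpleGraph (Fin n)) (m : ℕ) :
    adjInput G m = truth (∃ i j : Fin n, m = i.val * n + j.val ∧ G.Adj i j) := by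
  unfold adjInput inputStore truth
  dsimp only
  congr 1
  simp

/-- The vertex `u` is the value of a loop variable. -/
def Context.IsVar (Γ : Context) (u : ∀ p, Fin (Γ.n p)) : Prop :=
  ∃ x < Γ.depth, ∀ p, Γ.env p x = u p

/-- The function `h` is the content of a local array. -/
def Context.IsArr (Γ : Context) (h : ∀ p, Fin (Γ.n p) → ℕ) : Prop :=
  ∃ a < Γ.width, ∀ p (i : Fin (Γ.n p)), Γ.arr p a i = h p i

/-- The function `f` is computed by a term. -/
def Context.Computes (Γ : Context) (f : Γ.Pt → ℕ) : Prop :=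
  ∃ T : Term, ∀ p, T.eval (adjInput (Γ.graph p)) Γ.depth Γ.width (Γ.env p) (Γ.arr p) = f p

/-- The predicate `P` is decided by a term. -/
def Context.Decides (Γ : Context) (P : Γ.Pt → Prop) : Prop :=
  Γ.Computes fun p => truth (P p)

namespace Context

variable {Γ : Context}

theorem IsVar.ext {u : ∀ p, Fin (Γ.n p)} (h : Γ.IsVar u) : Γ.ext.IsVar fun p => u p.1 := by
  obtain ⟨x, hx, h⟩ := h
  exact ⟨x, Nat.lt_succ_of_lt hx, fun p => by
    rw [← h]; exact Function.update_of_ne hx.ne _ _⟩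

theorem IsVar.extArr {u : ∀ p, Fin (Γ.n p)} (h : Γ.IsVar u) : Γ.extArr.IsVar fun p => u p.1 := by
  obtain ⟨x, hx, h⟩ := h
  exact ⟨x, hx, fun p => h p.1⟩

theorem isVar_last : Γ.ext.IsVar fun p => p.2 :=
  ⟨Γ.depth, Nat.lt_succ_self _, fun _ => Function.update_self _ _ _⟩

theorem IsArr.ext {h : ∀ p, Fin (Γ.n p) → ℕ} (H : Γ.IsArr h) : Γ.ext.IsArr fun p => h p.1 := by
  obtain ⟨a, ha, H⟩ := H
  exact ⟨a, ha, fun p => H p.1⟩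

theorem isArr_last : Γ.extArr.IsArr fun p i => p.2 i :=
  ⟨Γ.width, Nat.lt_succ_self _, fun p i => by
    change Function.update (Γ.arr p.1) Γ.width p.2 Γ.width i = _
    rw [Function.update_self]⟩

theorem Computes.congr {f g : Γ.Pt → ℕ} (h : Γ.Computes f) (hfg : ∀ p, g p = f p) :
    Γ.Computes g := by
  rwa [funext hfg]

theorem computes_const (c : ℕ) : Γ.Computes fun _ => c := ⟨.const c, fun _ => rfl⟩

theorem computes_size : Γ.Computes Γ.n :=
  ⟨.lev 0, fun p => by rw [Term.eval, if_pos Γ.depth_pos, Γ.env_zero]⟩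

theorem IsVar.computes {u : ∀ p, Fin (Γ.n p)} (h : Γ.IsVar u) : Γ.Computes fun p => u p := by
  obtain ⟨x, hx, h⟩ := h
  exact ⟨.lev x, fun p => by rw [Term.eval, if_pos hx, h]⟩

theorem Computes.add {f g : Γ.Pt → ℕ} (hf : Γ.Computes f) (hg : Γ.Computes g) :
    Γ.Computes fun p => f p + g p := by
  obtain ⟨S, hS⟩ := hf
  obtain ⟨T, hT⟩ := hg
  exact ⟨.add S T, fun p => by rw [Term.eval, hS, hT]⟩

theorem Computes.sub {f g : Γ.Pt → ℕ} (hf : Γ.Computes f) (hg : Γ.Computes g) :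
    Γ.Computes fun p => f p - g p := by
  obtain ⟨S, hS⟩ := hf
  obtain ⟨T, hT⟩ := hg
  exact ⟨.sub S T, fun p => by rw [Term.eval, hS, hT]⟩

theorem Computes.sum {f : ∀ p, Fin (Γ.n p) → ℕ} (hf : Γ.ext.Computes fun p => f p.1 p.2) :
    Γ.Computes fun p => ∑ i, f p i := by
  obtain ⟨T, hT⟩ := hf
  refine ⟨.sum T, fun p => ?_⟩
  rw [Term.eval, Γ.env_zero, ← Fin.sum_univ_eq_sum_range
    (fun i => T.eval _ (Γ.depth + 1) Γ.width (Function.update (Γ.env p) Γ.depth i) (Γ.arr p))]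
  exact Finset.sum_congr rfl fun i _ => hT ⟨p, i⟩

theorem IsArr.computes {h : ∀ p, Fin (Γ.n p) → ℕ} {u : ∀ p, Fin (Γ.n p)} (H : Γ.IsArr h)
    (hu : Γ.IsVar u) : Γ.Computes fun p => h p (u p) := by
  obtain ⟨a, ha, H⟩ := H
  obtain ⟨T, hT⟩ := hu.computes
  refine ⟨.loc a T, fun p => ?_⟩
  rw [Term.eval, hT, Γ.env_zero, if_pos ⟨ha, (u p).2⟩, H]

/-- A point of `Γ.extArr` carries an arbitrary array, so the term for `step` may be applied to the
contents after any number of rounds. -/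
theorem Computes.iterate {F : ∀ p, ℕ → Fin (Γ.n p) → ℕ}
    {step : ∀ p, (Fin (Γ.n p) → ℕ) → Fin (Γ.n p) → ℕ} {src i : ∀ p, Fin (Γ.n p)}
    (hstep : Γ.extArr.ext.Computes fun p => step p.1.1 (fun i => p.1.2 i) p.2)
    (hsrc : Γ.IsVar src) (hi : Γ.IsVar i) (h0 : ∀ p x, F p 0 x = truth (x = src p))
    (hF : ∀ p t x, F p (t + 1) x = step p (F p t) x) :
    Γ.Computes fun p => F p (Γ.n p) (i p) := by
  obtain ⟨S, hS⟩ := hstep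
  obtain ⟨T, hT⟩ := hsrc.computes
  obtain ⟨U, hU⟩ := hi.computes
  refine ⟨.iter T S U, fun p => ?_⟩
  rw [Term.eval, hU, hT, Γ.env_zero, if_pos (i p).2]
  have key : ∀ t (x : Fin (Γ.n p)), Nat.rec (motive := fun _ => ℕ → ℕ)
      (fun x => if x = (src p : ℕ) then 1 else 0)
      (fun _ h x => S.eval (adjInput (Γ.graph p)) (Γ.depth + 1) (Γ.width + 1)
        (Function.update (Γ.env p) Γ.depth x) (Function.update (Γ.arr p) Γ.width h)) t (x : ℕ) =
      F p t x := by
    intro t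
    induction t with
    | zero =>
      intro x
      rw [h0]
      by_cases h : x = src p
      · simp [h, truth]
      · simp [h, truth, Fin.val_inj]
    | succ t ih =>
      intro x
      rw [hF, ← funext ih]
      exact hS ⟨(p, _), x⟩
  exact key _ _

theorem Decides.congr {P Q : Γ.Pt → Prop} (h : Γ.Decides P) (hPQ : ∀ p, Q p ↔ P p) :
    Γ.Decides Q := by
  rwa [funext fun p => propext (hPQ p)]

theorem Decides.not {P : Γ.Pt → Prop} (h : Γ.Decides P) : Γ.Decides fun p => ¬ P p :=
  ((computes_const 1).sub h).congr fun p => by by_cases hp : P p <;> simp [truth, hp]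

theorem Decides.and {P Q : Γ.Pt → Prop} (hP : Γ.Decides P) (hQ : Γ.Decides Q) :
    Γ.Decides fun p => P p ∧ Q p :=
  ((Computes.add hP hQ).sub (computes_const 1)).congr fun p => by
    by_cases hp : P p <;> by_cases hq : Q p <;> simp [truth, hp, hq]

theorem Decides.or {P Q : Γ.Pt → Prop} (hP : Γ.Decides P) (hQ : Γ.Decides Q) :
    Γ.Decides fun p => P p ∨ Q p :=
  (hP.not.and hQ.not).not.congr fun p => by tauto

theorem Decides.imp {P Q : Γ.Pt → Prop} (hP : Γ.Decides P) (hQ : Γ.Decides Q) :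
    Γ.Decides fun p => P p → Q p :=
  (hP.not.or hQ).congr fun p => by tauto

theorem Computes.le {f g : Γ.Pt → ℕ} (hf : Γ.Computes f) (hg : Γ.Computes g) :
    Γ.Decides fun p => f p ≤ g p :=
  ((computes_const 1).sub (hf.sub hg)).congr fun p => by
    by_cases h : f p ≤ g p
    · rw [truth_pos h]; omega
    · rw [truth_neg h]; omega

theorem Computes.lt {f g : Γ.Pt → ℕ} (hf : Γ.Computes f) (hg : Γ.Computes g) :
    Γ.Decides fun p => f p < g p :=
  (hf.add (computes_const 1)).le hg

theorem Computes.eq {f g : Γ.Pt → ℕ} (hf : Γ.Computes f) (hg : Γ.Computes g) :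
    Γ.Decides fun p => f p = g p :=
  ((hf.le hg).and (hg.le hf)).congr fun _ => le_antisymm_iff

/-- Division is avoided by `2 * f ≤ g ≤ 2 * f + 1`, the double being a sum. -/
theorem Computes.eq_half {f g : Γ.Pt → ℕ} (hf : Γ.Computes f) (hg : Γ.Computes g) :
    Γ.Decides fun p => f p = g p / 2 :=
  (((hf.add hf).le hg).and (hg.le ((hf.add hf).add (computes_const 1)))).congr fun _ => by omega

theorem Decides.exists {P : ∀ p, Fin (Γ.n p) → Prop} (h : Γ.ext.Decides fun p => P p.1 p.2) :
    Γ.Decides fun p => ∃ i, P p i :=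
  ((computes_const 0).lt (Computes.sum (f := fun p i => truth (P p i)) h)).congr fun p => by
    simp only [Finset.sum_pos_iff, Finset.mem_univ, true_and, truth_pos_iff]

theorem Decides.forall {P : ∀ p, Fin (Γ.n p) → Prop} (h : Γ.ext.Decides fun p => P p.1 p.2) :
    Γ.Decides fun p => ∀ i, P p i :=
  (Decides.exists (P := fun p i => ¬ P p i) h.not).not.congr fun p => by simp

theorem Decides.card {S : ∀ p, Finset (Fin (Γ.n p))} (h : Γ.ext.Decides fun p => p.2 ∈ S p.1) :
    Γ.Computes fun p => (S p).card :=
  (Computes.sum (f := fun p i => truth (i ∈ S p)) h).congr fun p => by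
    have : ∀ i, truth (i ∈ S p) = if i ∈ S p then 1 else 0 := fun i => by
      by_cases h : i ∈ S p <;> simp [truth, h]
    simp [this]

theorem IsVar.eq {u v : ∀ p, Fin (Γ.n p)} (hu : Γ.IsVar u) (hv : Γ.IsVar v) :
    Γ.Decides fun p => u p = v p :=
  (hu.computes.eq hv.computes).congr fun _ => Fin.ext_iff

theorem IsVar.adj {u v : ∀ p, Fin (Γ.n p)} (hu : Γ.IsVar u) (hv : Γ.IsVar v) :
    Γ.Decides fun p => (Γ.graph p).Adj (u p) (v p) := by
  -- Terms have no multiplication: the row offset `u * n` is the sum of `u` over all `n` values of a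
  -- loop variable.
  obtain ⟨T, hT⟩ := (Computes.sum (f := fun p _ => u p) hu.ext.computes).add hv.computes
  refine ⟨.inp T, fun p => ?_⟩
  rw [Term.eval, hT]
  simp only [Finset.sum_const, Finset.card_univ, Fintype.card_fin, smul_eq_mul, adjInput_eq]
  congr 1
  refine propext ⟨?_, fun h => ⟨u p, v p, by ring, h⟩⟩
  rintro ⟨i, j, hij, h⟩
  -- Quotient and remainder modulo `n` recover row and column from the matrix index.
  have hdiv := congrArg (· / Γ.n p) hij
  have hmod := congrArg (· % Γ.n p) hij
  have hn : 0 < Γ.n p := (u p).pos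
  simp only [Nat.mul_add_div hn, Nat.mul_add_mod, mul_comm (i : ℕ), Nat.div_eq_of_lt (Fin.is_lt _),
    Nat.mod_eq_of_lt (Fin.is_lt _), add_zero] at hdiv hmod
  rwa [Fin.ext hdiv, Fin.ext hmod]

theorem IsVar.searchCount {A : ∀ p, Fin (Γ.n p) → Prop} {u w : ∀ p, Fin (Γ.n p)}
    (hA : Γ.extArr.ext.Decides fun p => A p.1.1 p.2) (hu : Γ.IsVar u) (hw : Γ.IsVar w) :
    Γ.Computes fun p => searchCount (Γ.graph p) (A p) (u p) (Γ.n p) (w p) := by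
  refine Computes.iterate (F := fun p => StrongGeodetic.searchCount (Γ.graph p) (A p) (u p))
    (step := fun p h x => h x + truth (0 < h x ∨ (A p x ∧ ∃ y, 0 < h y ∧ (Γ.graph p).Adj y x)))
    ?_ hu hw (fun _ _ => rfl) (fun _ _ _ => rfl)
  have hx := (isArr_last (Γ := Γ)).ext.computes isVar_last
  exact hx.add (((computes_const 0).lt hx).or (hA.and (Decides.exists
    (((computes_const 0).lt (isArr_last.ext.ext.computes isVar_last)).and
      (isVar_last.adj isVar_last.ext)))))

theorem IsVar.dist {u w : ∀ p, Fin (Γ.n p)} (hu : Γ.IsVar u) (hw : Γ.IsVar w) :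
    Γ.Computes fun p => (Γ.graph p).dist (u p) (w p) :=
  ((computes_size.add (computes_const 1)).sub (IsVar.searchCount (A := fun _ _ => True)
    ((computes_const 0).eq (computes_const 0) |>.congr fun _ => by simp) hu hw)).congr fun p => by
    rw [dist_eq_sub_searchCount (Γ.cactus p).1, Fintype.card_fin]

theorem IsVar.reachableAvoiding {v u w : ∀ p, Fin (Γ.n p)} (hv : Γ.IsVar v) (hu : Γ.IsVar u)
    (hw : Γ.IsVar w) : Γ.Decides fun p => ReachableAvoiding (Γ.graph p) (v p) (u p) (w p) :=
  ((hu.eq hv).not.and ((computes_const 0).lt (IsVar.searchCount (A := fun p y => y ≠ v p)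
    (isVar_last.eq hv.extArr.ext).not hu hw))).congr fun p => by
    rw [reachableAvoiding_iff_searchCount, Fintype.card_fin]

theorem IsVar.notSeparated {u w : ∀ p, Fin (Γ.n p)} (hu : Γ.IsVar u) (hw : Γ.IsVar w) :
    Γ.Decides fun p => NotSeparated (Γ.graph p) (u p) (w p) :=
  Decides.forall ((isVar_last.eq hu.ext).not.imp
    ((isVar_last.eq hw.ext).not.imp (isVar_last.reachableAvoiding hu.ext hw.ext)))

theorem IsVar.isCutVertex {v : ∀ p, Fin (Γ.n p)} (hv : Γ.IsVar v) :
    Γ.Decides fun p => IsCutVertex (Γ.graph p) (v p) :=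
  (Decides.exists (P := fun p u => ∃ w, u ≠ v p ∧ w ≠ v p ∧ ¬ ReachableAvoiding (Γ.graph p) (v p) u w)
    (Decides.exists ((isVar_last.ext.eq hv.ext.ext).not.and ((isVar_last.eq hv.ext.ext).not.and
      (hv.ext.ext.reachableAvoiding isVar_last.ext isVar_last).not)))).congr fun p =>
    isCutVertex_iff_reachableAvoiding (Γ.cactus p).1

theorem IsVar.mem_blockAt {u v z : ∀ p, Fin (Γ.n p)} (hu : Γ.IsVar u) (hv : Γ.IsVar v)
    (hz : Γ.IsVar z) : Γ.Decides fun p => z p ∈ blockAt (Γ.graph p) (u p) (v p) :=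
  ((hu.notSeparated hz).and (hv.notSeparated hz)).congr fun _ => StrongGeodetic.mem_blockAt

theorem IsVar.card_blockAt {u v : ∀ p, Fin (Γ.n p)} (hu : Γ.IsVar u) (hv : Γ.IsVar v) :
    Γ.Computes fun p => (blockAt (Γ.graph p) (u p) (v p)).card :=
  Decides.card (hu.ext.mem_blockAt hv.ext isVar_last)

theorem IsVar.even_card_blockAt {u v : ∀ p, Fin (Γ.n p)} (hu : Γ.IsVar u) (hv : Γ.IsVar v) :
    Γ.Decides fun p => Even (blockAt (Γ.graph p) (u p) (v p)).card :=
  (Decides.exists (P := fun p (i : Fin (Γ.n p)) =>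
    (blockAt (Γ.graph p) (u p) (v p)).card = (i : ℕ) + i)
    ((hu.ext.card_blockAt hv.ext).eq (isVar_last.computes.add isVar_last.computes))).congr
    fun p => by
      constructor
      · rintro ⟨r, hr⟩
        have h1 := (blockAt (Γ.graph p) (u p) (v p)).card_le_univ
        rw [Fintype.card_fin] at h1
        have h2 := (u p).pos
        -- Half of a cardinality at most `n` with `0 < n` is below `n`, so a loop variable can take
        -- this value.
        exact ⟨⟨r, by omega⟩, hr⟩
      · rintro ⟨i, hi⟩
        exact ⟨i, hi⟩

theorem Decides.exists_mem_blockAt {u v : ∀ p, Fin (Γ.n p)} {P : ∀ p, Fin (Γ.n p) → Prop}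
    (hu : Γ.IsVar u) (hv : Γ.IsVar v) (h : Γ.ext.Decides fun p => P p.1 p.2) :
    Γ.Decides fun p => ∃ z ∈ blockAt (Γ.graph p) (u p) (v p), P p z :=
  Decides.exists ((hu.ext.mem_blockAt hv.ext isVar_last).and h)

theorem Decides.forall_mem_blockAt {u v : ∀ p, Fin (Γ.n p)} {P : ∀ p, Fin (Γ.n p) → Prop}
    (hu : Γ.IsVar u) (hv : Γ.IsVar v) (h : Γ.ext.Decides fun p => P p.1 p.2) :
    Γ.Decides fun p => ∀ z ∈ blockAt (Γ.graph p) (u p) (v p), P p z :=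
  Decides.forall ((hu.ext.mem_blockAt hv.ext isVar_last).imp h)

theorem IsVar.hasUniqueCutVertex {u : ∀ p, Fin (Γ.n p)} (hu : Γ.IsVar u) :
    Γ.Decides fun p => HasUniqueCutVertex (Γ.graph p) (blockAt (Γ.graph p) (u p) (u p)) :=
  Decides.exists_mem_blockAt hu hu (isVar_last.isCutVertex.and
    (Decides.forall_mem_blockAt hu.ext hu.ext
      (isVar_last.isCutVertex.imp (isVar_last.eq isVar_last.ext))))

theorem IsVar.hasAntipodalCutVertices {u : ∀ p, Fin (Γ.n p)} (hu : Γ.IsVar u) :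
    Γ.Decides fun p => HasAntipodalCutVertices (Γ.graph p) (blockAt (Γ.graph p) (u p) (u p)) :=
  Decides.exists_mem_blockAt hu hu (Decides.exists_mem_blockAt hu.ext hu.ext
    (isVar_last.ext.isCutVertex.and (isVar_last.isCutVertex.and
      ((isVar_last.ext.dist isVar_last).eq_half (hu.ext.ext.card_blockAt hu.ext.ext)))))

theorem IsVar.coveredByIntervals {u : ∀ p, Fin (Γ.n p)} (hu : Γ.IsVar u) :
    Γ.Decides fun p => CoveredByIntervals (Γ.graph p) (blockAt (Γ.graph p) (u p) (u p)) :=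
  Decides.forall_mem_blockAt hu hu (Decides.exists_mem_blockAt hu.ext hu.ext
    (Decides.exists_mem_blockAt hu.ext.ext hu.ext.ext
    (isVar_last.ext.isCutVertex.and (isVar_last.isCutVertex.and
      (((isVar_last.ext.dist isVar_last.ext.ext).add (isVar_last.ext.ext.dist isVar_last)).eq
        (isVar_last.ext.dist isVar_last))))))

theorem IsVar.isArcMiddle {u v : ∀ p, Fin (Γ.n p)} (hu : Γ.IsVar u) (hv : Γ.IsVar v) :
    Γ.Decides fun p => IsArcMiddle (Γ.graph p) (blockAt (Γ.graph p) (u p) (u p)) (v p) := by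
  have hd := (hu.ext.ext.card_blockAt hu.ext.ext).sub
    ((isVar_last (Γ := Γ)).ext.dist isVar_last)
  exact (hu.mem_blockAt hu hv).and (Decides.exists_mem_blockAt hu hu
    (Decides.exists_mem_blockAt hu.ext hu.ext
    (isVar_last.ext.isCutVertex.and (isVar_last.isCutVertex.and
      ((isVar_last.ext.eq isVar_last).not.and
        (((isVar_last.ext.dist hv.ext.ext).eq_half hd).and
          (((isVar_last.ext.dist hv.ext.ext).add (hv.ext.ext.dist isVar_last)).eq hd)))))))

theorem IsVar.isChosen {u v : ∀ p, Fin (Γ.n p)} (hu : Γ.IsVar u) (hv : Γ.IsVar v) :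
    Γ.Decides fun p =>
      IsChosen (Γ.graph p) Fin.val (blockAt (Γ.graph p) (u p) (u p)) (v p) :=
  (hu.mem_blockAt hu hv).and
    ((hu.hasUniqueCutVertex.and (Decides.exists_mem_blockAt hu hu (isVar_last.isCutVertex.and
      ((isVar_last.dist hv.ext).eq_half (hu.ext.card_blockAt hu.ext))))).or
    (hu.hasUniqueCutVertex.not.and ((hu.even_card_blockAt hu |>.and
      hu.hasAntipodalCutVertices).not.and (hu.coveredByIntervals.not.and
      ((hu.isArcMiddle hv).and (Decides.forall ((isVar_last.computes.lt hv.ext.computes).imp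
        (hu.ext.isArcMiddle isVar_last).not)))))))

theorem IsVar.mem_baseSet {v : ∀ p, Fin (Γ.n p)} (hv : Γ.IsVar v) :
    Γ.Decides fun p => v p ∈ baseSet (Γ.graph p) Fin.val := by
  have hcut : Γ.Decides fun p => ∃ a, IsCutVertex (Γ.graph p) a :=
    Decides.exists isVar_last.isCutVertex
  have hblock : Γ.Decides fun p => ∃ u, ¬ IsCutVertex (Γ.graph p) u ∧
      IsChosen (Γ.graph p) Fin.val (blockAt (Γ.graph p) u u) (v p) :=
    Decides.exists (isVar_last.isCutVertex.not.and (isVar_last.isChosen hv.ext))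
  have hsingle : Γ.Decides fun p => (v p : ℕ) = 0 ∨
      ∃ a : Fin (Γ.n p), (a : ℕ) = 0 ∧ (Γ.graph p).dist a (v p) = Γ.n p / 2 :=
    (hv.computes.eq (computes_const 0)).or (Decides.exists
      ((isVar_last.computes.eq (computes_const 0)).and
        ((isVar_last.dist hv.ext).eq_half computes_size)))
  refine ((hcut.and hblock).or (hcut.not.and hsingle)).congr fun p => ?_
  rw [baseSet]
  split_ifs with h
  · simp [h, mem_blockSet_iff (Γ.cactus p) h]
  · rw [mem_singleBlockSet, Fintype.card_fin]
    simp only [h, false_and, not_false_eq_true, true_and, false_or]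

theorem IsVar.mem_resultSet {v : ∀ p, Fin (Γ.n p)} (hv : Γ.IsVar v) :
    Γ.Decides fun p => v p ∈ resultSet (Γ.graph p) Fin.val := by
  have heven : Γ.Decides fun p => HasEvenCycleBlock (Γ.graph p) :=
    (Decides.exists (Decides.exists ((isVar_last.ext.adj isVar_last).and
      ((isVar_last.ext.even_card_blockAt isVar_last).and
        ((computes_const 3).le (isVar_last.ext.card_blockAt isVar_last)))))).congr
      fun p => hasEvenCycleBlock_iff (Γ.cactus p)
  exact (hv.mem_baseSet.or (((Decides.card isVar_last.mem_baseSet).lt (computes_const 3)).and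
    (heven.and (hv.mem_baseSet.not.and (Decides.forall
      ((isVar_last.computes.lt hv.ext.computes).imp isVar_last.mem_baseSet)))))).congr
    fun p => StrongGeodetic.mem_resultSet

end Context

end Computability

/-! ### The programs for the set and for the decision problem -/

section Programs

/-- The context of all cacti with one loop variable. -/
def inputContext : Context where
  Pt := Σ n : ℕ, {G : SimpleGraph (Fin n) // IsCactus G}
  n p := p.1
  graph p := p.2.1
  cactus p := p.2.2
  depth := 1
  width := 0
  env p _ := p.1
  arr _ _ _ := 0
  depth_pos := Nat.one_pos
  env_zero _ := rfl

theorem represents_inputStore {n : ℕ} (G : SimpleGraph (Fin n)) (k : ℕ) :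
    Represents (adjInput G) 1 0 (fun _ => n) (fun _ _ => 0) (inputStore G k) :=
  ⟨rfl, fun x hx => by rw [Nat.lt_one_iff.1 hx]; rfl, fun _ ha => absurd ha (by omega)⟩

/-- Write the values of a term for all values of the loop variable `1` into the output array. -/
def outputProgram (T : Term) : Program :=
  .forLoop 2 (.seq (T.compile 2 0 1) (.store 1 (.var 2) (.var 3)))

theorem exec_outputProgram (T : Term) {n : ℕ} (G : SimpleGraph (Fin n)) :
    ∃ s t, Exec (outputProgram T) (inputStore G 0) s t ∧
      t ≤ (Polynomial.X * (T.time + 11) + 6).eval n ∧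
      ∀ i < n, s.arr 1 i =
        T.eval (adjInput G) 2 0 (Function.update (fun _ => n) 1 i) (fun _ _ => 0) := by
  have hr := represents_inputStore G 0
  obtain ⟨s, t, h, ht, -, -, hs⟩ := exec_forLoop (x := 2) (n := n) (c := T.time.eval n + 3)
    (p := .seq (T.compile 2 0 1) (.store 1 (.var 2) (.var 3))) (by omega)
    (fun i s => Represents (adjInput G) 1 0 (fun _ => n) (fun _ _ => 0) s ∧ ∀ j < i, s.arr 1 j =
        T.eval (adjInput G) 2 0 (Function.update (fun _ => n) 1 j) (fun _ _ => 0))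
    (by
      rintro i s hi h0 hx ⟨hs, hj⟩
      obtain ⟨s', t, h, ht, hf, hv⟩ := T.exec_compile (adjInput G) (d := 2) (m := 0) (k := 1)
        (by omega) (hs.succ Nat.one_pos hx)
      have hs' := hs.frame (hf.mono (by omega : 1 ≤ 2) le_rfl le_rfl)
      have hx' : s'.var 2 = i := (hf.lev 1 (by omega)).trans hx
      refine ⟨_, _, .seq h (.store _ _ _ _), ?_, hs'.lev 0 Nat.one_pos, hx', ⟨?_, hs'.lev, ?_⟩, ?_⟩
      · rw [Function.update_of_ne zero_ne_one] at ht
        simp only [Expr.cost]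
        omega
      · simp only
        rw [Function.update_of_ne zero_ne_one]
        exact hs'.inp
      · exact fun a ha => absurd ha (by omega)
      · intro j hj'
        simp only [Function.update_self, Expr.eval, hx']
        rcases Nat.lt_succ_iff_lt_or_eq.1 hj' with hj' | rfl
        -- Compiled terms use only the arrays from `2` on as local arrays, so the output written so
        -- far survives.
        · rw [Function.update_of_ne (by omega), hf.arr 1 (by omega), hj j hj']
        · rw [Function.update_self]; exact hv)
    (by
      rintro i s v ⟨hs, hj⟩
      exact ⟨hs.frame (Frame.setLev 1 0 0 s (le_refl 1) v), hj⟩)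
    (hr.lev 0 Nat.one_pos) ⟨hr, fun j hj => absurd hj (by omega)⟩
  refine ⟨s, t, h, ?_, hs⟩
  simpa [add_assoc] using ht

theorem exists_outputProgram : ∃ (prog : Program) (b : Polynomial ℕ),
    ∀ (n : ℕ) (G : SimpleGraph (Fin n)), IsCactus G →
      ∃ (s : Store) (t : ℕ), Exec prog (inputStore G 0) s t ∧ t ≤ b.eval n ∧
        outputSet n s = resultSet G Fin.val := by
  obtain ⟨T, hT⟩ := (Context.isVar_last (Γ := inputContext)).mem_resultSet
  refine ⟨outputProgram T, Polynomial.X * (T.time + 11) + 6, fun n G hG => ?_⟩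
  obtain ⟨s, t, h, ht, hs⟩ := exec_outputProgram T G
  refine ⟨s, t, h, ht, ?_⟩
  ext v
  have hv : T.eval (adjInput G) 2 0 (Function.update (fun _ => n) 1 v) (fun _ _ => 0) =
    truth (v ∈ resultSet G Fin.val) := hT ⟨⟨n, G, hG⟩, v⟩
  simp [outputSet, hs v v.2, hv, ← Nat.pos_iff_ne_zero, truth_pos_iff]

theorem exists_decisionProgram : ∃ (prog : Program) (b : Polynomial ℕ),
    ∀ (n : ℕ) (G : SimpleGraph (Fin n)) (k : ℕ), IsCactus G →
      ∃ (s : Store) (t : ℕ), Exec prog (inputStore G k) s t ∧ t ≤ b.eval n ∧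
        (s.var 0 ≠ 0 ↔ (resultSet G Fin.val).card ≤ k) := by
  obtain ⟨T, hT⟩ := Context.Decides.card (S := fun p => resultSet (inputContext.graph p) Fin.val)
    Context.isVar_last.mem_resultSet
  -- Compiling with `k := 1` puts the cardinality into variable `3` and preserves variable `1`,
  -- which holds the bound; `1 - (card - k)` is nonzero exactly when `card ≤ k`.
  refine ⟨.seq (T.compile 1 0 1) (.assign 0 (.sub (.const 1) (.sub (.var 3) (.var 1)))),
    T.time + 6, fun n G k hG => ?_⟩
  obtain ⟨s, t, h, ht, hf, hv⟩ := T.exec_compile (adjInput G) (k := 1) Nat.one_pos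
    (represents_inputStore G k)
  refine ⟨_, _, .seq h (.assign _ _ _), ?_, ?_⟩
  · simp only [Expr.cost, Polynomial.eval_add, Polynomial.eval_ofNat]
    omega
  · have h3 : s.var 3 = (resultSet G Fin.val).card := hv.trans (hT ⟨n, G, hG⟩)
    have h1 : s.var 1 = k := hf.tmp 0 Nat.one_pos
    simp only [Function.update_self, Expr.eval, h3, h1]
    omega

theorem isMinimumStrongGeodeticSet_resultSet_val {n : ℕ} {G : SimpleGraph (Fin n)}
    (hG : IsCactus G) : IsMinimumStrongGeodeticSet G (resultSet G Fin.val) := by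
  obtain ⟨x⟩ := hG.1.nonempty
  exact isMinimumStrongGeodeticSet_resultSet hG Fin.val_injective ⟨⟨0, x.pos⟩, rfl⟩

end Programs

end StrongGeodetic

open StrongGeodetic in
theorem mainTheorem8 :
    -- correctness of the algorithm
    (∀ (V : Type u) [Fintype V] [DecidableEq V] (G : SimpleGraph V),
      IsCactus G → Nontrivial (CutTreeNode G) →
        (∃ S : Finset V, IsAlgorithmOutput G S) ∧
        ∀ S : Finset V, IsAlgorithmOutput G S → IsMinimumStrongGeodeticSet G S) ∧
    -- it runs in polynomial time, and minimum strong geodetic sets of cacti are found so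
    (∃ (prog : Program) (b : Polynomial ℕ), ∀ (n : ℕ) (G : SimpleGraph (Fin n)), IsCactus G →
      ∃ (s : Store) (t : ℕ), Exec prog (inputStore G 0) s t ∧ t ≤ b.eval n ∧
        IsMinimumStrongGeodeticSet G (outputSet n s) ∧
        (Nontrivial (CutTreeNode G) → IsAlgorithmOutput G (outputSet n s))) ∧
    -- the decision problem on cacti is solvable in polynomial time
    (∃ (prog : Program) (b : Polynomial ℕ), ∀ (n : ℕ) (G : SimpleGraph (Fin n)) (k : ℕ),
      IsCactus G →
      ∃ (s : Store) (t : ℕ), Exec prog (inputStore G k) s t ∧ t ≤ b.eval n ∧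
        (s.var 0 ≠ 0 ↔ ∃ S : Finset (Fin n), IsStrongGeodeticSet G S ∧ S.card ≤ k)) := by
  refine ⟨fun V _ _ G hG hT => ?_, ?_, ?_⟩
  · have hcut := exists_isCutVertex_of_nontrivial hG hT
    exact ⟨⟨_, isAlgorithmOutput_resultSet hG
      (Fin.val_injective.comp (Fintype.equivFin V).injective) hcut⟩,
      fun S hS => isMinimumStrongGeodeticSet_of_isAlgorithmOutput hG hcut hS⟩
  · obtain ⟨prog, b, h⟩ := exists_outputProgram
    refine ⟨prog, b, fun n G hG => ?_⟩
    obtain ⟨s, t, hexec, ht, hs⟩ := h n G hG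
    refine ⟨s, t, hexec, ht, ?_, fun hT => ?_⟩
    · rw [hs]
      exact isMinimumStrongGeodeticSet_resultSet_val hG
    · rw [hs]
      exact isAlgorithmOutput_resultSet hG Fin.val_injective (exists_isCutVertex_of_nontrivial hG hT)
  · obtain ⟨prog, b, h⟩ := exists_decisionProgram
    refine ⟨prog, b, fun n G k hG => ?_⟩
    obtain ⟨s, t, hexec, ht, hs⟩ := h n G k hG
    have hmin := isMinimumStrongGeodeticSet_resultSet_val hG
    exact ⟨s, t, hexec, ht, hs.trans
      ⟨fun hle => ⟨_, hmin.1, hle⟩, fun ⟨S, hS, hle⟩ => (hmin.2 S hS).trans hle⟩⟩
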